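/- For a finite set $Z\subset\mathbb{R}_{>0}$ let $\Sigma(Z)$ be the sum of its elements, and for finite $X,Y\subset\mathbb{R}_{>0}$ let $R(X,Y)=\max\{\Sigma(X)/\Sigma(Y),\,\Sigma(Y)/\Sigma(X)\}$, where $x/0=\infty$ for all $x\ge 0$. For a finite nonempty set $I\subset\mathbb{R}_{>0}$ let $$\mathrm{OPT}_{\mathrm L}(I)=\min\{R(X,Y) : X,Y\subseteq I \text{ disjoint},\ \max(I)\in X\cup Y\}.$$ The problem $\mathrm{SSR}_{\mathrm L}$ is: given a set $I\subset\mathbb{R}_{>0}$ of size $n\ge 2$ and a number $\varepsilon\in(0,1)$, compute disjoint subsets $X,Y\subseteq I$ with $R(X,Y)\le(1+\varepsilon)\,\mathrm{OPT}_{\mathrm L}(I)$ (the sets $X,Y$ need not contain $\max(I)$). Theorem. On the Real RAM with floor function (memory cells hold real numbers; the four arithmetic operations, the floor function, comparisons and indirect memory accesses take unit time; the items of $I$ are given as an array in arbitrary order, together with $n$ and $\varepsilon$), there is an algorithm that solves every $\mathrm{SSR}_{\mathrm L}$ instance $(I,\varepsilon)$ of size $n$ in time $\mathrm{poly}(n)\cdot(1/\varepsilon)^{0.93856}$.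 That is, there are a single program and constants $C,k$, independent of $I$, $n$ and $\varepsilon$, such that on every instance the program halts after at most $C\,n^{k}\,(1/\varepsilon)^{0.93856}$ steps with a correct output. -/

import Mathlib

open scoped ENNReal

namespace SubsetSumRatio

noncomputable section

/-- The quotient of two nonnegative reals with the convention `x / 0 = ∞` for all `x ≥ 0`
(including `0 / 0 = ∞`). -/
def quot (x y : ℝ) : ℝ≥0∞ := if y = 0 then ∞ else ENNReal.ofReal (x / y)

/-- `Σ(X)`. -/
def total (X : Finset ℝ) : ℝ := ∑ x ∈ X, x

/-- `R(X,Y) = max {Σ(X)/Σ(Y), Σ(Y)/Σ(X)}`. -/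
def ratio (X Y : Finset ℝ) : ℝ≥0∞ :=
  max (quot (total X) (total Y)) (quot (total Y) (total X))

/-- The pairs of disjoint subsets of `I` one of which contains the largest element of `I`. -/
def FeasibleL (I X Y : Finset ℝ) : Prop :=
  X ⊆ I ∧ Y ⊆ I ∧ Disjoint X Y ∧ ∃ z ∈ X ∪ Y, IsGreatest (I : Set ℝ) z

/-- `OPT_L(I)`. Only finitely many pairs are feasible, so for nonempty `I` the infimum is
a minimum. -/
def optL (I : Finset ℝ) : ℝ≥0∞ := sInf {r | ∃ X Y, FeasibleL I X Y ∧ r = ratio X Y}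

/-- `(X,Y)` is a correct answer to the instance `(I,ε)` of `SSR_L`. The sets `X`, `Y` are not
required to contain the largest element of `I`. -/
def IsSolutionL (I : Finset ℝ) (ε : ℝ) (X Y : Finset ℝ) : Prop :=
  X ⊆ I ∧ Y ⊆ I ∧ Disjoint X Y ∧ ratio X Y ≤ ENNReal.ofReal (1 + ε) * optL I

end

end SubsetSumRatio

/-! The Real RAM with floor function and unit costs. Programs are finite and structured; they
use integer constants only. -/

namespace RealRAM

noncomputable section

/-- The memory: cell `i` of array `A` holds the real number `m A i`. Array names occur
literally in a program, so a program uses only finitely many arrays, whereas indices are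
computed at run time. -/
abbrev Memory := ℕ → ℕ → ℝ

/-- Arithmetic expressions: constants, (indirect) memory access, the four arithmetic
operations, and the floor function. -/
inductive Expr where
  | const (c : ℤ)
  | read (A : ℕ) (i : Expr)
  | add (e f : Expr)
  | sub (e f : Expr)
  | mul (e f : Expr)
  | div (e f : Expr)
  | floor (e : Expr)

/-- The value of an expression. A real number used as an index is rounded down to a natural
number; division by `0` yields `0` (a program can test for this case). -/
def Expr.eval (m : Memory) : Expr → ℝ
  | .const c => (c : ℝ)
  | .read A i => m A ⌊i.eval m⌋₊
  | .add e f => e.eval m + f.eval m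
  | .sub e f => e.eval m - f.eval m
  | .mul e f => e.eval m * f.eval m
  | .div e f => e.eval m / f.eval m
  | .floor e => (⌊e.eval m⌋ : ℝ)

/-- The time to evaluate an expression: one unit for each operation in it. -/
def Expr.cost : Expr → ℕ
  | .const _ => 1
  | .read _ i => i.cost + 1
  | .add e f => e.cost + f.cost + 1
  | .sub e f => e.cost + f.cost + 1
  | .mul e f => e.cost + f.cost + 1
  | .div e f => e.cost + f.cost + 1
  | .floor e => e.cost + 1

/-- Tests: Boolean combinations of exact comparisons of real numbers. -/
inductive Test where
  | le (e f : Expr)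
  | not (b : Test)
  | and (b c : Test)

def Test.Holds (m : Memory) : Test → Prop
  | .le e f => e.eval m ≤ f.eval m
  | .not b => ¬ b.Holds m
  | .and b c => b.Holds m ∧ c.Holds m

def Test.cost : Test → ℕ
  | .le e f => e.cost + f.cost + 1
  | .not b => b.cost + 1
  | .and b c => b.cost + c.cost + 1

/-- Programs. -/
inductive Program where
  | skip
  | write (A : ℕ) (i e : Expr)
  | seq (p q : Program)
  | cond (b : Test) (p q : Program)
  | loop (b : Test) (p : Program)

/-- The memory after writing `x` into cell `i` of array `A`. -/
def Memory.set (m : Memory) (A i : ℕ) (x : ℝ) : Memory :=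
  Function.update m A (Function.update (m A) i x)

/-- `Runs p m t m'`: started on memory `m`, the program `p` halts after exactly `t` elementary
steps with memory `m'`. -/
inductive Runs : Program → Memory → ℕ → Memory → Prop where
  | skip (m : Memory) : Runs .skip m 1 m
  | write (m : Memory) (A : ℕ) (i e : Expr) :
      Runs (.write A i e) m (i.cost + e.cost + 1) (m.set A ⌊i.eval m⌋₊ (e.eval m))
  | seq {p q : Program} {m m₁ m₂ : Memory} {s t : ℕ} :
      Runs p m s m₁ → Runs q m₁ t m₂ → Runs (.seq p q) m (s + t) m₂
  | cond_true {b : Test} {p q : Program} {m m₁ : Memory} {t : ℕ} :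
      b.Holds m → Runs p m t m₁ → Runs (.cond b p q) m (b.cost + t) m₁
  | cond_false {b : Test} {p q : Program} {m m₁ : Memory} {t : ℕ} :
      ¬ b.Holds m → Runs q m t m₁ → Runs (.cond b p q) m (b.cost + t) m₁
  | loop_exit {b : Test} {p : Program} {m : Memory} :
      ¬ b.Holds m → Runs (.loop b p) m b.cost m
  | loop_step {b : Test} {p : Program} {m m₁ m₂ : Memory} {s t : ℕ} :
      b.Holds m → Runs p m s m₁ → Runs (.loop b p) m₁ t m₂ →
      Runs (.loop b p) m (b.cost + s + t) m₂

/-- The machine is deterministic: running time and final memory are functions of the program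
and the initial memory. -/
theorem Runs.unique {p : Program} {m m₁ m₂ : Memory} {s t : ℕ} (h₁ : Runs p m s m₁)
    (h₂ : Runs p m t m₂) : s = t ∧ m₁ = m₂ := by
  induction h₁ generalizing t m₂ with
  | skip m => cases h₂; exact ⟨rfl, rfl⟩
  | write m A i e => cases h₂; exact ⟨rfl, rfl⟩
  | seq _ _ ih₁ ih₂ =>
    cases h₂ with
    | seq h h' =>
      obtain ⟨rfl, rfl⟩ := ih₁ h
      obtain ⟨rfl, rfl⟩ := ih₂ h'
      exact ⟨rfl, rfl⟩
  | cond_true hb _ ih =>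
    cases h₂ with
    | cond_true _ h => obtain ⟨rfl, rfl⟩ := ih h; exact ⟨rfl, rfl⟩
    | cond_false hb' _ => exact absurd hb hb'
  | cond_false hb _ ih =>
    cases h₂ with
    | cond_true hb' _ => exact absurd hb' hb
    | cond_false _ h => obtain ⟨rfl, rfl⟩ := ih h; exact ⟨rfl, rfl⟩
  | loop_exit hb =>
    cases h₂ with
    | loop_exit _ => exact ⟨rfl, rfl⟩
    | loop_step hb' _ _ => exact absurd hb' hb
  | loop_step hb _ _ ih₁ ih₂ =>
    cases h₂ with
    | loop_exit hb' => exact absurd hb hb'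
    | loop_step _ h h' =>
      obtain ⟨rfl, rfl⟩ := ih₁ h
      obtain ⟨rfl, rfl⟩ := ih₂ h'
      exact ⟨rfl, rfl⟩

/-- The initial memory on items `a 0, …, a (n-1)` and accuracy `ε`: array `0` holds the items,
array `1` holds `n` and `ε` in its cells `0` and `1`, all other cells hold `0`. -/
def input {n : ℕ} (a : Fin n → ℝ) (ε : ℝ) : Memory := fun A i =>
  if A = 0 then (if h : i < n then a ⟨i, h⟩ else 0)
  else if A = 1 then (if i = 0 then (n : ℝ) else if i = 1 then ε else 0)
  else 0

open Classical in
/-- The set of those items that carry the label `v` in array `2` of the memory `m`. The output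
of a program is the pair of the items labelled `1` and the items labelled `2`. -/
def output {n : ℕ} (a : Fin n → ℝ) (m : Memory) (v : ℝ) : Finset ℝ :=
  (Finset.univ.filter fun i : Fin n => m 2 i = v).image a

end

end RealRAM

/-! Let `b 0 > b 1 > …` be the sorted items. A pair `(X, Y)` is a labelling with difference `d =
Σ(X) - Σ(Y)` and absolute sum `s = Σ(X) + Σ(Y)`. Its ratio is `(s + |d|) / (s - |d|)`, so the task
is to minimise the relative difference `|d| / s` up to an additive `O(ε)`; this is good enough as
long as the optimum stays away from `1`. If `b 0` is at least the sum of the other items, comparing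
it with all of them is optimal (`nearOptimal_of_large`). Otherwise a greedy pair has relative
difference at most `1/3` (`exists_balanced`).

An attempt with largest item `b i` and budget `B` rounds differences to buckets of width `ε b i /
(16 n)`. It lists the signed sums of `b i, b (i+1), …`, one per bucket with preference for large
`s`, until the list has more than `B` elements, at item `l`. A second list treats the items from `l`
on in the same way and ends at item `t`. Bisection over a two-pointer scan of both lists then
encloses the least relative difference on `[i, t)`. The attempt is accepted if this value is at most
`ε/4`, which alone guarantees ratio at most `1 + ε`, or if `i = 0` and `t = n`, when every labelling
using `b 0` has been considered. Every accepted attempt is therefore correct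
(`AttemptRes.nearOptimal`). Budgets are doubled until some `i` is accepted, so only the necessary
budget matters.

A budget `O(n⁴ M)` with `M = (1/ε)^(1940/2067)` is enough (`exists_suffices`). Let `3^l ≤ M <
3^(l+1)`, and let the large items, those of size at least `ε M b 0`, be the first `K`. The budget
admits `l + 1` items into the first list. If `K ≤ l + 1`, all remaining items are small, their
signed sums meet only `O(n² M)` buckets, and the attempt `i = 0` is exhaustive.

If `K > l + 1`, fix the least width `δ = ε (ε M b 0) / (16 n)` and count the pairs of a set of large
items and a bucket of subset sums of small items, within the first `j` items; let `k` be the number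
of large items and `q` the number of buckets, so that the count is `2^k q`. All sums lie in `N =
O(n² / (ε² M))` buckets. Once the count exceeds `N`, the pigeonhole principle gives two pairs of
nearly equal sum with different large parts (`exists_small_difference`), hence a tiny difference
whose largest item `b i` is large, and attempt `i` is accepted. Up to that moment the count is at
most `3 N`, and the second list meets at most `3 · 3^(k-l-1) q²` buckets
(`hasBuckets_of_subsetBuckets`), which is `O(4^k q² / 4^(l+1)) = O(n⁴ / (ε⁴ M² 4^(l+1)))`. This is
`O(n⁴ M)` as soon as `4^(l+1) M³ ε⁴ ≥ 1`. Since `4^(l+1) > M^(log₃ 4)`, the critical exponent is `4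
/ (3 + log₃ 4)`; replacing `log₃ 4` by the slightly smaller `612/485` gives `1940/2067 < 0.93856`,
and the remaining gap pays for the logarithmic number of bisection steps. -/

namespace RealRAM

/-! ### Reasoning about programs -/

theorem Memory.set_apply (m : Memory) (A i : ℕ) (x : ℝ) (B : ℕ) :
    m.set A i x B = if B = A then Function.update (m A) i x else m B := by
  unfold Memory.set
  by_cases h : B = A
  · subst h; simp
  · simp [h]

/-- The memory after running a program without loops. -/
noncomputable def Program.step : Program → Memory → Memory
  | .skip, m => m
  | .write A i e, m => m.set A ⌊i.eval m⌋₊ (e.eval m)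
  | .seq p q, m => q.step (p.step m)
  | .cond b p q, m => open Classical in if b.Holds m then p.step m else q.step m
  | .loop _ _, m => m

/-- A bound for the running time of a program without loops. -/
def Program.cost : Program → ℕ
  | .skip => 1
  | .write _ i e => i.cost + e.cost + 1
  | .seq p q => p.cost + q.cost
  | .cond b p q => b.cost + max p.cost q.cost
  | .loop b _ => b.cost

def Program.loopFree : Program → Bool
  | .skip => true
  | .write _ _ _ => true
  | .seq p q => p.loopFree && q.loopFree
  | .cond _ p q => p.loopFree && q.loopFree
  | .loop _ _ => false

theorem Program.runs_step (p : Program) (m : Memory) (h : p.loopFree = true) :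
    ∃ t, Runs p m t (p.step m) ∧ t ≤ p.cost := by
  induction p generalizing m with
  | skip => exact ⟨_, Runs.skip m, le_rfl⟩
  | write A i e => exact ⟨_, Runs.write m A i e, le_rfl⟩
  | seq p q ihp ihq =>
    simp only [Program.loopFree, Bool.and_eq_true] at h
    obtain ⟨s, hs, hs'⟩ := ihp m h.1
    obtain ⟨t, ht, ht'⟩ := ihq (p.step m) h.2
    exact ⟨_, Runs.seq hs ht, by simp only [Program.cost]; omega⟩
  | cond b p q ihp ihq =>
    simp only [Program.loopFree, Bool.and_eq_true] at h
    by_cases hb : b.Holds m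
    · obtain ⟨s, hs, hs'⟩ := ihp m h.1
      refine ⟨_, by simpa [Program.step, hb] using Runs.cond_true hb hs, ?_⟩
      simp only [Program.cost]; omega
    · obtain ⟨s, hs, hs'⟩ := ihq m h.2
      refine ⟨_, by simpa [Program.step, hb] using Runs.cond_false hb hs, ?_⟩
      simp only [Program.cost]; omega
  | loop b p => simp [Program.loopFree] at h

/-- The names of the arrays that a program may write to. -/
def Program.writes : Program → List ℕ
  | .skip => []
  | .write A _ _ => [A]
  | .seq p q => p.writes ++ q.writes
  | .cond _ p q => p.writes ++ q.writes
  | .loop _ p => p.writes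

/-- Array names are literals, so preservation of an array is a syntactic property, settled by
`decide` at each use. -/
theorem Runs.frame {p : Program} {m m' : Memory} {t : ℕ} (h : Runs p m t m') :
    ∀ A, A ∉ p.writes → m' A = m A := by
  induction h with
  | skip m => intros; rfl
  | write m A i e =>
    intro B hB
    simp only [Program.writes, List.mem_singleton] at hB
    simp [Memory.set_apply, hB]
  | seq _ _ ih₁ ih₂ =>
    intro A hA
    simp only [Program.writes, List.mem_append, not_or] at hA
    rw [ih₂ A hA.2, ih₁ A hA.1]
  | cond_true _ _ ih =>
    intro A hA
    simp only [Program.writes, List.mem_append, not_or] at hA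
    exact ih A hA.1
  | cond_false _ _ ih =>
    intro A hA
    simp only [Program.writes, List.mem_append, not_or] at hA
    exact ih A hA.2
  | loop_exit _ => intros; rfl
  | loop_step _ _ _ ih₁ ih₂ =>
    intro A hA
    rw [ih₂ A hA, ih₁ A hA]

/-- Started on `m`, the program `p` halts after at most `T` steps with a memory satisfying `Q`
that agrees with `m` outside of the arrays that `p` writes to. -/
def Tri (p : Program) (m : Memory) (T : ℝ) (Q : Memory → Prop) : Prop :=
  ∃ t m', Runs p m t m' ∧ (t : ℝ) ≤ T ∧ Q m' ∧ ∀ A, A ∉ p.writes → m' A = m A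

theorem Tri.of_runs {p : Program} {m m' : Memory} {t : ℕ} {T : ℝ} {Q : Memory → Prop}
    (h : Runs p m t m') (hT : (t : ℝ) ≤ T) (hQ : Q m') : Tri p m T Q :=
  ⟨t, m', h, hT, hQ, h.frame⟩

/-- For code without loops, `Program.step` replaces the relation `Runs` by a function that `simp`
can evaluate; the numeral `c` keeps the cost check decidable. -/
theorem Tri.straight {p : Program} {m : Memory} {T : ℝ} {Q : Memory → Prop}
    (h : p.loopFree = true) (c : ℕ) (hc : p.cost ≤ c) (hT : (c : ℝ) ≤ T) (hQ : Q (p.step m)) :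
    Tri p m T Q := by
  obtain ⟨t, ht, ht'⟩ := p.runs_step m h
  exact Tri.of_runs ht (le_trans (by exact_mod_cast ht'.trans hc) hT) hQ

theorem Tri.mono {p : Program} {m : Memory} {T T' : ℝ} {Q Q' : Memory → Prop}
    (h : Tri p m T Q) (hT : T ≤ T')
    (hQ : ∀ m', Q m' → (∀ A, A ∉ p.writes → m' A = m A) → Q' m') : Tri p m T' Q' := by
  obtain ⟨t, m', hr, ht, hq, hf⟩ := h
  exact ⟨t, m', hr, ht.trans hT, hQ m' hq hf, hf⟩

theorem Tri.seq {p q : Program} {m : Memory} {T₁ T₂ T : ℝ} {Q₁ Q : Memory → Prop}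
    (h₁ : Tri p m T₁ Q₁)
    (h₂ : ∀ m₁, Q₁ m₁ → (∀ A, A ∉ p.writes → m₁ A = m A) → Tri q m₁ T₂ Q)
    (hT : T₁ + T₂ ≤ T) : Tri (.seq p q) m T Q := by
  obtain ⟨t, m', hr, ht, hq, hf⟩ := h₁
  obtain ⟨s, m'', hr', hs, hq', _⟩ := h₂ m' hq hf
  exact Tri.of_runs (Runs.seq hr hr') (by push_cast; linarith) hq'

theorem Tri.cond {b : Test} {p q : Program} {m : Memory} {T T' : ℝ} {Q : Memory → Prop}
    (c : ℕ) (hc : b.cost ≤ c)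
    (h₁ : b.Holds m → Tri p m T Q) (h₂ : ¬ b.Holds m → Tri q m T Q) (hT : T + c ≤ T') :
    Tri (.cond b p q) m T' Q := by
  have hc' : (b.cost : ℝ) ≤ c := by exact_mod_cast hc
  by_cases hb : b.Holds m
  · obtain ⟨t, m', hr, ht, hq, hf⟩ := h₁ hb
    exact Tri.of_runs (Runs.cond_true hb hr) (by push_cast; linarith) hq
  · obtain ⟨t, m', hr, ht, hq, hf⟩ := h₂ hb
    exact Tri.of_runs (Runs.cond_false hb hr) (by push_cast; linarith) hq

/-- The rule for loops. Here `k` iterations remain at most, and `V k` bounds the remaining time. -/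
theorem Tri.loop_pot {b : Test} {p : Program} (V : ℕ → ℝ) (Inv : ℕ → Memory → Prop)
    (c : ℕ) (hc : b.cost ≤ c) (hV : ∀ k, (c : ℝ) ≤ V k)
    (step : ∀ k m, Inv k m → b.Holds m → ∃ T k', k' < k ∧ Tri p m T (Inv k') ∧
      T + c + V k' ≤ V k)
    (k : ℕ) (m : Memory) (h : Inv k m) :
    Tri (.loop b p) m (V k) (fun m' => (∃ k', Inv k' m') ∧ ¬ b.Holds m') := by
  have hc' : (b.cost : ℝ) ≤ c := by exact_mod_cast hc
  induction k using Nat.strong_induction_on generalizing m with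
  | _ k ih =>
    by_cases hb : b.Holds m
    · obtain ⟨T, k', hk, ⟨t, m', hr, ht, hq, -⟩, hT⟩ := step k m h hb
      obtain ⟨s, m'', hr', hs, hq', -⟩ := ih k' hk m' hq
      exact Tri.of_runs (Runs.loop_step hb hr hr') (by push_cast; linarith) hq'
    · exact Tri.of_runs (Runs.loop_exit hb) (hc'.trans (hV k)) ⟨⟨k, h⟩, hb⟩

theorem Tri.loop {b : Test} {p : Program} (T : ℝ) (hT : 0 ≤ T) (Inv : ℕ → Memory → Prop)
    (c : ℕ) (hc : b.cost ≤ c)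
    (step : ∀ k m, Inv k m → b.Holds m → ∃ k', k' < k ∧ Tri p m T (Inv k'))
    (k : ℕ) (m : Memory) (h : Inv k m) :
    Tri (.loop b p) m ((k : ℝ) * (T + c) + c)
      (fun m' => (∃ k', Inv k' m') ∧ ¬ b.Holds m') := by
  refine Tri.loop_pot (fun k => (k : ℝ) * (T + c) + c) Inv c hc (fun k => ?_)
    (fun k m hI hb => ?_) k m h
  · have : (0 : ℝ) ≤ (k : ℝ) * (T + c) := by positivity
    linarith
  · obtain ⟨k', hk, ht⟩ := step k m hI hb
    refine ⟨T, k', hk, ht, ?_⟩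
    have : (k' : ℝ) + 1 ≤ k := by exact_mod_cast hk
    have h0 : (0 : ℝ) ≤ T + c := by positivity
    nlinarith

/-- The scalar variable stored in cell `0` of array `x`. -/
abbrev var (x : ℕ) : Expr := .read x (.const 0)

/-- Assignment to a scalar variable. -/
abbrev assign (x : ℕ) (e : Expr) : Program := .write x (.const 0) e

abbrev Test.lt (e f : Expr) : Test := .not (.le f e)

/-- Equality of two numbers. -/
abbrev Test.eq (e f : Expr) : Test := .and (.le e f) (.le f e)

abbrev Test.or (b c : Test) : Test := .not (.and (.not b) (.not c))

abbrev one : Expr := .const 1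

abbrev zero : Expr := .const 0

end RealRAM

namespace SubsetSumRatio

/-! ### Signed sums and lists of signed sums -/

/-- The sign of a label: `1` puts an item into `X`, `2` puts it into `Y`. -/
def sgn (v : ℕ) : ℝ := if v = 1 then 1 else if v = 2 then -1 else 0

/-- A labelling of the items. -/
def Labels (w : ℕ → ℕ) : Prop := ∀ k, w k < 3

/-- `Σ(X) - Σ(Y)` for the items in `[s, e)`. -/
noncomputable def dsum (b : ℕ → ℝ) (w : ℕ → ℕ) (s e : ℕ) : ℝ :=
  ∑ k ∈ Finset.Ico s e, sgn (w k) * b k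

/-- `Σ(X) + Σ(Y)` for the items in `[s, e)`. -/
noncomputable def ssum (b : ℕ → ℝ) (w : ℕ → ℕ) (s e : ℕ) : ℝ :=
  ∑ k ∈ Finset.Ico s e, |sgn (w k)| * b k

/-- The labels of the items in `[s, e)`, written in base three. -/
def code (w : ℕ → ℕ) (s : ℕ) : ℕ → ℕ
  | 0 => 0
  | e + 1 => if e < s then 0 else 3 * code w s e + w e

theorem code_self (w : ℕ → ℕ) (s : ℕ) : code w s s = 0 := by
  cases s <;> simp [code]

theorem code_of_le (w : ℕ → ℕ) {s e : ℕ} (h : e ≤ s) : code w s e = 0 := by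
  cases e with
  | zero => rfl
  | succ e => simp [code, Nat.lt_of_succ_le h]

theorem code_succ (w : ℕ → ℕ) {s e : ℕ} (h : s ≤ e) :
    code w s (e + 1) = 3 * code w s e + w e := by
  simp [code, Nat.not_lt.mpr h]

theorem dsum_succ (b : ℕ → ℝ) (w : ℕ → ℕ) {s e : ℕ} (h : s ≤ e) :
    dsum b w s (e + 1) = dsum b w s e + sgn (w e) * b e :=
  Finset.sum_Ico_succ_top h _

theorem ssum_succ (b : ℕ → ℝ) (w : ℕ → ℕ) {s e : ℕ} (h : s ≤ e) :
    ssum b w s (e + 1) = ssum b w s e + |sgn (w e)| * b e :=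
  Finset.sum_Ico_succ_top h _

theorem dsum_congr {b : ℕ → ℝ} {w w' : ℕ → ℕ} {s e : ℕ}
    (h : ∀ k, s ≤ k → k < e → w k = w' k) : dsum b w s e = dsum b w' s e :=
  Finset.sum_congr rfl fun k hk => by
    rw [Finset.mem_Ico] at hk; rw [h k hk.1 hk.2]

theorem ssum_congr {b : ℕ → ℝ} {w w' : ℕ → ℕ} {s e : ℕ}
    (h : ∀ k, s ≤ k → k < e → w k = w' k) : ssum b w s e = ssum b w' s e :=
  Finset.sum_congr rfl fun k hk => by
    rw [Finset.mem_Ico] at hk; rw [h k hk.1 hk.2]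

theorem code_congr {w w' : ℕ → ℕ} {s e : ℕ}
    (h : ∀ k, s ≤ k → k < e → w k = w' k) : code w s e = code w' s e := by
  induction e with
  | zero => rfl
  | succ e ih =>
    by_cases hs : e < s
    · simp [code, hs]
    · rw [code_succ w (not_lt.mp hs), code_succ w' (not_lt.mp hs),
        ih fun k h1 h2 => h k h1 (by omega), h e (not_lt.mp hs) (by omega)]

theorem Labels.update {w : ℕ → ℕ} (hw : Labels w) (e : ℕ) {v : ℕ} (hv : v < 3) :
    Labels (Function.update w e v) := by
  intro k
  by_cases h : k = e
  · subst h; simpa using hv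
  · simpa [h] using hw k

/-- The cells `[p, q)` of the arrays `d`, `s`, `c` hold a list of triples `(Σ(X)-Σ(Y), Σ(X)+Σ(Y),
code)` of labellings of the items in `[st, e)`, sorted by their first components, no two of which
share a `δ`-bucket. Every labelling is represented up to an error of `err`. -/
structure SumList (b : ℕ → ℝ) (δ : ℝ) (Adm : (ℕ → ℕ) → Prop) (st e : ℕ) (err : ℝ)
    (d s c : ℕ → ℝ) (p q : ℕ) : Prop where
  lt : p < q
  sound : ∀ x, p ≤ x → x < q → ∃ w, Labels w ∧ Adm w ∧ d x = dsum b w st e ∧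
    s x = ssum b w st e ∧ c x = code w st e
  complete : ∀ w, Labels w → Adm w → ∃ x, p ≤ x ∧ x < q ∧ |d x - dsum b w st e| ≤ err ∧
    ssum b w st e ≤ s x
  sorted : ∀ x y, p ≤ x → x < y → y < q → ⌊d x / δ⌋ < ⌊d y / δ⌋

theorem lt_of_floor_div_lt {x y δ : ℝ} (hδ : 0 < δ) (h : ⌊x / δ⌋ < ⌊y / δ⌋) : x < y := by
  by_contra hxy
  exact absurd h (not_lt.mpr (Int.floor_le_floor (div_le_div_of_nonneg_right (not_lt.mp hxy) hδ.le)))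

theorem floor_div_mono {x y δ : ℝ} (hδ : 0 < δ) (h : x ≤ y) : ⌊x / δ⌋ ≤ ⌊y / δ⌋ :=
  Int.floor_le_floor (div_le_div_of_nonneg_right h hδ.le)

theorem abs_sub_le_of_floor_div_eq {x y δ : ℝ} (hδ : 0 < δ) (h : ⌊x / δ⌋ = ⌊y / δ⌋) :
    |x - y| ≤ δ := by
  have := (Int.abs_sub_lt_one_of_floor_eq_floor h).le
  rw [← sub_div, abs_div, abs_of_pos hδ, div_le_one hδ] at this
  exact this

/-- The invariant of the loop that merges the three translates of a list `D`, `S`, `C` on `[p, q)`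
by `sgn v * a` into a list that starts in cell `q + 1`; here `P v` is the position reached in the
translate of label `v`, and `o` is the end of the output. -/
structure MergeInv (δ a : ℝ) (D S C : ℕ → ℝ) (p q : ℕ) (d s c : ℕ → ℝ) (P : ℕ → ℕ) (o : ℕ) :
    Prop where
  same : ∀ x, x < q → d x = D x ∧ s x = S x ∧ c x = C x
  sentinel : d q = D (q - 1) + 3 * a
  bound : ∀ v, v < 3 → p ≤ P v ∧ P v ≤ q
  le_o : q + 1 ≤ o
  cover : ∀ v, v < 3 → ∀ x, p ≤ x → x < P v →
    ∃ y, q + 1 ≤ y ∧ y < o ∧ ⌊d y / δ⌋ = ⌊(D x + sgn v * a) / δ⌋ ∧ S x + |sgn v| * a ≤ s y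
  sound : ∀ y, q + 1 ≤ y → y < o → ∃ x v, p ≤ x ∧ x < q ∧ v < 3 ∧ d y = D x + sgn v * a ∧
    s y = S x + |sgn v| * a ∧ c y = 3 * C x + v
  sorted : ∀ x y, q + 1 ≤ x → x < y → y < o → ⌊d x / δ⌋ < ⌊d y / δ⌋
  below : ∀ y, q + 1 ≤ y → y < o → ∀ v, v < 3 → P v < q →
    ⌊d y / δ⌋ ≤ ⌊(D (P v) + sgn v * a) / δ⌋

/-! ### Correctness of the merging step, independently of the machine -/

section Merge

variable {δ a : ℝ} {D S C d s c : ℕ → ℝ} {p q o v : ℕ} {P : ℕ → ℕ}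

theorem MergeInv.init (hpq : p < q) (hd : ∀ x, x < q → d x = D x ∧ s x = S x ∧ c x = C x)
    (hs : d q = D (q - 1) + 3 * a) (hP : ∀ v, v < 3 → P v = p) :
    MergeInv δ a D S C p q d s c P (q + 1) where
  same := hd
  sentinel := hs
  bound v hv := by rw [hP v hv]; exact ⟨le_rfl, hpq.le⟩
  le_o := le_rfl
  cover v hv x h1 h2 := by rw [hP v hv] at h2; omega
  sound y h1 h2 := by omega
  sorted x y h1 h2 h3 := by omega
  below y h1 h2 := by omega

/-- The selected head is minimal, and advancing it in a sorted list only increases it, so all later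
heads lie at or above it. -/
theorem MergeInv.below_head (hδ : 0 < δ)
    (hsort : ∀ x y, p ≤ x → x < y → y < q → D x < D y)
    (h : MergeInv δ a D S C p q d s c P o) (hv : v < 3)
    (hmin : ∀ v', v' < 3 → P v' < q → D (P v) + sgn v * a ≤ D (P v') + sgn v' * a)
    {x : ℝ} (hx : ⌊x / δ⌋ ≤ ⌊(D (P v) + sgn v * a) / δ⌋) (v' : ℕ) (hv' : v' < 3)
    (hq : Function.update P v (P v + 1) v' < q) :
    ⌊x / δ⌋ ≤ ⌊(D (Function.update P v (P v + 1) v') + sgn v' * a) / δ⌋ := by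
  refine hx.trans (floor_div_mono hδ ?_)
  by_cases hvv : v' = v
  · subst hvv
    simp only [Function.update_self] at hq ⊢
    have := hsort (P v') (P v' + 1) (h.bound v' hv).1 (by omega) hq
    linarith
  · simp only [Function.update_of_ne hvv] at hq ⊢
    exact hmin v' hv' hq

/-- Nothing is written: an output element in the same bucket with at least the same absolute sum
already represents the selected head. -/
theorem MergeInv.skip (hδ : 0 < δ)
    (hsort : ∀ x y, p ≤ x → x < y → y < q → D x < D y)
    (h : MergeInv δ a D S C p q d s c P o) (hv : v < 3) (hvq : P v < q)
    (hmin : ∀ v', v' < 3 → P v' < q → D (P v) + sgn v * a ≤ D (P v') + sgn v' * a)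
    {y : ℕ} (hy : q + 1 ≤ y) (hyo : y < o)
    (hfl : ⌊d y / δ⌋ = ⌊(D (P v) + sgn v * a) / δ⌋) (hle : S (P v) + |sgn v| * a ≤ s y) :
    MergeInv δ a D S C p q d s c (Function.update P v (P v + 1)) o where
  same := h.same
  sentinel := h.sentinel
  bound v' hv' := by
    by_cases hvv : v' = v
    · subst hvv; have := h.bound v' hv; simp only [Function.update_self]; omega
    · simpa [hvv] using h.bound v' hv'
  le_o := h.le_o
  cover v' hv' x h1 h2 := by
    by_cases hvv : v' = v
    · subst hvv
      simp only [Function.update_self] at h2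
      rcases Nat.lt_succ_iff_lt_or_eq.mp h2 with h3 | h3
      · exact h.cover v' hv x h1 h3
      · subst h3; exact ⟨y, hy, hyo, hfl, hle⟩
    · simp only [Function.update_of_ne hvv] at h2
      exact h.cover v' hv' x h1 h2
  sound := h.sound
  sorted := h.sorted
  below y' h1 h2 v' hv' hq' :=
    h.below_head hδ hsort hv hmin (h.below y' h1 h2 v hv hvq) v' hv' hq'

/-- Appending is the case `y₀ = o`, overwriting the last output the case `y₀ = o - 1`. An
overwritten element stays covered, because its successor lies in the same bucket and has no smaller
absolute sum. -/
theorem MergeInv.write (hδ : 0 < δ)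
    (hsort : ∀ x y, p ≤ x → x < y → y < q → D x < D y)
    (h : MergeInv δ a D S C p q d s c P o) (hv : v < 3) (hvq : P v < q)
    (hmin : ∀ v', v' < 3 → P v' < q → D (P v) + sgn v * a ≤ D (P v') + sgn v' * a)
    {y₀ : ℕ} {e f g : ℝ} (he : e = D (P v) + sgn v * a) (hf : f = S (P v) + |sgn v| * a)
    (hg : g = 3 * C (P v) + v) (hy : q + 1 ≤ y₀) (hyo : y₀ ≤ o)
    (hold : ∀ y, q + 1 ≤ y → y < o → (y < y₀ ∧ ⌊d y / δ⌋ < ⌊e / δ⌋) ∨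
      (y = y₀ ∧ ⌊d y / δ⌋ = ⌊e / δ⌋ ∧ s y ≤ f)) :
    MergeInv δ a D S C p q (Function.update d y₀ e) (Function.update s y₀ f)
      (Function.update c y₀ g) (Function.update P v (P v + 1)) (y₀ + 1) where
  same x hx := by
    have : x ≠ y₀ := by omega
    simpa [this] using h.same x hx
  sentinel := by
    have : q ≠ y₀ := by omega
    simpa [this] using h.sentinel
  bound v' hv' := by
    by_cases hvv : v' = v
    · subst hvv; have := h.bound v' hv; simp only [Function.update_self]; omega
    · simpa [hvv] using h.bound v' hv'
  le_o := by omega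
  cover v' hv' x h1 h2 := by
    have key : (∃ y, q + 1 ≤ y ∧ y < o ∧ ⌊d y / δ⌋ = ⌊(D x + sgn v' * a) / δ⌋ ∧
        S x + |sgn v'| * a ≤ s y) ∨ (v' = v ∧ x = P v) := by
      by_cases hvv : v' = v
      · subst hvv
        simp only [Function.update_self] at h2
        rcases Nat.lt_succ_iff_lt_or_eq.mp h2 with h3 | h3
        · exact Or.inl (h.cover v' hv x h1 h3)
        · exact Or.inr ⟨rfl, h3⟩
      · simp only [Function.update_of_ne hvv] at h2
        exact Or.inl (h.cover v' hv' x h1 h2)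
    rcases key with ⟨y, hy1, hy2, hy3, hy4⟩ | ⟨rfl, rfl⟩
    · rcases hold y hy1 hy2 with ⟨h5, -⟩ | ⟨h5, h6, h7⟩
      · refine ⟨y, hy1, by omega, ?_⟩
        simpa [h5.ne] using ⟨hy3, hy4⟩
      · refine ⟨y₀, hy, by omega, ?_⟩
        simp only [Function.update_self]
        exact ⟨by rw [← h6, hy3], hy4.trans h7⟩
    · refine ⟨y₀, hy, by omega, ?_⟩
      simp only [Function.update_self]
      exact ⟨by rw [he], hf.ge⟩
  sound y h1 h2 := by
    rcases Nat.lt_succ_iff_lt_or_eq.mp h2 with h3 | h3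
    · simpa [h3.ne] using h.sound y h1 (by omega)
    · subst h3
      simp only [Function.update_self]
      exact ⟨P v, v, (h.bound v hv).1, hvq, hv, he, hf, hg⟩
  sorted x y h1 h2 h3 := by
    have hx : x ≠ y₀ := by omega
    rcases Nat.lt_succ_iff_lt_or_eq.mp h3 with h4 | h4
    · simpa [hx, h4.ne] using h.sorted x y h1 h2 (by omega)
    · subst h4
      rcases hold x h1 (by omega) with ⟨-, h5⟩ | ⟨h5, -⟩
      · simpa [hx] using h5
      · omega
  below y h1 h2 v' hv' hq' := by
    refine h.below_head hδ hsort hv hmin ?_ v' hv' hq'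
    rcases Nat.lt_succ_iff_lt_or_eq.mp h2 with h3 | h3
    · simpa [h3.ne] using h.below y h1 (by omega) v hv hvq
    · subst h3; simp [he]

/-- An element of minimal key is not the sentinel. -/
theorem MergeInv.head_lt (ha : 0 < a)
    (hsort : ∀ x y, p ≤ x → x < y → y < q → D x < D y)
    (h : MergeInv δ a D S C p q d s c P o)
    (hmin : ∀ v', v' < 3 → d (P v) + sgn v * a ≤ d (P v') + sgn v' * a)
    (hv : v < 3) (hne : ∃ v', v' < 3 ∧ P v' < q) :
    P v < q := by
  by_contra hcon
  have hPv : P v = q := by have := (h.bound v hv).2; omega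
  obtain ⟨v', hv', hlt⟩ := hne
  have h1 := hmin v' hv'
  rw [hPv, h.sentinel, (h.same _ hlt).1] at h1
  have h2 : D (P v') ≤ D (q - 1) := by
    rcases Nat.lt_or_ge (P v') (q - 1) with h3 | h3
    · exact (hsort _ _ (h.bound v' hv').1 h3 (by omega)).le
    · have : P v' = q - 1 := by omega
      rw [this]
  -- A shifted sentinel is at least `D (q - 1) + 2 * a`, while every genuine head is at most `D (q -
  -- 1) + a`.
  have h3 : ∀ u, -1 ≤ sgn u ∧ sgn u ≤ 1 := by
    intro u; unfold sgn; split_ifs <;> norm_num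
  have h4 := (h3 v).1
  have h5 := (h3 v').2
  nlinarith

/-- Each labelling of `[st, e]` extends one of `[st, e)`, whose representative is shifted and then
possibly replaced by another member of its bucket. The replacement costs at most `δ`, once per item.
-/
theorem SumList.merge {b : ℕ → ℝ} {Adm : (ℕ → ℕ) → Prop} {st e : ℕ} {err : ℝ}
    (hδ : 0 < δ) (hst : st ≤ e)
    (hAdm : ∀ w v, v < 3 → Adm w → Adm (Function.update w e v))
    (hL : SumList b δ Adm st e err D S C p q)
    (h : MergeInv δ (b e) D S C p q d s c P o) (hP : ∀ v, v < 3 → P v = q) :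
    SumList b δ Adm st (e + 1) (err + δ) d s c (q + 1) o where
  lt := by
    obtain ⟨y, h1, h2, -⟩ := h.cover 0 (by norm_num) p le_rfl (by
      rw [hP 0 (by norm_num)]; exact hL.lt)
    omega
  sound y h1 h2 := by
    obtain ⟨x, v, hx1, hx2, hv, e1, e2, e3⟩ := h.sound y h1 h2
    obtain ⟨w, hw, hA, f1, f2, f3⟩ := hL.sound x hx1 hx2
    have hc : ∀ k, st ≤ k → k < e → Function.update w e v k = w k := fun k _ hk => by
      simp [hk.ne]
    refine ⟨Function.update w e v, hw.update e hv, hAdm w v hv hA, ?_, ?_, ?_⟩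
    · rw [dsum_succ _ _ hst, dsum_congr hc, Function.update_self, e1, f1]
    · rw [ssum_succ _ _ hst, ssum_congr hc, Function.update_self, e2, f2]
    · rw [code_succ _ hst, code_congr hc, Function.update_self, e3, f3]
      push_cast; ring
  complete w hw hA := by
    obtain ⟨x, h1, h2, h3, h4⟩ := hL.complete w hw hA
    obtain ⟨y, g1, g2, g3, g4⟩ := h.cover (w e) (hw e) x h1 (by rw [hP _ (hw e)]; exact h2)
    refine ⟨y, g1, g2, ?_, ?_⟩
    · rw [dsum_succ _ _ hst]
      have := abs_sub_le_of_floor_div_eq hδ g3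
      have e1 : d y - (dsum b w st e + sgn (w e) * b e) =
        (d y - (D x + sgn (w e) * b e)) + (D x - dsum b w st e) := by ring
      rw [e1]
      exact (abs_add_le _ _).trans (by linarith)
    · rw [ssum_succ _ _ hst]; linarith
  sorted := h.sorted

theorem SumList.sorted_lt {b : ℕ → ℝ} {Adm : (ℕ → ℕ) → Prop} {st e : ℕ} {err : ℝ} (hδ : 0 < δ)
    (hL : SumList b δ Adm st e err D S C p q) (x y : ℕ) (h1 : p ≤ x) (h2 : x < y) (h3 : y < q) :
    D x < D y :=
  lt_of_floor_div_lt hδ (hL.sorted x y h1 h2 h3)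

end Merge

end SubsetSumRatio

namespace RealRAM
open SubsetSumRatio

infixr:60 " ;; " => Program.seq

@[simp] theorem eval_const (m : Memory) (c : ℤ) : (Expr.const c).eval m = c := rfl
@[simp] theorem eval_read (m : Memory) (A : ℕ) (i : Expr) :
    (Expr.read A i).eval m = m A ⌊i.eval m⌋₊ := rfl
@[simp] theorem eval_add (m : Memory) (e f : Expr) :
    (Expr.add e f).eval m = e.eval m + f.eval m := rfl
@[simp] theorem eval_sub (m : Memory) (e f : Expr) :
    (Expr.sub e f).eval m = e.eval m - f.eval m := rfl
@[simp] theorem eval_mul (m : Memory) (e f : Expr) :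
    (Expr.mul e f).eval m = e.eval m * f.eval m := rfl
@[simp] theorem eval_div (m : Memory) (e f : Expr) :
    (Expr.div e f).eval m = e.eval m / f.eval m := rfl
@[simp] theorem eval_floor (m : Memory) (e : Expr) :
    (Expr.floor e).eval m = (⌊e.eval m⌋ : ℝ) := rfl
@[simp] theorem holds_le (m : Memory) (e f : Expr) :
    (Test.le e f).Holds m ↔ e.eval m ≤ f.eval m := Iff.rfl
@[simp] theorem holds_not (m : Memory) (b : Test) : (Test.not b).Holds m ↔ ¬ b.Holds m := Iff.rfl
@[simp] theorem holds_and (m : Memory) (b c : Test) :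
    (Test.and b c).Holds m ↔ b.Holds m ∧ c.Holds m := Iff.rfl
@[simp] theorem step_skip (m : Memory) : Program.skip.step m = m := rfl
@[simp] theorem step_write (m : Memory) (A : ℕ) (i e : Expr) :
    (Program.write A i e).step m = m.set A ⌊i.eval m⌋₊ (e.eval m) := rfl
@[simp] theorem step_seq (m : Memory) (p q : Program) :
    (Program.seq p q).step m = q.step (p.step m) := rfl
theorem step_cond_true {m : Memory} {b : Test} (p q : Program) (h : b.Holds m) :
    (Program.cond b p q).step m = p.step m := by simp [Program.step, h]
theorem step_cond_false {m : Memory} {b : Test} (p q : Program) (h : ¬ b.Holds m) :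
    (Program.cond b p q).step m = q.step m := by simp [Program.step, h]

theorem floor_natCast_sub_one (n : ℕ) : ⌊(n : ℝ) - 1⌋₊ = n - 1 := by
  rcases n with _ | n
  · simp
  · push_cast; simp

@[simp] theorem sgn_zero : sgn 0 = 0 := by norm_num [sgn]
@[simp] theorem sgn_one : sgn 1 = 1 := by norm_num [sgn]
@[simp] theorem sgn_two : sgn 2 = -1 := by norm_num [sgn]

/-! ### Merging the three translates of a list -/

/-- Take the head of the translate with label `v`, whose shift is the value of `sh` and whose
absolute shift is the value of `ab`, into the variables `26`, `27`, `28`. -/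
def takeHead (v : ℕ) (sh ab : Expr) : Program :=
  assign 26 (.add (.read 5 (var (23 + v))) sh) ;;
  assign 27 (.add (.read 6 (var (23 + v))) ab) ;;
  assign 28 (.add (.mul (.const 3) (.read 7 (var (23 + v)))) (.const v)) ;;
  assign (23 + v) (.add (var (23 + v)) one)

/-- During a merge, variable 20 holds the item `a`, 21 and 22 the start and end of the output, 23 to
25 the heads of the translates by `0`, `a`, `-a`, 26 to 28 the selected triple, and 29 the bucket
width. -/
def selectHead : Program :=
  .cond (.and
      (.le (.add (.read 5 (var 24)) (var 20)) (.read 5 (var 23)))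
      (.le (.add (.read 5 (var 24)) (var 20)) (.sub (.read 5 (var 25)) (var 20))))
    (takeHead 1 (var 20) (var 20))
    (.cond (.le (.read 5 (var 23)) (.sub (.read 5 (var 25)) (var 20)))
      (takeHead 0 zero zero)
      (takeHead 2 (.sub zero (var 20)) (var 20)))

/-- Write the triple in the variables `26`, `27`, `28` into cell `45`. -/
def putTriple : Program :=
  .write 5 (var 45) (var 26) ;; .write 6 (var 45) (var 27) ;; .write 7 (var 45) (var 28)

/-- Of two triples in a common bucket, the one with the larger absolute sum survives: at nearly
equal difference it has the smaller relative difference. -/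
def emitHead : Program :=
  .cond (.and (.lt (var 21) (var 22))
      (.eq (.floor (.div (.read 5 (.sub (var 22) one)) (var 29)))
        (.floor (.div (var 26) (var 29)))))
    (assign 45 (.sub (var 22) one) ;;
      .cond (.lt (.read 6 (var 45)) (var 27)) putTriple .skip)
    (assign 45 (var 22) ;; putTriple ;; assign 22 (.add (var 22) one))

def mergeBody : Program := selectHead ;; emitHead

/-- No head exceeds the end of the list in variable 18, so the sum of the heads reaches three times
that value exactly when all translates are exhausted. -/
def mergeLoop : Program :=
  .loop (.lt (.add (.add (var 23) (var 24)) (var 25)) (.mul (.const 3) (var 18))) mergeBody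

theorem selectHead_step (m : Memory) (P : ℕ → ℕ) (a : ℝ)
    (hP : ∀ v, v < 3 → m (23 + v) 0 = P v) (ha : m 20 0 = a) :
    ∃ v, v < 3 ∧ (∀ v', v' < 3 → m 5 (P v) + sgn v * a ≤ m 5 (P v') + sgn v' * a) ∧
      (selectHead.step m) 26 0 = m 5 (P v) + sgn v * a ∧
      (selectHead.step m) 27 0 = m 6 (P v) + |sgn v| * a ∧
      (selectHead.step m) 28 0 = 3 * m 7 (P v) + v ∧
      (∀ v', v' < 3 → (selectHead.step m) (23 + v') 0 = Function.update P v (P v + 1) v') ∧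
      (∀ A, A ∉ [23, 24, 25, 26, 27, 28] → (selectHead.step m) A = m A) := by
  have h0 : m 23 0 = P 0 := hP 0 (by norm_num)
  have h1 : m 24 0 = P 1 := hP 1 (by norm_num)
  have h2 : m 25 0 = P 2 := hP 2 (by norm_num)
  by_cases c1 : m 5 (P 1) + a ≤ m 5 (P 0) ∧ m 5 (P 1) + a ≤ m 5 (P 2) - a
  · refine ⟨1, by norm_num, ?_, ?_⟩
    · intro v' hv'
      interval_cases v' <;> simp <;> linarith
    · rw [selectHead, step_cond_true _ _ (by simpa [h0, h1, h2, ha] using c1)]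
      refine ⟨?_, ?_, ?_, ?_, ?_⟩
      · simp [takeHead, Memory.set_apply, h1, ha]
      · simp [takeHead, Memory.set_apply, h1, ha]
      · simp [takeHead, Memory.set_apply, h1, ha]
      · intro v' hv'
        interval_cases v' <;> simp [takeHead, Memory.set_apply, h0, h1, h2]
      · intro A hA
        simp only [List.mem_cons, List.not_mem_nil, or_false, not_or] at hA
        simp [takeHead, Memory.set_apply, hA]
  · by_cases c2 : m 5 (P 0) ≤ m 5 (P 2) - a
    · refine ⟨0, by norm_num, ?_, ?_⟩
      · intro v' hv'
        rw [not_and_or] at c1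
        interval_cases v' <;> simp <;> rcases c1 with c1 | c1 <;> linarith
      · rw [selectHead, step_cond_false _ _ (by simpa [h0, h1, h2, ha] using c1),
          step_cond_true _ _ (by simpa [h0, h1, h2, ha] using c2)]
        refine ⟨?_, ?_, ?_, ?_, ?_⟩
        · simp [takeHead, Memory.set_apply, h0]
        · simp [takeHead, Memory.set_apply, h0]
        · simp [takeHead, Memory.set_apply, h0]
        · intro v' hv'
          interval_cases v' <;> simp [takeHead, Memory.set_apply, h0, h1, h2]
        · intro A hA
          simp only [List.mem_cons, List.not_mem_nil, or_false, not_or] at hA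
          simp [takeHead, Memory.set_apply, hA]
    · refine ⟨2, by norm_num, ?_, ?_⟩
      · intro v' hv'
        rw [not_and_or] at c1
        interval_cases v' <;> simp <;> rcases c1 with c1 | c1 <;> linarith
      · rw [selectHead, step_cond_false _ _ (by simpa [h0, h1, h2, ha] using c1),
          step_cond_false _ _ (by simpa [h0, h1, h2, ha] using c2)]
        refine ⟨?_, ?_, ?_, ?_, ?_⟩
        · simp [takeHead, Memory.set_apply, h2, ha]
        · simp [takeHead, Memory.set_apply, h2, ha]
        · simp [takeHead, Memory.set_apply, h2]
        · intro v' hv'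
          interval_cases v' <;> simp [takeHead, Memory.set_apply, h0, h1, h2]
        · intro A hA
          simp only [List.mem_cons, List.not_mem_nil, or_false, not_or] at hA
          simp [takeHead, Memory.set_apply, hA]

theorem emitHead_step (m : Memory) (o q : ℕ) (δ : ℝ) (h22 : m 22 0 = o)
    (h21 : m 21 0 = (q : ℝ) + 1) (h29 : m 29 0 = δ) :
    (q + 1 < o ∧ ⌊m 5 (o - 1) / δ⌋ = ⌊m 26 0 / δ⌋ ∧ m 27 0 ≤ m 6 (o - 1) ∧
      ∀ A, A ≠ 45 → (emitHead.step m) A = m A) ∨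
    ∃ y₀, (emitHead.step m) 5 = Function.update (m 5) y₀ (m 26 0) ∧
      (emitHead.step m) 6 = Function.update (m 6) y₀ (m 27 0) ∧
      (emitHead.step m) 7 = Function.update (m 7) y₀ (m 28 0) ∧
      (emitHead.step m) 22 0 = (y₀ : ℝ) + 1 ∧
      (∀ A, A ∉ [5, 6, 7, 22, 45] → (emitHead.step m) A = m A) ∧
      ((q + 1 < o ∧ y₀ + 1 = o ∧ ⌊m 5 (o - 1) / δ⌋ = ⌊m 26 0 / δ⌋ ∧ m 6 (o - 1) ≤ m 27 0) ∨
        (y₀ = o ∧ ¬ (q + 1 < o ∧ ⌊m 5 (o - 1) / δ⌋ = ⌊m 26 0 / δ⌋))) := by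
  have hlt : (q : ℝ) + 1 < o ↔ q + 1 < o := by exact_mod_cast Iff.rfl
  have hfl : ⌊(o : ℝ) - 1⌋₊ = o - 1 := floor_natCast_sub_one o
  by_cases c1 : q + 1 < o ∧ ⌊m 5 (o - 1) / δ⌋ = ⌊m 26 0 / δ⌋
  · have hb : (Test.and (.lt (var 21) (var 22))
      (.eq (.floor (.div (.read 5 (.sub (var 22) one)) (var 29)))
        (.floor (.div (var 26) (var 29))))).Holds m := by
      simp [h22, h21, h29, hfl, hlt, c1.1, c1.2]
    by_cases c2 : m 6 (o - 1) < m 27 0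
    · right
      refine ⟨o - 1, ?_⟩
      have ho : ((o - 1 : ℕ) : ℝ) + 1 = o := by
        exact_mod_cast Nat.sub_add_cancel (by omega : 1 ≤ o)
      rw [emitHead, step_cond_true _ _ hb, step_seq,
        step_cond_true _ _ (by simpa [Memory.set_apply, h22, hfl] using c2)]
      refine ⟨?_, ?_, ?_, ?_, ?_, Or.inl ⟨c1.1, by omega, c1.2, c2.le⟩⟩
      · simp [putTriple, Memory.set_apply, h22, hfl]
      · simp [putTriple, Memory.set_apply, h22, hfl]
      · simp [putTriple, Memory.set_apply, h22, hfl]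
      · simp [putTriple, Memory.set_apply, h22, ho]
      · intro A hA
        simp only [List.mem_cons, List.not_mem_nil, or_false, not_or] at hA
        simp [putTriple, Memory.set_apply, hA]
    · left
      refine ⟨c1.1, c1.2, not_lt.mp c2, ?_⟩
      rw [emitHead, step_cond_true _ _ hb, step_seq,
        step_cond_false _ _ (by simpa [Memory.set_apply, h22, hfl] using c2)]
      intro A hA
      simp [Memory.set_apply, hA]
  · right
    refine ⟨o, ?_⟩
    rw [emitHead, step_cond_false _ _ (by
      simp only [holds_and, holds_not, holds_le, eval_read, eval_const, eval_floor, eval_div,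
        eval_sub, Int.cast_zero, Nat.floor_zero, Int.cast_one, h22, h21, h29, hfl, not_le, hlt]
      rintro ⟨g1, g2, g3⟩
      exact c1 ⟨g1, by exact_mod_cast le_antisymm g2 g3⟩)]
    refine ⟨?_, ?_, ?_, ?_, ?_, Or.inr ⟨rfl, c1⟩⟩
    · simp [putTriple, Memory.set_apply, h22]
    · simp [putTriple, Memory.set_apply, h22]
    · simp [putTriple, Memory.set_apply, h22]
    · simp [putTriple, Memory.set_apply, h22]
    · intro A hA
      simp only [List.mem_cons, List.not_mem_nil, or_false, not_or] at hA
      simp [putTriple, Memory.set_apply, hA]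

/-- The memory during the merge loop, with `k` iterations to go. -/
def MergeMem (δ a : ℝ) (D S C : ℕ → ℝ) (p q k : ℕ) (m : Memory) : Prop :=
  ∃ P o, MergeInv δ a D S C p q (m 5) (m 6) (m 7) P o ∧ (∀ v, v < 3 → m (23 + v) 0 = (P v : ℕ)) ∧
    m 22 0 = (o : ℕ) ∧ m 21 0 = (q : ℝ) + 1 ∧ m 18 0 = q ∧ m 29 0 = δ ∧ m 20 0 = a ∧
    k + P 0 + P 1 + P 2 = 3 * q ∧ o + 3 * p ≤ P 0 + P 1 + P 2 + q + 1

/-- One head is consumed and at most one element is emitted, so the output is never longer than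
three times the input. -/
theorem mergeBody_spec {δ a : ℝ} {D S C : ℕ → ℝ} {p q k : ℕ} {m : Memory} (hδ : 0 < δ) (ha : 0 < a)
    (hsort : ∀ x y, p ≤ x → x < y → y < q → D x < D y) (hk : 0 < k)
    (h : MergeMem δ a D S C p q k m) :
    MergeMem δ a D S C p q (k - 1) (mergeBody.step m) := by
  obtain ⟨P, o, hI, hP, h22, h21, h18, h29, h20, hsum, hlen⟩ := h
  obtain ⟨v, hv, hmin, e26, e27, e28, hP', hfr⟩ := selectHead_step m P a hP h20
  have hvq : P v < q := hI.head_lt ha hsort hmin hv (by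
    by_contra hcon
    push Not at hcon
    have := hcon 0 (by norm_num)
    have := hcon 1 (by norm_num)
    have := hcon 2 (by norm_num)
    omega)
  have hmin' : ∀ v', v' < 3 → P v' < q → D (P v) + sgn v * a ≤ D (P v') + sgn v' * a := by
    intro v' hv' hq'
    have := hmin v' hv'
    rwa [(hI.same _ hvq).1, (hI.same _ hq').1] at this
  rw [(hI.same _ hvq).1] at e26
  rw [(hI.same _ hvq).2.1] at e27
  rw [(hI.same _ hvq).2.2] at e28
  have hPsum : Function.update P v (P v + 1) 0 + Function.update P v (P v + 1) 1 +
      Function.update P v (P v + 1) 2 = P 0 + P 1 + P 2 + 1 := by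
    interval_cases v <;> simp <;> omega
  rw [mergeBody, step_seq]
  set m₁ := selectHead.step m with hm₁
  have f5 : m₁ 5 = m 5 := hfr 5 (by simp)
  have f6 : m₁ 6 = m 6 := hfr 6 (by simp)
  have f7 : m₁ 7 = m 7 := hfr 7 (by simp)
  have f18 : m₁ 18 = m 18 := hfr 18 (by simp)
  have f20 : m₁ 20 = m 20 := hfr 20 (by simp)
  have f21 : m₁ 21 = m 21 := hfr 21 (by simp)
  have f22 : m₁ 22 = m 22 := hfr 22 (by simp)
  have f29 : m₁ 29 = m 29 := hfr 29 (by simp)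
  -- The output is sorted, so a comparison with its last bucket alone decides whether a bucket is
  -- new.
  have hlast : ∀ y, q + 1 ≤ y → y < o → ⌊m₁ 5 y / δ⌋ ≤ ⌊m₁ 5 (o - 1) / δ⌋ := by
    intro y h1 h2
    rw [f5]
    rcases Nat.lt_or_ge y (o - 1) with h3 | h3
    · exact (hI.sorted y (o - 1) h1 h3 (by omega)).le
    · have : y = o - 1 := by omega
      rw [this]
  rcases emitHead_step m₁ o q δ (by rw [f22, h22]) (by rw [f21, h21]) (by rw [f29, h29]) with
    ⟨g1, g2, g3, gf⟩ | ⟨y₀, g5, g6, g7, g22, gf, hor⟩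
  · refine ⟨Function.update P v (P v + 1), o, ?_, ?_, ?_, ?_, ?_, ?_, ?_, ?_, ?_⟩
    · rw [gf 5 (by simp), gf 6 (by simp), gf 7 (by simp), f5, f6, f7]
      refine hI.skip hδ hsort hv hvq hmin' (y := o - 1) (by omega) (by omega) ?_ ?_
      · rw [← e26, ← f5]; exact g2
      · rw [← e27, ← f6]; exact g3
    · intro v' hv'
      rw [gf _ (by omega)]; exact hP' v' hv'
    · rw [gf _ (by simp), f22, h22]
    · rw [gf _ (by simp), f21, h21]
    · rw [gf _ (by simp), f18, h18]
    · rw [gf _ (by simp), f29, h29]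
    · rw [gf _ (by simp), f20, h20]
    · omega
    · omega
  · refine ⟨Function.update P v (P v + 1), y₀ + 1, ?_, ?_, ?_, ?_, ?_, ?_, ?_, ?_, ?_⟩
    · rw [g5, g6, g7]
      have hq := hI.le_o
      rw [f5, f6, f7]
      rw [f5, f6] at hor
      rw [f5] at hlast
      refine hI.write hδ hsort hv hvq hmin' e26 e27 e28 ?_ ?_ ?_
      · rcases hor with h | h <;> omega
      · rcases hor with h | h <;> omega
      · intro y hy1 hy2
        rcases hor with ⟨i1, i2, i3, i4⟩ | ⟨i1, i2⟩
        · rcases Nat.lt_or_ge y y₀ with h3 | h3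
          · refine Or.inl ⟨h3, ?_⟩
            rw [← i3]
            exact hI.sorted y (o - 1) hy1 (by omega) (by omega)
          · have hy : y = o - 1 := by omega
            exact Or.inr ⟨by omega, by rw [hy, i3], by rw [hy]; exact i4⟩
        · refine Or.inl ⟨by omega, ?_⟩
          rw [e26] at i2 ⊢
          exact (hlast y hy1 hy2).trans_lt (lt_of_le_of_ne
            (hI.below (o - 1) (by omega) (by omega) v hv hvq) fun h3 => i2 ⟨by omega, h3⟩)
    · intro v' hv'
      have : 23 + v' ∉ [5, 6, 7, 22, 45] := by
        simp only [List.mem_cons, List.not_mem_nil, or_false, not_or]; omega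
      rw [gf _ this]; exact hP' v' hv'
    · rw [g22]; push_cast; rfl
    · rw [gf _ (by simp), f21, h21]
    · rw [gf _ (by simp), f18, h18]
    · rw [gf _ (by simp), f29, h29]
    · rw [gf _ (by simp), f20, h20]
    · omega
    · rcases hor with h | h <;> omega

end RealRAM

/-! ### Building a list by repeated merging -/

namespace RealRAM
open SubsetSumRatio

theorem mergeLoop_spec {δ a : ℝ} {D S C : ℕ → ℝ} {p q : ℕ} {m : Memory} (hδ : 0 < δ) (ha : 0 < a)
    (hsort : ∀ x y, p ≤ x → x < y → y < q → D x < D y)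
    (k : ℕ) (h : MergeMem δ a D S C p q k m) :
    Tri mergeLoop m (k * 180 + 20) (MergeMem δ a D S C p q 0) := by
  refine (Tri.loop 160 (by norm_num) (MergeMem δ a D S C p q) 20 (by decide) ?_ k m h).mono
    (by norm_num) ?_
  · intro k m hI hb
    have hk : 0 < k := by
      obtain ⟨P, o, -, hP, -, -, h18, -, -, hsum, -⟩ := hI
      have h0 := hP 0 (by norm_num)
      have h1 := hP 1 (by norm_num)
      have h2 := hP 2 (by norm_num)
      simp only [holds_not, holds_le, eval_mul, eval_const, eval_add, eval_read, Int.cast_zero,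
        Nat.floor_zero, h18] at hb
      simp only [add_zero, Nat.reduceAdd] at h0 h1 h2
      rw [h0, h1, h2] at hb
      norm_num at hb
      norm_cast at hb
      omega
    exact ⟨k - 1, by omega, Tri.straight (by decide) 160 (by decide) (by norm_num)
      (mergeBody_spec hδ ha hsort hk hI)⟩
  · rintro m' ⟨⟨k', P, o, hI, hP, h22, h21, h18, h29, h20, hsum, hlen⟩, hb⟩ -
    have h0 := hP 0 (by norm_num)
    have h1 := hP 1 (by norm_num)
    have h2 := hP 2 (by norm_num)
    simp only [holds_not, holds_le, eval_mul, eval_const, eval_add, eval_read, Int.cast_zero,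
      Nat.floor_zero, h18, not_not] at hb
    simp only [add_zero, Nat.reduceAdd] at h0 h1 h2
    rw [h0, h1, h2] at hb
    norm_num at hb
    norm_cast at hb
    exact ⟨P, o, hI, hP, h22, h21, h18, h29, h20, by omega, hlen⟩

/-- Variables 17 and 18 delimit the list `[p, q)`, and 19 is the next item. Cell `q` receives the
sentinel and the output starts in cell `q + 1`, so cells below `q`, in particular earlier lists,
remain intact. -/
def mergePrep : Program :=
  assign 20 (.read 3 (var 19)) ;;
  .write 5 (var 18) (.add (.read 5 (.sub (var 18) one)) (.mul (.const 3) (var 20))) ;;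
  assign 21 (.add (var 18) one) ;; assign 22 (.add (var 18) one) ;;
  assign 23 (var 17) ;; assign 24 (var 17) ;; assign 25 (var 17)

def mergeFinish : Program :=
  assign 17 (var 21) ;; assign 18 (var 22) ;; assign 19 (.add (var 19) one)

def mergeItem : Program := mergePrep ;; mergeLoop ;; mergeFinish

/-- Merge items, starting with the one in variable `19`, until all items have been used or the
list has more than `B` elements. -/
def buildLoop : Program :=
  .loop (.and (.lt (var 19) (.read 1 zero)) (.le (.sub (var 18) (var 17)) (var 14))) mergeItem

/-- The list in the cells given by the variables `17` and `18` represents the labellings of the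
items in `[st, e)`, where `e` is the value of variable `19`. -/
structure ListMem (b : ℕ → ℝ) (δ : ℝ) (Adm : (ℕ → ℕ) → Prop) (st e : ℕ) (m : Memory) (err : ℝ)
    (p q : ℕ) : Prop where
  list : SumList b δ Adm st e err (m 5) (m 6) (m 7) p q
  base : m 17 0 = p
  halts : m 18 0 = q
  next : m 19 0 = e
  items : m 3 = b
  width : m 29 0 = δ

/-- The list arrays of two memories agree below `q`. -/
def SameBelow (q : ℕ) (m m' : Memory) : Prop :=
  ∀ x, x < q → m' 5 x = m 5 x ∧ m' 6 x = m 6 x ∧ m' 7 x = m 7 x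

theorem SameBelow.trans {q q' : ℕ} {m m' m'' : Memory} (h : SameBelow q m m')
    (h' : SameBelow q' m' m'') (hq : q ≤ q') : SameBelow q m m'' := by
  intro x hx
  obtain ⟨a1, a2, a3⟩ := h x hx
  obtain ⟨b1, b2, b3⟩ := h' x (by omega)
  exact ⟨b1.trans a1, b2.trans a2, b3.trans a3⟩

theorem mergeItem_spec {b : ℕ → ℝ} {δ : ℝ} {Adm : (ℕ → ℕ) → Prop} {st e p q : ℕ} {err : ℝ}
    {m : Memory} (hδ : 0 < δ) (hb : 0 < b e) (hst : st ≤ e)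
    (hAdm : ∀ w v, v < 3 → Adm w → Adm (Function.update w e v))
    (h : ListMem b δ Adm st e m err p q) :
    Tri mergeItem m (540 * ((q : ℝ) - p) + 100) (fun m' => ∃ q',
      ListMem b δ Adm st (e + 1) m' (err + δ) (q + 1) q' ∧ q' + 3 * p ≤ 4 * q + 1 ∧
      SameBelow q m m') := by
  have hpq := h.list.lt
  have hsort := h.list.sorted_lt hδ
  have h17 := h.base
  have h18 := h.halts
  have h19 := h.next
  have hfl : ⌊(q : ℝ) - 1⌋₊ = q - 1 := floor_natCast_sub_one q
  have hprep : MergeMem δ (b e) (m 5) (m 6) (m 7) p q (3 * (q - p)) (mergePrep.step m) := by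
    refine ⟨fun _ => p, q + 1, ?_, ?_, ?_, ?_, ?_, ?_, ?_, ?_, ?_⟩
    · refine MergeInv.init hpq ?_ ?_ (fun _ _ => rfl)
      · intro x hx
        have : x ≠ q := hx.ne
        simp [mergePrep, Memory.set_apply, h18, this]
      · simp [mergePrep, Memory.set_apply, h18, h19, hfl, h.items]
    · intro v hv
      interval_cases v <;> simp [mergePrep, Memory.set_apply, h17]
    · simp [mergePrep, Memory.set_apply, h18]
    · simp [mergePrep, Memory.set_apply, h18]
    · simp [mergePrep, Memory.set_apply, h18]
    · simp [mergePrep, Memory.set_apply, h.width]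
    · simp [mergePrep, Memory.set_apply, h19, h.items]
    · simp only; omega
    · simp only; omega
  have hcast : ((3 * (q - p) : ℕ) : ℝ) = 3 * ((q : ℝ) - p) := by
    push_cast [Nat.cast_sub hpq.le]; ring
  refine Tri.seq (T₁ := 50) (Q₁ := fun m₁ => m₁ = mergePrep.step m)
    (Tri.straight (by decide) 50 (by decide) (by norm_num) rfl) ?_
    (T₂ := 540 * ((q : ℝ) - p) + 50) (by linarith)
  · rintro _ rfl hf₁
    refine Tri.seq (mergeLoop_spec hδ hb hsort _ hprep) ?_ (T₂ := 30) ?_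
    · rintro m₂ ⟨P, o, hI, hP, h22', h21', h18', h29', h20', hsum, hlen⟩ hf₂
      have hPq : ∀ v, v < 3 → P v = q := by
        intro v hv
        have b0 := (hI.bound 0 (by norm_num)).2
        have b1 := (hI.bound 1 (by norm_num)).2
        have b2 := (hI.bound 2 (by norm_num)).2
        interval_cases v <;> omega
      have hm3 : m₂ 3 = b := by
        rw [hf₂ 3 (by decide), hf₁ 3 (by decide), h.items]
      have hm19 : m₂ 19 0 = e := by
        rw [hf₂ 19 (by decide), hf₁ 19 (by decide), h19]
      refine Tri.straight (by decide) 30 (by decide) (by norm_num) ⟨o, ⟨?_, ?_, ?_, ?_, ?_, ?_⟩, ?_, ?_⟩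
      · have := SumList.merge hδ hst hAdm h.list hI hPq
        simpa [mergeFinish, Memory.set_apply] using this
      · simp [mergeFinish, Memory.set_apply, h21']
      · simp [mergeFinish, Memory.set_apply, h22']
      · simp [mergeFinish, Memory.set_apply, hm19]
      · simp [mergeFinish, Memory.set_apply, hm3]
      · simp [mergeFinish, Memory.set_apply, h29']
      · have := hPq 0 (by norm_num)
        have := hPq 1 (by norm_num)
        have := hPq 2 (by norm_num)
        omega
      · intro x hx
        simpa [mergeFinish, Memory.set_apply] using hI.same x hx
    · rw [hcast]; linarith

/-- Only lists of length at most `B` are merged, and merging at most triples the length; hence the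
bound `3 * B`. If items are left over, the loop can only have stopped because the list is longer
than `B`. -/
theorem buildLoop_spec {b : ℕ → ℝ} {δ : ℝ} {Adm : (ℕ → ℕ) → Prop} {st e p q n : ℕ} {err B : ℝ}
    {m : Memory} (hδ : 0 < δ) (hb : ∀ k, k < n → 0 < b k) (hst : st ≤ e) (hen : e ≤ n)
    (hAdm : ∀ w k v, e ≤ k → v < 3 → Adm w → Adm (Function.update w k v))
    (hn : m 1 0 = n) (hB : m 14 0 = B) (hB1 : 1 ≤ B) (hlen : (q : ℝ) - p ≤ 3 * B)
    (h : ListMem b δ Adm st e m err p q) :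
    Tri buildLoop m (n * (540 * B + 120) + 20) (fun m' => ∃ e' p' q', e ≤ e' ∧ e' ≤ n ∧
      p ≤ p' ∧ q ≤ q' ∧
      ListMem b δ Adm st e' m' (err + ((e' : ℝ) - e) * δ) p' q' ∧ (q' : ℝ) - p' ≤ 3 * B ∧
      (e' < n → B < (q' : ℝ) - p') ∧ SameBelow q m m') := by
  let Inv : ℕ → Memory → Prop := fun k m' => ∃ e' p' q', k + e' = n ∧ e ≤ e' ∧ p ≤ p' ∧ q ≤ q' ∧
    ListMem b δ Adm st e' m' (err + ((e' : ℝ) - e) * δ) p' q' ∧ (q' : ℝ) - p' ≤ 3 * B ∧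
    SameBelow q m m' ∧ m' 1 0 = n ∧ m' 14 0 = B
  have hinit : Inv (n - e) m := ⟨e, p, q, by omega, le_rfl, le_rfl, le_rfl, by simpa using h, hlen,
    fun x _ => ⟨rfl, rfl, rfl⟩, hn, hB⟩
  refine (Tri.loop (540 * B + 100) (by linarith) Inv 20 (by decide) ?_ (n - e) m hinit).mono
    ?_ ?_
  · rintro k m₁ ⟨e', p', q', hk, he, hp, hq, hL, hlen', hsame, hn', hB'⟩ hg
    simp only [holds_and, holds_not, holds_le, eval_sub, eval_read, eval_const, Int.cast_zero,
      Nat.floor_zero, hL.next, hL.base, hL.halts, hn', hB', not_le, Nat.cast_lt] at hg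
    refine ⟨k - 1, by omega, (mergeItem_spec hδ (hb e' hg.1) (hst.trans he)
      (fun w v => hAdm w e' v he) hL).mono (by linarith [hg.2]) ?_⟩
    rintro m₂ ⟨q₂, hL₂, hq₂, hs₂⟩ hf
    have hpq := hL.list.lt
    refine ⟨e' + 1, q' + 1, q₂, by omega, by omega, by omega, ?_, ?_, ?_, ?_, ?_, ?_⟩
    · have := hL₂.list.lt; omega
    · convert hL₂ using 1
      push_cast; ring
    · have : (q₂ : ℝ) + 3 * p' ≤ 4 * q' + 1 := by exact_mod_cast hq₂
      push_cast
      linarith [hg.2]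
    · exact hsame.trans hs₂ hq
    · rw [hf 1 (by decide), hn']
    · rw [hf 14 (by decide), hB']
  · have : ((n - e : ℕ) : ℝ) ≤ n := by exact_mod_cast Nat.sub_le n e
    have h2 : (540 * B + 100 + 20) * ((n - e : ℕ) : ℝ) ≤ (540 * B + 100 + 20) * n :=
      mul_le_mul_of_nonneg_left this (by linarith)
    push_cast at h2 ⊢
    linarith
  · rintro m' ⟨⟨k, e', p', q', hk, he, hp, hq, hL, hlen', hsame, hn', hB'⟩, hg⟩ -
    simp only [holds_and, holds_not, holds_le, eval_sub, eval_read, eval_const, Int.cast_zero,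
      Nat.floor_zero, hL.next, hL.base, hL.halts, hn', hB', not_le, Nat.cast_lt, not_and] at hg
    exact ⟨e', p', q', he, by omega, hp, hq, hL, hlen', fun h => hg h, hsame⟩

end RealRAM

namespace RealRAM
open SubsetSumRatio

/-! ### Searching two lists for a pair of small relative difference -/

/-- The pair of the list elements in cells `u` and `v` has relative difference at most `θ`,
up to an error of `η`. -/
def GoodPair (D S : ℕ → ℝ) (θ η : ℝ) (u v : ℕ) : Prop :=
  -η ≤ D u + D v ∧ D u + D v ≤ θ * (S u + S v) + η

/-- As `u` (variable 39) increases in the first list, the `v` with `-η ≤ D u + D v` form a growing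
final segment of the second list, starting at variable 40. Whether `u` has a partner depends only on
the element of that segment with least `D - θ * S`, kept in variable 41; the end of the list there
means that the segment is empty. Variable 38 flags success, and 42, 43 store the codes of the pair
found. -/
def passInit : Program :=
  assign 38 zero ;; assign 39 (var 31) ;; assign 40 (var 18) ;; assign 41 (var 18)

/-- Move on in the second list, keeping track of the best element. -/
def passDown : Program :=
  assign 40 (.sub (var 40) one) ;;
  .cond (.or (.le (var 18) (var 41))
      (.lt (.sub (.read 5 (var 40)) (.mul (var 37) (.read 6 (var 40))))
        (.sub (.read 5 (var 41)) (.mul (var 37) (.read 6 (var 41))))))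
    (assign 41 (var 40)) .skip

/-- Test the current element of the first list, and move on in the first list. -/
def passUp : Program :=
  .cond (.and (.lt (var 41) (var 18))
      (.le (.add (.read 5 (var 39)) (.read 5 (var 41)))
        (.add (.mul (var 37) (.add (.read 6 (var 39)) (.read 6 (var 41)))) (var 30))))
    (assign 38 one ;; assign 42 (.read 7 (var 39)) ;; assign 43 (.read 7 (var 41))) .skip ;;
  assign 39 (.add (var 39) one)

def passBody : Program :=
  .cond (.and (.lt (var 17) (var 40))
      (.le (.sub zero (var 30)) (.add (.read 5 (var 39)) (.read 5 (.sub (var 40) one)))))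
    passDown passUp

def pass : Program :=
  passInit ;; .loop (.and (.le (var 38) zero) (.lt (var 39) (var 32))) passBody

section Pass

variable (D S C : ℕ → ℝ) (θ η x y : ℝ) (bL eL bR eR : ℕ)

/-- The state of the search before a pair has been found. -/
structure PassState (u v t : ℕ) : Prop where
  left : bL ≤ u ∧ u ≤ eL
  right : bR ≤ v ∧ v ≤ eR
  none : ∀ u', bL ≤ u' → u' < u → ∀ v', bR ≤ v' → v' < eR → ¬ GoodPair D S θ η u' v'
  above : ∀ u', u ≤ u' → u' < eL → ∀ v', v ≤ v' → v' < eR → -η ≤ D u' + D v'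
  best : (t = eR ∧ v = eR) ∨ (v ≤ t ∧ t < eR ∧
    ∀ v', v ≤ v' → v' < eR → D t - θ * S t ≤ D v' - θ * S v')

structure PassMem (m : Memory) : Prop where
  d : m 5 = D
  s : m 6 = S
  c : m 7 = C
  theta : m 37 0 = θ
  eta : m 30 0 = η
  bl : m 31 0 = bL
  el : m 32 0 = eL
  br : m 17 0 = bR
  er : m 18 0 = eR

/-- The outcome of a successful search. -/
def PassFound (m : Memory) : Prop :=
  m 38 0 = 1 ∧ ∃ u v, bL ≤ u ∧ u < eL ∧ bR ≤ v ∧ v < eR ∧ GoodPair D S θ η u v ∧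
    m 42 0 = C u ∧ m 43 0 = C v

def PassInv (k : ℕ) (m : Memory) : Prop :=
  PassMem D S C θ η bL eL bR eR m ∧
    ((m 38 0 = 0 ∧ m 42 0 = x ∧ m 43 0 = y ∧ ∃ u v t, m 39 0 = (u : ℕ) ∧ m 40 0 = (v : ℕ) ∧
        m 41 0 = (t : ℕ) ∧ k + u + bR = eL + v ∧ PassState D S θ η bL eL bR eR u v t) ∨
      PassFound D S C θ η bL eL bR eR m)

variable {D S C θ η x y bL eL bR eR}

theorem PassMem.congr {m m' : Memory} (h : PassMem D S C θ η bL eL bR eR m)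
    (hf : ∀ A, A ∉ [38, 39, 40, 41, 42, 43] → m' A = m A) :
    PassMem D S C θ η bL eL bR eR m' := by
  constructor
  · rw [hf 5 (by decide), h.d]
  · rw [hf 6 (by decide), h.s]
  · rw [hf 7 (by decide), h.c]
  · rw [hf 37 (by decide), h.theta]
  · rw [hf 30 (by decide), h.eta]
  · rw [hf 31 (by decide), h.bl]
  · rw [hf 32 (by decide), h.el]
  · rw [hf 17 (by decide), h.br]
  · rw [hf 18 (by decide), h.er]

/-- The new segment element is admissible for `u`, and it stays admissible for all later `u'`
because the first list is increasing. -/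
theorem PassState.down {u v t : ℕ} (h : PassState D S θ η bL eL bR eR u v t)
    (hL : ∀ x y, bL ≤ x → x < y → y < eL → D x < D y) (hv : bR < v)
    (hd : -η ≤ D u + D (v - 1)) (t' : ℕ)
    (ht : (t' = v - 1 ∧ (t = eR ∨ D (v - 1) - θ * S (v - 1) ≤ D t - θ * S t)) ∨
      (t' = t ∧ t ≠ eR ∧ D t - θ * S t ≤ D (v - 1) - θ * S (v - 1))) :
    PassState D S θ η bL eL bR eR u (v - 1) t' where
  left := h.left
  right := by have := h.right; omega
  none := h.none
  above u' h1 h2 v' h3 h4 := by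
    rcases Nat.lt_or_ge v' v with h5 | h5
    · have : v' = v - 1 := by omega
      subst this
      rcases h1.eq_or_lt with h6 | h6
      · rw [← h6]; exact hd
      · have := hL u u' h.left.1 h6 h2
        linarith
    · exact h.above u' h1 h2 v' h5 h4
  best := by
    have hr := h.right
    right
    have hb := h.best
    have hcase : ∀ v', v - 1 ≤ v' → v' = v - 1 ∨ v ≤ v' := by intro v' _; omega
    rcases ht with ⟨rfl, h1⟩ | ⟨rfl, h1, h2⟩
    · refine ⟨le_rfl, by omega, fun v' h3 h4 => ?_⟩
      rcases hcase v' h3 with rfl | h5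
      · exact le_rfl
      · rcases hb with ⟨b1, b2⟩ | ⟨b1, b2, b3⟩
        · omega
        · rcases h1 with h1 | h1
          · omega
          · exact h1.trans (b3 v' h5 h4)
    · rcases hb with ⟨b1, b2⟩ | ⟨b1, b2, b3⟩
      · exact absurd b1 h1
      · refine ⟨by omega, b2, fun v' h3 h4 => ?_⟩
        rcases hcase v' h3 with rfl | h5
        · exact h2
        · exact b3 v' h5 h4

/-- Elements below `v` give a sum with `u` that is too small, since already `v - 1` does; those from
`v` on are no better than `t`, which failed. So `u` has no partner. -/
theorem PassState.up {u v t : ℕ} (h : PassState D S θ η bL eL bR eR u v t)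
    (hR : ∀ x y, bR ≤ x → x < y → y < eR → D x < D y) (hu : u < eL)
    (hv : ¬ (bR < v ∧ -η ≤ D u + D (v - 1)))
    (hn : ¬ (t < eR ∧ D u + D t ≤ θ * (S u + S t) + η)) :
    PassState D S θ η bL eL bR eR (u + 1) v t where
  left := by have := h.left; omega
  right := h.right
  none u' h1 h2 v' h3 h4 := by
    rcases Nat.lt_succ_iff_lt_or_eq.mp h2 with h5 | rfl
    · exact h.none u' h1 h5 v' h3 h4
    · rintro ⟨g1, g2⟩
      rcases Nat.lt_or_ge v' v with h5 | h5
      · refine hv ⟨by omega, g1.trans ?_⟩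
        rcases Nat.lt_or_ge v' (v - 1) with h6 | h6
        · have := hR v' (v - 1) h3 h6 (by have := h.right; omega)
          linarith
        · have : v' = v - 1 := by omega
          rw [this]
      · rcases h.best with ⟨b1, b2⟩ | ⟨b1, b2, b3⟩
        · omega
        · refine hn ⟨b2, ?_⟩
          have := b3 v' h5 h4
          nlinarith
  above u' h1 h2 := h.above u' (by omega) h2
  best := h.best

theorem passBody_spec {k : ℕ} {m : Memory}
    (hL : ∀ x y, bL ≤ x → x < y → y < eL → D x < D y)
    (hR : ∀ x y, bR ≤ x → x < y → y < eR → D x < D y)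
    (hM : PassMem D S C θ η bL eL bR eR m)
    (h38 : m 38 0 = 0) (h42 : m 42 0 = x) (h43 : m 43 0 = y) {u v t : ℕ}
    (h39 : m 39 0 = (u : ℕ)) (h40 : m 40 0 = (v : ℕ)) (h41 : m 41 0 = (t : ℕ))
    (hk : k + u + bR = eL + v) (hu : u < eL) (h : PassState D S θ η bL eL bR eR u v t)
    (hM' : PassMem D S C θ η bL eL bR eR (passBody.step m)) :
    PassInv D S C θ η x y bL eL bR eR (k - 1) (passBody.step m) := by
  refine ⟨hM', ?_⟩
  have hfl : ⌊(v : ℝ) - 1⌋₊ = v - 1 := floor_natCast_sub_one v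
  have hl := h.left
  have hr := h.right
  by_cases c1 : bR < v ∧ -η ≤ D u + D (v - 1)
  · have hv1 : ((v - 1 : ℕ) : ℝ) = (v : ℝ) - 1 := by
      rw [Nat.cast_sub (by omega)]; simp
    rw [passBody, step_cond_true _ _ (by
      simpa [h39, h40, hM.br, hM.eta, hM.d, hfl] using c1)]
    left
    by_cases c2 : eR ≤ t ∨ D (v - 1) - θ * S (v - 1) < D t - θ * S t
    · rw [passDown, step_seq, step_cond_true _ _ (by
        simp [Memory.set_apply, h40, h41, hM.er, hM.theta, hM.d, hM.s, hfl]
        intro h1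
        rcases c2 with c2 | c2
        · omega
        · linarith)]
      refine ⟨by simp [Memory.set_apply, h38], by simp [Memory.set_apply, h42],
        by simp [Memory.set_apply, h43], u, v - 1, v - 1, by simp [Memory.set_apply, h39],
        by simp [Memory.set_apply, h40, hv1], by simp [Memory.set_apply, h40, hv1], by omega,
        h.down hL c1.1 c1.2 _ (Or.inl ⟨rfl, ?_⟩)⟩
      rcases c2 with c2 | c2
      · rcases h.best with b | b
        · exact Or.inl b.1
        · omega
      · exact Or.inr c2.le
    · rw [passDown, step_seq, step_cond_false _ _ (by
        simp [Memory.set_apply, h40, h41, hM.er, hM.theta, hM.d, hM.s, hfl]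
        push Not at c2
        exact ⟨c2.1, by linarith [c2.2]⟩)]
      push Not at c2
      exact ⟨by simp [Memory.set_apply, h38], by simp [Memory.set_apply, h42],
        by simp [Memory.set_apply, h43], u, v - 1, t, by simp [Memory.set_apply, h39],
        by simp [Memory.set_apply, h40, hv1], by simp [Memory.set_apply, h41], by omega,
        h.down hL c1.1 c1.2 _ (Or.inr ⟨rfl, by omega, c2.2⟩)⟩
  · rw [passBody, step_cond_false _ _ (by
      simpa [h39, h40, hM.br, hM.eta, hM.d, hfl] using c1)]
    by_cases c2 : t < eR ∧ D u + D t ≤ θ * (S u + S t) + η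
    · right
      rw [passUp, step_seq, step_cond_true _ _ (by
        simpa [h39, h41, hM.er, hM.theta, hM.d, hM.s, hM.eta] using c2)]
      have hb : v ≤ t := by rcases h.best with b | b <;> omega
      exact ⟨by simp [Memory.set_apply], u, t, hl.1, hu, by omega, c2.1,
        ⟨h.above u le_rfl hu t hb c2.1, c2.2⟩, by simp [Memory.set_apply, h39, hM.c],
        by simp [Memory.set_apply, h41, hM.c]⟩
    · left
      rw [passUp, step_seq, step_cond_false _ _ (by
        simpa [h39, h41, hM.er, hM.theta, hM.d, hM.s, hM.eta] using c2)]
      exact ⟨by simp [Memory.set_apply, h38], by simp [Memory.set_apply, h42],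
        by simp [Memory.set_apply, h43], u + 1, v, t, by simp [Memory.set_apply, h39],
        by simp [Memory.set_apply, h40], by simp [Memory.set_apply, h41], by omega,
        h.up hR hu c1 c2⟩

theorem pass_spec {m : Memory}
    (hL : ∀ x y, bL ≤ x → x < y → y < eL → D x < D y)
    (hR : ∀ x y, bR ≤ x → x < y → y < eR → D x < D y)
    (hbL : bL ≤ eL) (hbR : bR ≤ eR)
    (hM : PassMem D S C θ η bL eL bR eR m) :
    Tri pass m (100 * (((eL : ℝ) - bL) + ((eR : ℝ) - bR)) + 40) (fun m' =>
      (m' 38 0 = 0 ∧ m' 42 0 = m 42 0 ∧ m' 43 0 = m 43 0 ∧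
        ∀ u v, bL ≤ u → u < eL → bR ≤ v → v < eR → ¬ GoodPair D S θ η u v) ∨
      PassFound D S C θ η bL eL bR eR m') := by
  -- Each step decreases `(eL - u) + (v - bR)`, which makes the scan linear.
  have hinit : PassInv D S C θ η (m 42 0) (m 43 0) bL eL bR eR ((eL - bL) + (eR - bR))
      (passInit.step m) := by
    refine ⟨⟨?_, ?_, ?_, ?_, ?_, ?_, ?_, ?_, ?_⟩, Or.inl ⟨?_, ?_, ?_, bL, eR, eR, ?_, ?_, ?_,
      by omega, ⟨le_rfl, hbL⟩, ⟨hbR, le_rfl⟩, ?_, ?_, Or.inl ⟨rfl, rfl⟩⟩⟩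
    · simp [passInit, Memory.set_apply, hM.d]
    · simp [passInit, Memory.set_apply, hM.s]
    · simp [passInit, Memory.set_apply, hM.c]
    · simp [passInit, Memory.set_apply, hM.theta]
    · simp [passInit, Memory.set_apply, hM.eta]
    · simp [passInit, Memory.set_apply, hM.bl]
    · simp [passInit, Memory.set_apply, hM.el]
    · simp [passInit, Memory.set_apply, hM.br]
    · simp [passInit, Memory.set_apply, hM.er]
    · simp [passInit, Memory.set_apply]
    · simp [passInit, Memory.set_apply]
    · simp [passInit, Memory.set_apply]
    · simp [passInit, Memory.set_apply, hM.bl]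
    · simp [passInit, Memory.set_apply, hM.er]
    · simp [passInit, Memory.set_apply, hM.er]
    · intro u' h1 h2; omega
    · intro u' _ _ v' h1 h2; omega
  refine Tri.seq (T₁ := 20) (T₂ := 100 * (((eL : ℝ) - bL) + ((eR : ℝ) - bR)) + 20)
    (Q₁ := fun m₁ => m₁ = passInit.step m)
    (Tri.straight (by decide) 20 (by decide) (by norm_num) rfl) ?_ (by linarith)
  rintro _ rfl -
  refine (Tri.loop 80 (by norm_num) (PassInv D S C θ η (m 42 0) (m 43 0) bL eL bR eR) 20
    (by decide) ?_ _ _ hinit).mono ?_ ?_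
  · rintro k m₁ ⟨hM₁, hor⟩ hg
    rcases hor with ⟨h38, h42, h43, u, v, t, h39, h40, h41, hk, hst⟩ | ⟨h38, -⟩
    · have hu : u < eL := by
        simp only [holds_and, holds_not, holds_le, eval_read, eval_const, Int.cast_zero,
          Nat.floor_zero, h39, hM₁.el, not_le, Nat.cast_lt] at hg
        exact hg.2
      have hr := hst.right
      refine ⟨k - 1, by omega, (Tri.straight (by decide) 80 (by decide) (by norm_num)
        (Q := fun m' => m' = passBody.step m₁) rfl).mono le_rfl ?_⟩
      rintro _ rfl hf
      exact passBody_spec hL hR hM₁ h38 h42 h43 h39 h40 h41 hk hu hst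
        (hM₁.congr fun A hA => hf A fun hA' => hA
          ((by decide : ∀ A ∈ passBody.writes, A ∈ [38, 39, 40, 41, 42, 43]) A hA'))
    · simp [h38] at hg
      exact absurd hg.1 (by norm_num)
  · push_cast [Nat.cast_sub hbL, Nat.cast_sub hbR]
    linarith
  · rintro m' ⟨⟨k, hM₁, hor⟩, hg⟩ -
    rcases hor with ⟨h38, h42, h43, u, v, t, h39, h40, h41, hk, hst⟩ | h
    · have hu : u = eL := by
        simp only [holds_and, holds_not, holds_le, eval_read, eval_const, Int.cast_zero,
          Nat.floor_zero, h39, h38, hM₁.el, le_refl, true_and, not_not, Nat.cast_le] at hg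
        have := hst.left
        omega
      exact Or.inl ⟨h38, h42, h43, fun u' v' h1 h2 h3 h4 => hst.none u' h1 (by omega) v' h3 h4⟩
    · exact Or.inr h

end Pass

end RealRAM

namespace RealRAM
open SubsetSumRatio

/-! ### Binary search for the smallest relative difference -/

/-- Bisection of `[0, 1]`: variables 36 and 35 are the bounds, 34 is the length of the interval and
37 its midpoint. A failing pass leaves 42 and 43 alone, so these always belong to the current upper
bound, unless that is still `1`. -/
def searchInit : Program := assign 34 one ;; assign 35 one ;; assign 36 zero

def searchMid : Program := assign 37 (.div (.add (var 36) (var 35)) (.const 2))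

def searchUpdate : Program :=
  .cond (.lt zero (var 38)) (assign 35 (var 37)) (assign 36 (var 37)) ;;
  assign 34 (.div (var 34) (.const 2))

def searchBody : Program := searchMid ;; pass ;; searchUpdate

def searchLoop : Program :=
  .loop (.lt (.div (.read 1 one) (.const 16)) (var 34)) searchBody

section Search

variable (D S C : ℕ → ℝ) (ε η : ℝ) (bL eL bR eR : ℕ)

/-- The bounds `lo` and `hi` of the binary search enclose the smallest relative difference. -/
structure SearchState (m : Memory) (lo hi : ℝ) : Prop where
  lo_nonneg : 0 ≤ lo
  lo_le : lo ≤ hi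
  lower : lo = 0 ∨ ∀ u v, bL ≤ u → u < eL → bR ≤ v → v < eR → ¬ GoodPair D S lo η u v
  upper : hi = 1 ∨ ∃ u v, bL ≤ u ∧ u < eL ∧ bR ≤ v ∧ v < eR ∧ GoodPair D S hi η u v ∧
    m 42 0 = C u ∧ m 43 0 = C v

def SearchInv (R k : ℕ) (m : Memory) : Prop :=
  (∃ θ, PassMem D S C θ η bL eL bR eR m) ∧ m 1 1 = ε ∧ ∃ r lo hi, k + r = R ∧
    m 34 0 = (1 / 2 : ℝ) ^ r ∧ hi - lo = (1 / 2 : ℝ) ^ r ∧ m 36 0 = lo ∧ m 35 0 = hi ∧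
    SearchState D S C η bL eL bR eR m lo hi

variable {D S C ε η bL eL bR eR}

theorem searchBody_spec {R k : ℕ} {m : Memory}
    (hL : ∀ x y, bL ≤ x → x < y → y < eL → D x < D y)
    (hR : ∀ x y, bR ≤ x → x < y → y < eR → D x < D y)
    (hbL : bL ≤ eL) (hbR : bR ≤ eR) (hk : 0 < k)
    (h : SearchInv D S C ε η bL eL bR eR R k m) :
    Tri searchBody m (100 * (((eL : ℝ) - bL) + ((eR : ℝ) - bR)) + 100)
      (SearchInv D S C ε η bL eL bR eR R (k - 1)) := by
  obtain ⟨⟨θ₀, hM⟩, h11, r, lo, hi, hkr, h34, hw, h36, h35, hst⟩ := h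
  refine Tri.seq (T₁ := 20) (T₂ := 100 * (((eL : ℝ) - bL) + ((eR : ℝ) - bR)) + 80)
    (Q₁ := fun m₁ => m₁ = searchMid.step m)
    (Tri.straight (by decide) 20 (by decide) (by norm_num) rfl) ?_ (by linarith)
  rintro _ rfl hf₁
  set m₁ := searchMid.step m with hm₁
  set θ := (lo + hi) / 2 with hθ
  have h37 : m₁ 37 0 = θ := by simp [hm₁, searchMid, Memory.set_apply, h36, h35, hθ]
  have hM₁ : PassMem D S C θ η bL eL bR eR m₁ := by
    constructor
    · rw [hf₁ 5 (by decide), hM.d]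
    · rw [hf₁ 6 (by decide), hM.s]
    · rw [hf₁ 7 (by decide), hM.c]
    · exact h37
    · rw [hf₁ 30 (by decide), hM.eta]
    · rw [hf₁ 31 (by decide), hM.bl]
    · rw [hf₁ 32 (by decide), hM.el]
    · rw [hf₁ 17 (by decide), hM.br]
    · rw [hf₁ 18 (by decide), hM.er]
  refine Tri.seq (pass_spec hL hR hbL hbR hM₁) ?_ (T₂ := 40) (by linarith)
  intro m₂ hor hf₂
  have hM₂ : PassMem D S C θ η bL eL bR eR m₂ := hM₁.congr fun A hA => hf₂ A fun hA' => hA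
    ((by decide : ∀ A ∈ pass.writes, A ∈ [38, 39, 40, 41, 42, 43]) A hA')
  have g11 : m₂ 1 1 = ε := by rw [hf₂ 1 (by decide), hf₁ 1 (by decide), h11]
  have g34 : m₂ 34 0 = (1 / 2 : ℝ) ^ r := by rw [hf₂ 34 (by decide), hf₁ 34 (by decide), h34]
  have g35 : m₂ 35 0 = hi := by rw [hf₂ 35 (by decide), hf₁ 35 (by decide), h35]
  have g36 : m₂ 36 0 = lo := by rw [hf₂ 36 (by decide), hf₁ 36 (by decide), h36]
  have hlo := hst.lo_nonneg
  have hlohi := hst.lo_le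
  have hpow : (1 / 2 : ℝ) ^ (r + 1) = (1 / 2 : ℝ) ^ r / 2 := by rw [pow_succ]; ring
  refine Tri.straight (by decide) 40 (by decide) (by norm_num) ?_
  rcases hor with ⟨h38, h42, h43, hnone⟩ | ⟨h38, u, v, hu1, hu2, hv1, hv2, hg, h42, h43⟩
  · rw [searchUpdate, step_seq, step_cond_false _ _ (by simp [h38])]
    refine ⟨⟨θ, ?_⟩, by simp [Memory.set_apply, g11], r + 1, θ, hi, by omega,
      by rw [hpow]; simp [Memory.set_apply, g34], by rw [hpow, ← hw]; ring,
      by simp [Memory.set_apply, hM₂.theta], by simp [Memory.set_apply, g35], ⟨?_, ?_, ?_, ?_⟩⟩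
    · constructor <;> simp [Memory.set_apply, hM₂.d, hM₂.s, hM₂.c, hM₂.theta, hM₂.eta, hM₂.bl,
        hM₂.el, hM₂.br, hM₂.er]
    · linarith
    · linarith
    · exact Or.inr hnone
    · rcases hst.upper with h | ⟨u, v, h1, h2, h3, h4, h5, h6, h7⟩
      · exact Or.inl h
      · refine Or.inr ⟨u, v, h1, h2, h3, h4, h5, ?_, ?_⟩
        · simp [Memory.set_apply, h42, hf₁ 42 (by decide), h6]
        · simp [Memory.set_apply, h43, hf₁ 43 (by decide), h7]
  · rw [searchUpdate, step_seq, step_cond_true _ _ (by simp [h38])]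
    refine ⟨⟨θ, ?_⟩, by simp [Memory.set_apply, g11], r + 1, lo, θ, by omega,
      by rw [hpow]; simp [Memory.set_apply, g34], by rw [hpow, ← hw]; ring,
      by simp [Memory.set_apply, g36], by simp [Memory.set_apply, hM₂.theta], ⟨?_, ?_, ?_, ?_⟩⟩
    · constructor <;> simp [Memory.set_apply, hM₂.d, hM₂.s, hM₂.c, hM₂.theta, hM₂.eta, hM₂.bl,
        hM₂.el, hM₂.br, hM₂.er]
    · linarith
    · linarith
    · exact hst.lower
    · exact Or.inr ⟨u, v, hu1, hu2, hv1, hv2, hg, by simp [Memory.set_apply, h42],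
        by simp [Memory.set_apply, h43]⟩

theorem searchLoop_spec {R : ℕ} {m : Memory}
    (hL : ∀ x y, bL ≤ x → x < y → y < eL → D x < D y)
    (hR : ∀ x y, bR ≤ x → x < y → y < eR → D x < D y)
    (hbL : bL ≤ eL) (hbR : bR ≤ eR) (hε : (1 / 2 : ℝ) ^ R ≤ ε / 16)
    (h : SearchInv D S C ε η bL eL bR eR R R m) :
    Tri searchLoop m (R * (100 * (((eL : ℝ) - bL) + ((eR : ℝ) - bR)) + 120) + 20)
      (fun m' => ∃ lo hi, hi ≤ lo + ε / 16 ∧ m' 35 0 = hi ∧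
        SearchState D S C η bL eL bR eR m' lo hi) := by
  have h1 : (bL : ℝ) ≤ eL := by exact_mod_cast hbL
  have h2 : (bR : ℝ) ≤ eR := by exact_mod_cast hbR
  refine (Tri.loop (100 * (((eL : ℝ) - bL) + ((eR : ℝ) - bR)) + 100) (by linarith)
    (SearchInv D S C ε η bL eL bR eR R) 20 (by decide) ?_ _ _ h).mono ?_ ?_
  · intro k m₁ hI hg
    -- After `R` halvings the length is at most `ε / 16`, contrary to the loop test.
    have hk : 0 < k := by
      obtain ⟨-, h11, r, lo, hi, hkr, h34, -⟩ := hI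
      simp only [holds_not, holds_le, eval_div, eval_read, eval_const, Int.cast_zero, Int.cast_one,
        Nat.floor_zero, Nat.floor_one, h34, h11, not_le] at hg
      rcases Nat.eq_zero_or_pos k with rfl | hk
      · rw [zero_add] at hkr
        subst hkr
        norm_num at hg hε
        linarith
      · exact hk
    exact ⟨k - 1, by omega, searchBody_spec hL hR hbL hbR hk hI⟩
  · push_cast
    linarith
  · rintro m' ⟨⟨k, -, h11, r, lo, hi, hkr, h34, hw, h36, h35, hst⟩, hg⟩ -
    simp only [holds_not, holds_le, eval_div, eval_read, eval_const, Int.cast_zero, Int.cast_one,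
      Nat.floor_zero, Nat.floor_one, h34, h11, not_not] at hg
    norm_num at hg hw
    exact ⟨lo, hi, by linarith, h35, hst⟩

end Search

end RealRAM

/-! ### List lengths and bucket counts -/

namespace SubsetSumRatio

/-- All sums of labellings of the items in `[s, e)` lie in at most `N` buckets of width `δ`. -/
def HasBuckets (b : ℕ → ℝ) (δ : ℝ) (s e : ℕ) (N : ℝ) : Prop :=
  ∃ G : Finset ℤ, (G.card : ℝ) ≤ N ∧ ∀ w, Labels w → ⌊dsum b w s e / δ⌋ ∈ G

/-- The elements are differences of genuine labellings and lie in pairwise distinct buckets. -/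
theorem SumList.length_le {b : ℕ → ℝ} {δ : ℝ} {Adm : (ℕ → ℕ) → Prop} {st e : ℕ} {err : ℝ}
    {d s c : ℕ → ℝ} {p q : ℕ} {N : ℝ} (h : SumList b δ Adm st e err d s c p q)
    (hN : HasBuckets b δ st e N) : (q : ℝ) - p ≤ N := by
  obtain ⟨G, hG, hw⟩ := hN
  have hcard : (Finset.Ico p q).card ≤ G.card := by
    refine Finset.card_le_card_of_injOn (fun x => ⌊d x / δ⌋) ?_ ?_
    · intro x hx
      rw [Finset.mem_coe, Finset.mem_Ico] at hx
      obtain ⟨w, hl, -, hd, -⟩ := h.sound x hx.1 hx.2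
      simp only [hd]
      exact hw w hl
    · intro x hx y hy hxy
      rw [Finset.mem_coe, Finset.mem_Ico] at hx hy
      rcases lt_trichotomy x y with hlt | heq | hlt
      · exact absurd hxy (h.sorted x y hx.1 hlt hy.2).ne
      · exact heq
      · exact absurd hxy (h.sorted y x hy.1 hlt hx.2).ne'
  rw [Nat.card_Ico] at hcard
  have := h.lt
  have h2 : ((q - p : ℕ) : ℝ) ≤ G.card := by exact_mod_cast hcard
  rw [Nat.cast_sub this.le] at h2
  linarith

end SubsetSumRatio

namespace RealRAM
open SubsetSumRatio

/-! ### One attempt -/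

/-- Item `i` is forced into `X` or `Y`, so the list starts with `-b i` and `b i`, with codes `2` and
`1`. The tolerance `η = ε b i / 16` is divided by `n` because each of at most `n` merges may cost
one bucket width. -/
def leftInit : Program :=
  assign 20 (.read 3 (var 16)) ;;
  assign 30 (.div (.mul (.read 1 one) (var 20)) (.const 16)) ;;
  assign 29 (.div (var 30) (.read 1 zero)) ;;
  .write 5 zero (.sub zero (var 20)) ;; .write 6 zero (var 20) ;; .write 7 zero (.const 2) ;;
  .write 5 one (var 20) ;; .write 6 one (var 20) ;; .write 7 one one ;;
  assign 17 zero ;; assign 18 (.const 2) ;; assign 19 (.add (var 16) one)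

/-- The first list is saved in variables 31 and 32, and its end item `l` in 33; the second list
starts from the empty sum in the cell behind it. -/
def rightInit : Program :=
  assign 31 (var 17) ;; assign 32 (var 18) ;; assign 33 (var 19) ;;
  .write 5 (var 18) zero ;; .write 6 (var 18) zero ;; .write 7 (var 18) zero ;;
  assign 17 (var 18) ;; assign 18 (.add (var 18) one)

/-- Acceptance means that the difference found is small in itself or that the search was exhaustive.
-/
def checkDone : Program :=
  .cond (.or (.le (var 35) (.div (.read 1 one) (.const 4)))
      (.and (.le (var 16) zero) (.le (.read 1 zero) (var 19))))
    (assign 15 one) .skip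

def attempt : Program :=
  leftInit ;; buildLoop ;; rightInit ;; buildLoop ;; searchInit ;; searchLoop ;; checkDone

/-- The outcome of an attempt to find a solution with largest item `i`. Items in `[i, t)` have been
used; `lo` and `hi` enclose the smallest relative difference. -/
structure AttemptRes (b : ℕ → ℝ) (n : ℕ) (ε B : ℝ) (i l t : ℕ) (lo hi : ℝ) (m : Memory) :
    Prop where
  i_lt : i < l
  l_le : l ≤ t
  t_le : t ≤ n
  m33 : m 33 0 = l
  m19 : m 19 0 = t
  left : l < n → ∀ N, HasBuckets b (ε * b i / 16 / n) i l N → B < N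
  right : t < n → ∀ N, HasBuckets b (ε * b i / 16 / n) l t N → B < N
  hi_le : hi ≤ lo + ε / 16
  lo_nonneg : 0 ≤ lo
  lower : ∀ w, Labels w → w i ≠ 0 → 0 ≤ dsum b w i t → lo * ssum b w i t ≤ dsum b w i t
  upper : hi = 1 ∨ ∃ w, Labels w ∧ w i ≠ 0 ∧ |dsum b w i t| ≤ hi * ssum b w i t + ε * b i / 16 ∧
    m 42 0 = code w i l ∧ m 43 0 = code w l t
  done : m 15 0 = 1 ∧ (hi ≤ ε / 4 ∨ i = 0 ∧ t = n) ∨ m 15 0 = 0 ∧ ¬ (hi ≤ ε / 4 ∨ i = 0 ∧ t = n)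

end RealRAM

/-! ### Initial lists and splitting of sums -/

namespace SubsetSumRatio

theorem SumList.congr {b : ℕ → ℝ} {δ : ℝ} {Adm : (ℕ → ℕ) → Prop} {st e : ℕ} {err : ℝ}
    {d s c d' s' c' : ℕ → ℝ} {p q : ℕ} (h : SumList b δ Adm st e err d s c p q)
    (hs : ∀ x, x < q → d' x = d x ∧ s' x = s x ∧ c' x = c x) :
    SumList b δ Adm st e err d' s' c' p q where
  lt := h.lt
  sound x h1 h2 := by
    rw [(hs x h2).1, (hs x h2).2.1, (hs x h2).2.2]; exact h.sound x h1 h2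
  complete w hw hA := by
    obtain ⟨x, h1, h2, h3, h4⟩ := h.complete w hw hA
    exact ⟨x, h1, h2, by rw [(hs x h2).1]; exact h3, by rw [(hs x h2).2.1]; exact h4⟩
  sorted x y h1 h2 h3 := by
    rw [(hs x (h2.trans h3)).1, (hs y h3).1]; exact h.sorted x y h1 h2 h3

theorem dsum_add (b : ℕ → ℝ) (w : ℕ → ℕ) {s l e : ℕ} (h1 : s ≤ l) (h2 : l ≤ e) :
    dsum b w s l + dsum b w l e = dsum b w s e :=
  Finset.sum_Ico_consecutive _ h1 h2

theorem ssum_add (b : ℕ → ℝ) (w : ℕ → ℕ) {s l e : ℕ} (h1 : s ≤ l) (h2 : l ≤ e) :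
    ssum b w s l + ssum b w l e = ssum b w s e :=
  Finset.sum_Ico_consecutive _ h1 h2

theorem dsum_single (b : ℕ → ℝ) (w : ℕ → ℕ) (i : ℕ) : dsum b w i (i + 1) = sgn (w i) * b i := by
  simp [dsum]

theorem ssum_single (b : ℕ → ℝ) (w : ℕ → ℕ) (i : ℕ) :
    ssum b w i (i + 1) = |sgn (w i)| * b i := by
  simp [ssum]

theorem code_single (w : ℕ → ℕ) (i : ℕ) : code w i (i + 1) = w i := by
  rw [code_succ w le_rfl, code_self]; simp

/-- The hypothesis `δ ≤ b i` places `-b i` and `b i` in different buckets. -/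
theorem sumList_left {b : ℕ → ℝ} {δ : ℝ} {i : ℕ} {d s c : ℕ → ℝ} (hδ : 0 < δ) (hb : δ ≤ b i)
    (d0 : d 0 = -b i) (d1 : d 1 = b i) (s0 : s 0 = b i) (s1 : s 1 = b i) (c0 : c 0 = 2)
    (c1 : c 1 = 1) : SumList b δ (fun w => w i ≠ 0) i (i + 1) 0 d s c 0 2 where
  lt := by norm_num
  sound x _ h2 := by
    interval_cases x
    · exact ⟨fun _ => 2, fun _ => by norm_num, by norm_num, by simp [dsum_single, d0],
        by simp [ssum_single, s0], by simp [code_single, c0]⟩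
    · exact ⟨fun _ => 1, fun _ => by norm_num, by norm_num, by simp [dsum_single, d1],
        by simp [ssum_single, s1], by simp [code_single, c1]⟩
  complete w hw hA := by
    have h3 := hw i
    rw [dsum_single, ssum_single]
    generalize w i = v at *
    interval_cases v
    · exact absurd rfl hA
    · exact ⟨1, by norm_num, by norm_num, by simp [d1], by simp [s1]⟩
    · exact ⟨0, by norm_num, by norm_num, by simp [d0], by simp [s0]⟩
  sorted x y h1 h2 h3 := by
    have hx : x = 0 := by omega
    have hy : y = 1 := by omega
    subst hx hy
    have h1 : 1 ≤ b i / δ := (one_le_div hδ).mpr hb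
    rw [d0, d1, Int.floor_lt]
    have : ((1 : ℤ) : ℝ) ≤ (⌊b i / δ⌋ : ℝ) := by exact_mod_cast Int.le_floor.mpr (by simpa using h1)
    rw [neg_div]
    push_cast at this
    linarith

theorem sumList_right {b : ℕ → ℝ} {δ : ℝ} {l p : ℕ} {d s c : ℕ → ℝ}
    (d0 : d p = 0) (s0 : s p = 0) (c0 : c p = 0) :
    SumList b δ (fun _ => True) l l 0 d s c p (p + 1) where
  lt := by omega
  sound x h1 h2 := by
    have : x = p := by omega
    subst this
    exact ⟨fun _ => 0, fun _ => by norm_num, trivial, by simp [dsum, d0], by simp [ssum, s0],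
      by simp [code_self, c0]⟩
  complete w _ _ := ⟨p, le_rfl, by omega, by simp [dsum, d0], by simp [ssum, s0]⟩
  sorted x y h1 h2 h3 := by omega

end SubsetSumRatio

/-! ### Analysis of one attempt -/

namespace RealRAM
open SubsetSumRatio

/-- A labelling of relative difference below `lo` would have representatives with almost the same
difference and no smaller absolute sum, that is, a good pair for `lo`. This is why
`SumList.complete` bounds absolute sums from one side only. -/
theorem searchState_lower {b : ℕ → ℝ} {δ err₁ err₂ η : ℝ} {i l t : ℕ} {D S C : ℕ → ℝ}
    {bL eL bR eR : ℕ} {m : Memory} {lo hi : ℝ}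
    (h₁ : SumList b δ (fun w => w i ≠ 0) i l err₁ D S C bL eL)
    (h₂ : SumList b δ (fun _ => True) l t err₂ D S C bR eR)
    (hil : i ≤ l) (hlt : l ≤ t) (herr : err₁ + err₂ ≤ η)
    (hs : SearchState D S C η bL eL bR eR m lo hi)
    (w : ℕ → ℕ) (hw : Labels w) (hwi : w i ≠ 0) (h0 : 0 ≤ dsum b w i t) :
    lo * ssum b w i t ≤ dsum b w i t := by
  rcases hs.lower with h | h
  · rw [h, zero_mul]; exact h0
  · by_contra hcon
    obtain ⟨x, x1, x2, x3, x4⟩ := h₁.complete w hw hwi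
    obtain ⟨y, y1, y2, y3, y4⟩ := h₂.complete w hw trivial
    refine h x y x1 x2 y1 y2 ?_
    rw [← dsum_add b w hil hlt] at h0 hcon
    rw [← ssum_add b w hil hlt] at hcon
    rw [abs_le] at x3 y3
    have h5 : lo * (ssum b w i l + ssum b w l t) ≤ lo * (S x + S y) :=
      mul_le_mul_of_nonneg_left (by linarith) hs.lo_nonneg
    constructor <;> linarith [x3.1, x3.2, y3.1, y3.2]

/-- Labellings behind the two list elements live on the disjoint ranges `[i, l)` and `[l, t)` and
can be glued. -/
theorem searchState_upper {b : ℕ → ℝ} {δ err₁ err₂ η : ℝ} {i l t : ℕ} {D S C : ℕ → ℝ}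
    {bL eL bR eR : ℕ} {m : Memory} {lo hi : ℝ} (hb : ∀ k, k < t → 0 < b k)
    (h₁ : SumList b δ (fun w => w i ≠ 0) i l err₁ D S C bL eL)
    (h₂ : SumList b δ (fun _ => True) l t err₂ D S C bR eR)
    (hil : i < l) (hlt : l ≤ t)
    (hs : SearchState D S C η bL eL bR eR m lo hi) :
    hi = 1 ∨ ∃ w, Labels w ∧ w i ≠ 0 ∧ |dsum b w i t| ≤ hi * ssum b w i t + η ∧
      m 42 0 = code w i l ∧ m 43 0 = code w l t := by
  refine hs.upper.imp_right ?_
  rintro ⟨u, v, hu1, hu2, hv1, hv2, ⟨g1, g2⟩, h42, h43⟩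
  obtain ⟨w₁, hw₁, hA, a1, a2, a3⟩ := h₁.sound u hu1 hu2
  obtain ⟨w₂, hw₂, -, b1, b2, b3⟩ := h₂.sound v hv1 hv2
  let w : ℕ → ℕ := fun k => if k < l then w₁ k else w₂ k
  have hl : ∀ k, i ≤ k → k < l → w k = w₁ k := fun k _ hk => if_pos hk
  have hr : ∀ k, l ≤ k → k < t → w k = w₂ k := fun k hk _ => if_neg (by omega)
  refine ⟨w, fun k => ?_, ?_, ?_, ?_, ?_⟩
  · simp only [w]; split_ifs
    · exact hw₁ k
    · exact hw₂ k
  · rw [hl i le_rfl hil]; exact hA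
  · rw [← dsum_add b w hil.le hlt, ← ssum_add b w hil.le hlt, dsum_congr hl, dsum_congr hr,
      ssum_congr hl, ssum_congr hr, ← a1, ← a2, ← b1, ← b2, abs_le]
    refine ⟨?_, g2⟩
    have hS : 0 ≤ S u + S v := by
      rw [a2, b2]
      have : ∀ (w : ℕ → ℕ) s e, e ≤ t → 0 ≤ ssum b w s e := fun w s e he =>
        Finset.sum_nonneg fun k hk => mul_nonneg (abs_nonneg _)
          (hb k (by rw [Finset.mem_Ico] at hk; omega)).le
      exact add_nonneg (this _ _ _ hlt) (this _ _ _ le_rfl)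
    have := mul_nonneg (hs.lo_nonneg.trans hs.lo_le) hS
    linarith
  · rw [h42, a3, code_congr hl]
  · rw [h43, b3, code_congr hr]

/-- Building both lists costs `O(n B)`, and `R` scans of lists of length at most `3 B` cost `O(R
B)`; `n (R + 1) B` dominates both. -/
theorem attempt_spec {b : ℕ → ℝ} {n i R : ℕ} {ε B : ℝ} {m : Memory}
    (hb : ∀ k, k < n → 0 < b k) (hi : i < n) (hε : 0 < ε) (hε1 : ε < 1)
    (hR : (1 / 2 : ℝ) ^ R ≤ ε / 16) (hB : 1 ≤ B)
    (hn : m 1 0 = n) (he : m 1 1 = ε) (hm : m 3 = b) (h14 : m 14 0 = B) (h15 : m 15 0 = 0)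
    (h16 : m 16 0 = i) :
    Tri attempt m (2400 * (n * (R + 1) * B)) (fun m' => ∃ l t lo hi,
      AttemptRes b n ε B i l t lo hi m') := by
  have hn0 : (1 : ℝ) ≤ n := by exact_mod_cast (by omega : 1 ≤ n)
  have hbi := hb i hi
  set η := ε * b i / 16 with hη
  have hη0 : 0 < η := by positivity
  set δ := η / n with hδ
  have hδ0 : 0 < δ := by positivity
  have hδη : n * δ = η := by rw [hδ]; field_simp
  have hδb : δ ≤ b i := by
    have : δ ≤ η := by rw [← hδη]; nlinarith
    nlinarith
  unfold attempt
  have hT0 : (n : ℝ) * B ≤ n * (R + 1) * B := by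
    have : (0 : ℝ) ≤ n * R * B := by positivity
    linarith
  have hT1 : (R : ℝ) * B ≤ n * (R + 1) * B := by
    have h1 : (1 : ℝ) * (R * B) ≤ n * (R * B) := mul_le_mul_of_nonneg_right hn0 (by positivity)
    have : (0 : ℝ) ≤ n * B := by positivity
    linarith
  have hT2 : (n : ℝ) ≤ n * B := le_mul_of_one_le_right (by linarith) hB
  have hT3 : (R : ℝ) ≤ R * B := le_mul_of_one_le_right (by positivity) hB
  refine Tri.seq (T₁ := 80) (Q₁ := fun m₁ => m₁ = leftInit.step m)
    (T₂ := 2 * (n * (540 * B + 120)) + (R * (600 * B + 120)) + 200)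
    (Tri.straight (by decide) 80 (by decide) (by norm_num) rfl) ?_ (by linarith)
  rintro _ rfl hf₁
  have hlist₁ : ListMem b δ (fun w => w i ≠ 0) i (i + 1) (leftInit.step m) 0 0 2 := by
    refine ⟨sumList_left hδ0 hδb ?_ ?_ ?_ ?_ ?_ ?_, ?_, ?_, ?_, ?_, ?_⟩ <;>
      simp [leftInit, Memory.set_apply, hn, he, hm, h16, hδ, hη]
  have hη₁ : (leftInit.step m) 30 0 = η := by
    simp [leftInit, Memory.set_apply, he, hm, h16, hη]
  generalize leftInit.step m = m₁ at hlist₁ hη₁ hf₁ ⊢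
  refine Tri.seq (buildLoop_spec (n := n) (B := B) hδ0 hb (by omega) (by omega) ?_
    (by rw [hf₁ 1 (by decide), hn]) (by rw [hf₁ 14 (by decide), h14]) hB
    (by push_cast; linarith) hlist₁)
    (T₂ := n * (540 * B + 120) + (R * (600 * B + 120)) + 180) ?_ (by linarith)
  · intro w k v hk _ hA
    have : i ≠ k := by omega
    simpa [this] using hA
  rintro m₂ ⟨l, p₁, q₁, hl1, hl2, -, -, hlist₂, hlen₂, hbig₂, -⟩ hf₂
  refine Tri.seq (T₁ := 50) (Q₁ := fun m₃ => m₃ = rightInit.step m₂)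
    (T₂ := n * (540 * B + 120) + (R * (600 * B + 120)) + 130)
    (Tri.straight (by decide) 50 (by decide) (by norm_num) rfl) ?_ (by linarith)
  rintro _ rfl hf₃
  have g17 := hlist₂.base
  have g18 := hlist₂.halts
  have g19 := hlist₂.next
  have hlist₃ : ListMem b δ (fun _ => True) l l (rightInit.step m₂) 0 q₁ (q₁ + 1) := by
    refine ⟨sumList_right ?_ ?_ ?_, ?_, ?_, ?_, ?_, ?_⟩ <;>
      simp [rightInit, Memory.set_apply, g18, g19, hlist₂.items, hlist₂.width]
  have hsame₃ : SameBelow q₁ m₂ (rightInit.step m₂) := by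
    intro x hx
    have : x ≠ q₁ := hx.ne
    simp [rightInit, Memory.set_apply, g18, this]
  have e31 : (rightInit.step m₂) 31 0 = p₁ := by simp [rightInit, Memory.set_apply, g17]
  have e32 : (rightInit.step m₂) 32 0 = q₁ := by simp [rightInit, Memory.set_apply, g18]
  have e33 : (rightInit.step m₂) 33 0 = l := by simp [rightInit, Memory.set_apply, g19]
  generalize rightInit.step m₂ = m₃ at hlist₃ hsame₃ e31 e32 e33 hf₃ ⊢
  refine Tri.seq (buildLoop_spec (n := n) (B := B) hδ0 hb le_rfl hl2 (fun _ _ _ _ _ _ => trivial)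
    (by rw [hf₃ 1 (by decide), hf₂ 1 (by decide), hf₁ 1 (by decide), hn])
    (by rw [hf₃ 14 (by decide), hf₂ 14 (by decide), hf₁ 14 (by decide), h14]) hB
    (by push_cast; linarith) hlist₃) (T₂ := (R * (600 * B + 120)) + 100) ?_ (by linarith)
  rintro m₄ ⟨t, p₂, q₂, ht1, ht2, -, -, hlist₄, hlen₄, hbig₄, hsame₄⟩ hf₄
  have hleft := SumList.congr hlist₂.list (hsame₃.trans hsame₄ (by omega))
  refine Tri.seq (T₁ := 20) (Q₁ := fun m₅ => m₅ = searchInit.step m₄)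
    (T₂ := (R * (600 * B + 120)) + 80)
    (Tri.straight (by decide) 20 (by decide) (by norm_num) rfl) ?_ (by linarith)
  rintro _ rfl hf₅
  have hone : m₄ 1 = m 1 := by
    rw [hf₄ 1 (by decide), hf₃ 1 (by decide), hf₂ 1 (by decide), hf₁ 1 (by decide)]
  have hinv : SearchInv (m₄ 5) (m₄ 6) (m₄ 7) ε η p₁ q₁ p₂ q₂ R R (searchInit.step m₄) := by
    refine ⟨⟨m₄ 37 0, ?_⟩, by simp [searchInit, Memory.set_apply, hone, he], 0, 0, 1, by omega, ?_⟩
    · constructor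
      · rw [hf₅ 5 (by decide)]
      · rw [hf₅ 6 (by decide)]
      · rw [hf₅ 7 (by decide)]
      · rw [hf₅ 37 (by decide)]
      · rw [hf₅ 30 (by decide), hf₄ 30 (by decide), hf₃ 30 (by decide), hf₂ 30 (by decide), hη₁]
      · rw [hf₅ 31 (by decide), hf₄ 31 (by decide), e31]
      · rw [hf₅ 32 (by decide), hf₄ 32 (by decide), e32]
      · rw [hf₅ 17 (by decide)]; exact hlist₄.base
      · rw [hf₅ 18 (by decide)]; exact hlist₄.halts
    · refine ⟨by simp [searchInit, Memory.set_apply], by norm_num,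
        by simp [searchInit, Memory.set_apply], by simp [searchInit, Memory.set_apply], ?_⟩
      exact ⟨le_rfl, zero_le_one, Or.inl rfl, Or.inl rfl⟩
  have hm5 : ∀ A, A ∉ [34, 35, 36] → (searchInit.step m₄) A = m₄ A := by
    intro A hA
    simp only [List.mem_cons, List.not_mem_nil, or_false, not_or] at hA
    simp [searchInit, Memory.set_apply, hA]
  generalize searchInit.step m₄ = m₅ at hinv hm5 ⊢
  refine Tri.seq (searchLoop_spec (hleft.sorted_lt hδ0) (hlist₄.list.sorted_lt hδ0)
    hleft.lt.le hlist₄.list.lt.le hR hinv) (T₂ := 60) ?_ ?_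
  swap
  · have : (R : ℝ) * (100 * ((q₁ : ℝ) - p₁ + (q₂ - p₂)) + 120) ≤ R * (600 * B + 120) :=
      mul_le_mul_of_nonneg_left (by linarith) (by positivity)
    linarith
  rintro m₆ ⟨lo, hi', hhi, h35, hst⟩ hf₆
  have k1 : m₆ 1 = m 1 := by rw [hf₆ 1 (by decide), hm5 1 (by decide), hone]
  have k15 : m₆ 15 0 = 0 := by
    rw [hf₆ 15 (by decide), hm5 15 (by decide), hf₄ 15 (by decide), hf₃ 15 (by decide),
      hf₂ 15 (by decide), hf₁ 15 (by decide), h15]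
  have k16 : m₆ 16 0 = i := by
    rw [hf₆ 16 (by decide), hm5 16 (by decide), hf₄ 16 (by decide), hf₃ 16 (by decide),
      hf₂ 16 (by decide), hf₁ 16 (by decide), h16]
  have k19 : m₆ 19 0 = t := by
    rw [hf₆ 19 (by decide), hm5 19 (by decide), hlist₄.next]
  have k33 : m₆ 33 0 = l := by
    rw [hf₆ 33 (by decide), hm5 33 (by decide), hf₄ 33 (by decide), e33]
  refine Tri.straight (by decide) 60 (by decide) (by norm_num) ⟨l, t, lo, hi', ?_⟩
  have hfin : ∀ A, A ≠ 15 → (checkDone.step m₆) A = m₆ A := by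
    intro A hA
    by_cases hc : (Test.or (.le (var 35) (.div (.read 1 one) (.const 4)))
      (.and (.le (var 16) zero) (.le (.read 1 zero) (var 19)))).Holds m₆
    · rw [checkDone, step_cond_true _ _ hc]
      simp [Memory.set_apply, hA]
    · rw [checkDone, step_cond_false _ _ hc, step_skip]
  have hdone : (Test.or (.le (var 35) (.div (.read 1 one) (.const 4)))
      (.and (.le (var 16) zero) (.le (.read 1 zero) (var 19)))).Holds m₆ ↔
      (hi' ≤ ε / 4 ∨ i = 0 ∧ t = n) := by
    have : n ≤ t ↔ t = n := ⟨fun h => by omega, fun h => h.ge⟩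
    simp [h35, k1, he, hn, k16, k19, this, imp_iff_not_or, not_lt]
  have hup := searchState_upper (fun k hk => hb k (by omega)) hleft hlist₄.list (by omega) ht1 hst
  refine ⟨by omega, ht1, ht2, ?_, ?_, ?_, ?_, hhi, hst.lo_nonneg, ?_, ?_, ?_⟩
  · rw [hfin 33 (by norm_num), k33]
  · rw [hfin 19 (by norm_num), k19]
  · intro h N hN
    exact (hbig₂ h).trans_le (SumList.length_le hleft hN)
  · intro h N hN
    exact (hbig₄ h).trans_le (SumList.length_le hlist₄.list hN)
  · refine searchState_lower hleft hlist₄.list (by omega) ht1 ?_ hst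
    -- The two lists have errors `(l - i - 1) δ` and `(t - l) δ`, together at most `n δ = η`.
    rw [← hδη]
    have h1 : (t : ℝ) ≤ n := by exact_mod_cast ht2
    push_cast
    nlinarith [(Nat.cast_nonneg i : (0 : ℝ) ≤ i)]
  · rw [hfin 42 (by norm_num), hfin 43 (by norm_num)]
    exact hup
  · by_cases hc : hi' ≤ ε / 4 ∨ i = 0 ∧ t = n
    · refine Or.inl ⟨?_, hc⟩
      rw [checkDone, step_cond_true _ _ (hdone.mpr hc)]
      simp [Memory.set_apply]
    · refine Or.inr ⟨?_, hc⟩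
      rw [checkDone, step_cond_false _ _ (fun h => hc (hdone.mp h)), step_skip, k15]

end RealRAM

/-! ### Restricted labellings and sufficient budgets -/

namespace SubsetSumRatio

theorem exists_dsums (b : ℕ → ℝ) {s e : ℕ} (h : s ≤ e) :
    ∃ F : Finset ℝ, F.card ≤ 3 ^ (e - s) ∧ ∀ w, Labels w → dsum b w s e ∈ F := by
  induction e, h using Nat.le_induction with
  | base => exact ⟨{0}, by simp, fun w _ => by simp [dsum]⟩
  | succ e he ih =>
    obtain ⟨F, hF, hw⟩ := ih
    refine ⟨(F ×ˢ Finset.range 3).image fun x => x.1 + sgn x.2 * b e, ?_, fun w h => ?_⟩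
    · refine Finset.card_image_le.trans ?_
      rw [Finset.card_product, Finset.card_range, Nat.succ_sub he, pow_succ]
      exact Nat.mul_le_mul_right 3 hF
    · rw [dsum_succ _ _ he]
      exact Finset.mem_image.mpr ⟨(dsum b w s e, w e), by simp [hw w h, h e], rfl⟩

theorem hasBuckets_pow (b : ℕ → ℝ) (δ : ℝ) {s e : ℕ} (h : s ≤ e) :
    HasBuckets b δ s e ((3 : ℝ) ^ (e - s)) := by
  obtain ⟨F, hF, hw⟩ := exists_dsums b h
  refine ⟨F.image fun x => ⌊x / δ⌋, ?_, fun w h => Finset.mem_image_of_mem _ (hw w h)⟩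
  exact_mod_cast Finset.card_image_le.trans hF

/-- The restriction of a labelling to `[s, e)`. -/
def restrict (w : ℕ → ℕ) (s e k : ℕ) : ℕ := if s ≤ k ∧ k < e then w k else 0

theorem Labels.restrict {w : ℕ → ℕ} (h : Labels w) (s e : ℕ) : Labels (restrict w s e) := by
  intro k
  unfold SubsetSumRatio.restrict
  split_ifs
  · exact h k
  · norm_num

theorem sum_restrict (f : ℕ → ℕ → ℝ) (hf : ∀ k, f 0 k = 0) (w : ℕ → ℕ) {s s' e' e : ℕ}
    (h1 : s ≤ s') (h2 : e' ≤ e) :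
    ∑ k ∈ Finset.Ico s e, f (restrict w s' e' k) k = ∑ k ∈ Finset.Ico s' e', f (w k) k := by
  rw [← Finset.sum_subset (Finset.Ico_subset_Ico h1 h2)]
  · refine Finset.sum_congr rfl fun k hk => ?_
    rw [Finset.mem_Ico] at hk
    simp [restrict, hk]
  · intro k _ hk
    rw [Finset.mem_Ico] at hk
    simp [restrict, hk, hf]

theorem dsum_restrict (b : ℕ → ℝ) (w : ℕ → ℕ) {s s' e' e : ℕ} (h1 : s ≤ s') (h2 : e' ≤ e) :
    dsum b (restrict w s' e') s e = dsum b w s' e' :=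
  sum_restrict (fun v k => sgn v * b k) (by simp [sgn]) w h1 h2

theorem ssum_restrict (b : ℕ → ℝ) (w : ℕ → ℕ) {s s' e' e : ℕ} (h1 : s ≤ s') (h2 : e' ≤ e) :
    ssum b (restrict w s' e') s e = ssum b w s' e' :=
  sum_restrict (fun v k => |sgn v| * b k) (by simp [sgn]) w h1 h2

theorem HasBuckets.mono {b : ℕ → ℝ} {δ : ℝ} {s s' e' e : ℕ} {N N' : ℝ} (h : HasBuckets b δ s e N)
    (h1 : s ≤ s') (h2 : e' ≤ e) (hN : N ≤ N') : HasBuckets b δ s' e' N' := by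
  obtain ⟨G, hG, hw⟩ := h
  refine ⟨G, hG.trans hN, fun w h => ?_⟩
  rw [← dsum_restrict b w h1 h2]
  exact hw _ (h.restrict _ _)

theorem abs_sgn {v : ℕ} (h : v < 3) (h0 : v ≠ 0) : |sgn v| = 1 := by
  interval_cases v <;> simp_all [sgn]

theorem le_ssum {b : ℕ → ℝ} {n : ℕ} (hb : ∀ k, k < n → 0 < b k) {w : ℕ → ℕ} (hw : Labels w)
    {i e : ℕ} (hi : i < e) (he : e ≤ n) (hwi : w i ≠ 0) : b i ≤ ssum b w i e := by
  have h := Finset.single_le_sum (f := fun k => |sgn (w k)| * b k) (s := Finset.Ico i e)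
    (fun k hk => mul_nonneg (abs_nonneg _)
      (hb k (by rw [Finset.mem_Ico] at hk; omega)).le) (Finset.mem_Ico.mpr ⟨le_rfl, hi⟩)
  simp only [abs_sgn (hw i) hwi, one_mul] at h
  exact h

/-- Conditions under which the attempt with largest item `i` and budget `B` is successful. -/
def Suffices (b : ℕ → ℝ) (n : ℕ) (ε B : ℝ) (i : ℕ) : Prop :=
  i < n ∧ ∃ l J, i < J ∧ l ≤ J ∧ J ≤ n ∧ (3 : ℝ) ^ l ≤ B ∧
    HasBuckets b (ε * b i / 16 / n) l J B ∧
    ((i = 0 ∧ J = n) ∨ ∃ w, Labels w ∧ w i ≠ 0 ∧ 0 ≤ dsum b w i J ∧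
      dsum b w i J ≤ ε / 16 * b i)

theorem Suffices.mono {b : ℕ → ℝ} {n i : ℕ} {ε B B' : ℝ} (h : Suffices b n ε B i) (hB : B ≤ B') :
    Suffices b n ε B' i := by
  obtain ⟨h0, l, J, h1, h2, h3, h4, h5, h6⟩ := h
  exact ⟨h0, l, J, h1, h2, h3, h4.trans hB, h5.mono le_rfl le_rfl hB, h6⟩

end SubsetSumRatio

namespace RealRAM
open SubsetSumRatio

/-- A list over fewer than `l₀` items has fewer than `3 ^ l₀ ≤ B` elements, so the first list
reaches `l₀` or all items are used up. The second then cannot outgrow the buckets of `[l₀, J)`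
before `J`. So either everything is covered, or the witness gives `lo * b i ≤ ε / 16 * b i` and thus
`hi ≤ ε / 8`. -/
theorem AttemptRes.success {b : ℕ → ℝ} {n i l t : ℕ} {ε B lo hi : ℝ} {m : Memory}
    (hb : ∀ k, k < n → 0 < b k) (hε : 0 < ε)
    (h : AttemptRes b n ε B i l t lo hi m) (hs : Suffices b n ε B i) : m 15 0 = 1 := by
  obtain ⟨hin, l₀, J, hiJ, hlJ, hJn, h3, hbk, hor⟩ := hs
  have hil := h.i_lt
  have hlt := h.l_le
  have htn := h.t_le
  have hl : l = n ∨ l₀ ≤ l := by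
    by_contra hcon
    push Not at hcon
    have h1 := h.left (by omega) _ (hasBuckets_pow b _ hil.le)
    have h2 := (pow_lt_pow_iff_right₀ (by norm_num : (1 : ℝ) < 3)).mp (h3.trans_lt h1)
    omega
  have ht : J ≤ t := by
    by_contra hcon
    exact lt_irrefl _ (h.right (by omega) B (hbk.mono (by omega) (by omega) le_rfl))
  have hfin : hi ≤ ε / 4 ∨ i = 0 ∧ t = n := by
    rcases hor with ⟨h1, h2⟩ | ⟨w, hw, hwi, h1, h2⟩
    · exact Or.inr ⟨h1, by omega⟩
    · left
      have hw' := hw.restrict i J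
      have hwi' : restrict w i J i ≠ 0 := by simpa [restrict, hiJ] using hwi
      have hd : dsum b (restrict w i J) i t = dsum b w i J := dsum_restrict b w le_rfl ht
      have h4 := h.lower _ hw' hwi' (by rw [hd]; exact h1)
      have h5 := le_ssum hb hw' (by omega : i < t) htn hwi'
      have h6 := hb i hin
      rw [hd] at h4
      have h7 : lo ≤ ε / 16 := by
        by_contra hcon
        push Not at hcon
        nlinarith
      have := h.hi_le
      linarith
  rcases h.done with h1 | h1
  · exact h1.1
  · exact absurd hfin h1.2

theorem AttemptRes.congr {b : ℕ → ℝ} {n i l t : ℕ} {ε B lo hi : ℝ} {m m' : Memory}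
    (h : AttemptRes b n ε B i l t lo hi m)
    (hf : ∀ A, A ∈ [15, 19, 33, 42, 43] → m' A = m A) :
    AttemptRes b n ε B i l t lo hi m' where
  i_lt := h.i_lt
  l_le := h.l_le
  t_le := h.t_le
  m33 := by rw [hf 33 (by decide)]; exact h.m33
  m19 := by rw [hf 19 (by decide)]; exact h.m19
  left := h.left
  right := h.right
  hi_le := h.hi_le
  lo_nonneg := h.lo_nonneg
  lower := h.lower
  upper := by rw [hf 42 (by decide), hf 43 (by decide)]; exact h.upper
  done := by rw [hf 15 (by decide)]; exact h.done

/-! ### Trying all largest items and increasing budgets -/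

def tryBody : Program := attempt ;; .cond (.le (var 15) zero) (assign 16 (.add (var 16) one)) .skip

def tryLoop : Program :=
  .loop (.and (.lt (var 16) (.read 1 zero)) (.le (var 15) zero)) tryBody

def budgetBody : Program := assign 16 zero ;; tryLoop ;; assign 14 (.mul (.const 2) (var 14))

def budgetLoop : Program := .loop (.le (var 15) zero) budgetBody

/-- The search has been successful. -/
def Success (b : ℕ → ℝ) (n : ℕ) (ε : ℝ) (m : Memory) : Prop :=
  m 15 0 = 1 ∧ ∃ B i l t lo hi, m 16 0 = (i : ℕ) ∧ AttemptRes b n ε B i l t lo hi m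

/-- The data that the search does not change. -/
structure Base (b : ℕ → ℝ) (n : ℕ) (ε : ℝ) (m : Memory) : Prop where
  n : m 1 0 = n
  eps : m 1 1 = ε
  items : m 3 = b

theorem Base.congr {b : ℕ → ℝ} {n : ℕ} {ε : ℝ} {m m' : Memory} (h : Base b n ε m)
    (h1 : m' 1 = m 1) (h3 : m' 3 = m 3) : Base b n ε m' :=
  ⟨by rw [h1, h.n], by rw [h1, h.eps], by rw [h3, h.items]⟩

theorem tryLoop_spec {b : ℕ → ℝ} {n R : ℕ} {ε B : ℝ} {m : Memory}
    (hb : ∀ k, k < n → 0 < b k) (hn1 : 1 ≤ n) (hε : 0 < ε) (hε1 : ε < 1)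
    (hR : (1 / 2 : ℝ) ^ R ≤ ε / 16) (hB : 1 ≤ B)
    (hm : Base b n ε m) (h14 : m 14 0 = B) (h15 : m 15 0 = 0) (h16 : m 16 0 = 0) :
    Tri tryLoop m (2600 * (n ^ 2 * (R + 1) * B)) (fun m' => Success b n ε m' ∨
      (m' 15 0 = 0 ∧ ∀ i, ¬ Suffices b n ε B i)) := by
  have hn0 : (1 : ℝ) ≤ n := by exact_mod_cast hn1
  let Inv : ℕ → Memory → Prop := fun k m => Base b n ε m ∧ m 14 0 = B ∧ (Success b n ε m ∨
    (m 15 0 = 0 ∧ ∃ i, m 16 0 = (i : ℕ) ∧ k + i = n ∧ ∀ i', i' < i → ¬ Suffices b n ε B i'))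
  have hinit : Inv n m := ⟨hm, h14, Or.inr ⟨h15, 0, by simpa using h16, by omega,
    fun _ h => absurd h (Nat.not_lt_zero _)⟩⟩
  have hX : 1 ≤ (n : ℝ) * (R + 1) * B := by
    have h1 : (1 : ℝ) ≤ R + 1 := by linarith [(Nat.cast_nonneg R : (0 : ℝ) ≤ R)]
    exact one_le_mul_of_one_le_of_one_le (one_le_mul_of_one_le_of_one_le hn0 h1) hB
  refine (Tri.loop (2400 * (n * (R + 1) * B) + 60) (by linarith) Inv 30 (by decide) ?_ n m
    hinit).mono ?_ ?_
  · rintro k m₁ ⟨hm₁, g14, hor⟩ hg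
    have hg15 : m₁ 15 0 ≤ 0 := by
      simp only [holds_and, holds_le, eval_read, eval_const, Int.cast_zero, Nat.floor_zero] at hg
      exact hg.2
    rcases hor with ⟨h, -⟩ | ⟨g15, i, g16, hk, hno⟩
    · rw [h] at hg15; norm_num at hg15
    have hi : i < n := by
      simp only [holds_and, holds_not, holds_le, eval_read, eval_const, Int.cast_zero,
        Nat.floor_zero, g16, hm₁.n, not_le, Nat.cast_lt] at hg
      exact hg.1
    refine ⟨k - 1, by omega, Tri.seq (attempt_spec hb hi hε hε1 hR hB hm₁.n hm₁.eps hm₁.items g14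
      g15 g16) (T₂ := 40) ?_ (by linarith)⟩
    rintro m₂ ⟨l, t, lo, hi', hres⟩ hf₂
    have hm₂ : Base b n ε m₂ := hm₁.congr (hf₂ 1 (by decide)) (hf₂ 3 (by decide))
    have e14 : m₂ 14 0 = B := by rw [hf₂ 14 (by decide), g14]
    have e16 : m₂ 16 0 = i := by rw [hf₂ 16 (by decide), g16]
    refine Tri.straight (by decide) 40 (by decide) (by norm_num) ?_
    rcases hres.done with ⟨d1, -⟩ | ⟨d1, -⟩
    · rw [step_cond_false _ _ (by simp [d1]), step_skip]
      exact ⟨hm₂, e14, Or.inl ⟨d1, B, i, l, t, lo, hi', e16, hres⟩⟩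
    · rw [step_cond_true _ _ (by simp [d1])]
      refine ⟨hm₂.congr (by simp [Memory.set_apply]) (by simp [Memory.set_apply]),
        by simp [Memory.set_apply, e14], Or.inr ⟨by simp [Memory.set_apply, d1], i + 1,
        by simp [Memory.set_apply, e16], by omega, ?_⟩⟩
      intro i' h hs
      rcases Nat.lt_succ_iff_lt_or_eq.mp h with h | rfl
      · exact hno i' h hs
      · have := hres.success hb hε hs
        rw [d1] at this
        norm_num at this
  · have h1 : (1 : ℝ) * n ≤ (n * (R + 1) * B) * n := mul_le_mul_of_nonneg_right hX (by linarith)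
    have h2 : (n : ℝ) ^ 2 * (R + 1) * B = (n * (R + 1) * B) * n := by ring
    rw [h2]
    push_cast
    nlinarith
  · rintro m' ⟨⟨k, hm₁, g14, hor⟩, hg⟩ -
    refine hor.imp_right ?_
    rintro ⟨g15, i, g16, hk, hno⟩
    refine ⟨g15, fun i' hs => hno i' ?_ hs⟩
    simp only [holds_and, holds_not, holds_le, eval_read, eval_const, Int.cast_zero,
      Nat.floor_zero, g16, g15, hm₁.n, not_le, Nat.cast_lt, le_refl, and_true, not_lt] at hg
    exact hs.1.trans_le hg

/-- The budgets `1, 2, 4, …, 2 ^ K` form a geometric series, so all rounds together cost a constant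
multiple of the last one. -/
theorem budgetLoop_spec {b : ℕ → ℝ} {n R K : ℕ} {ε : ℝ} {m : Memory}
    (hb : ∀ k, k < n → 0 < b k) (hn1 : 1 ≤ n) (hε : 0 < ε) (hε1 : ε < 1)
    (hR : (1 / 2 : ℝ) ^ R ≤ ε / 16) (hK : ∃ i, Suffices b n ε (2 ^ K) i)
    (hm : Base b n ε m) (h14 : m 14 0 = 1) (h15 : m 15 0 = 0) :
    Tri budgetLoop m (3000 * (n ^ 2 * (R + 1)) * 2 ^ (K + 2)) (Success b n ε) := by
  have hn0 : (1 : ℝ) ≤ n := by exact_mod_cast hn1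
  set W : ℝ := 2800 * (n ^ 2 * (R + 1)) with hW
  have hW0 : 2800 ≤ W := by
    have h1 : (1 : ℝ) ≤ R + 1 := by linarith [(Nat.cast_nonneg R : (0 : ℝ) ≤ R)]
    have := one_le_mul_of_one_le_of_one_le (one_le_pow₀ hn0 (n := 2)) h1
    linarith
  let Inv : ℕ → Memory → Prop := fun k m => Success b n ε m ∨
    (Base b n ε m ∧ m 15 0 = 0 ∧ m 14 0 = 2 ^ (K + 1) * (1 / 2) ^ k ∧ 0 < k ∧ k ≤ K + 1)
  have hinit : Inv (K + 1) m := Or.inr ⟨hm, h15, by rw [h14, ← mul_pow]; norm_num, by omega, le_rfl⟩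
  have hpow : ∀ k : ℕ, (1 / 2 : ℝ) ^ k ≤ 1 := fun k => pow_le_one₀ (by norm_num) (by norm_num)
  -- With `k` rounds left the budget is `B = 2 ^ (K + 1) / 2 ^ k`, and the potential drops by `2 *
  -- (W * B)` in that round.
  refine (Tri.loop_pot (fun k => W * 2 ^ (K + 2) * (1 - (1 / 2) ^ k) + 10) Inv 10 (by decide)
    ?_ ?_ (K + 1) m hinit).mono ?_ ?_
  · intro k
    have := hpow k
    have : 0 ≤ W * 2 ^ (K + 2) * (1 - (1 / 2) ^ k) := by
      apply mul_nonneg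
      · positivity
      · linarith
    push_cast
    linarith
  · rintro k m₁ (⟨h, -⟩ | ⟨hm₁, g15, g14, hk0, hk⟩) hg
    · simp [h] at hg
      norm_num at hg
    set B : ℝ := 2 ^ (K + 1) * (1 / 2) ^ k with hB
    have hB1 : 1 ≤ B := by
      calc (1 : ℝ) = 2 ^ k * (1 / 2) ^ k := by rw [← mul_pow]; norm_num
        _ ≤ B := mul_le_mul_of_nonneg_right (pow_le_pow_right₀ (by norm_num) hk) (by positivity)
    obtain ⟨k, rfl⟩ : ∃ k', k = k' + 1 := ⟨k - 1, by omega⟩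
    refine ⟨W * B + 40, k, by omega, ?_, ?_⟩
    · refine Tri.seq (T₁ := 10) (T₂ := W * B + 30) (Q₁ := fun m₂ => m₂ = (assign 16 zero).step m₁)
        (Tri.straight (by decide) 10 (by decide) (by norm_num) rfl) ?_ (by linarith)
      rintro _ rfl hf₂
      refine Tri.seq (tryLoop_spec hb hn1 hε hε1 hR hB1
        (hm₁.congr (hf₂ 1 (by decide)) (hf₂ 3 (by decide))) (by rw [hf₂ 14 (by decide), g14])
        (by rw [hf₂ 15 (by decide), g15]) (by simp [Memory.set_apply])) (T₂ := 30) ?_ ?_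
      · rintro m₃ hor hf₃
        refine Tri.straight (by decide) 30 (by decide) (by norm_num) ?_
        rcases hor with ⟨d1, B', i, l, t, lo, hi, e16, hres⟩ | ⟨d1, hno⟩
        · refine Or.inl ⟨by simp [Memory.set_apply, d1], B', i, l, t, lo, hi,
            by simp [Memory.set_apply, e16], hres.congr fun A hA => ?_⟩
          have : A ≠ 14 := by rintro rfl; simp at hA
          simp [Memory.set_apply, this]
        · right
          refine ⟨hm₁.congr ?_ ?_, by simp [Memory.set_apply, d1], ?_, ?_, by omega⟩
          · simp [Memory.set_apply, hf₃ 1 (by decide)]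
          · simp [Memory.set_apply, hf₃ 3 (by decide)]
          · rw [pow_succ] at hB
            simp [Memory.set_apply, hf₃ 14 (by decide), g14, hB]
            ring
          -- At `k = 0` the round with budget `2 ^ K` would have failed, against `hK`.
          · rcases Nat.eq_zero_or_pos k with rfl | h
            · exfalso
              obtain ⟨i, hi⟩ := hK
              refine hno i ?_
              have : B = 2 ^ K := by rw [hB, pow_succ]; ring
              rw [this]
              exact hi
            · exact h
      · have h1 : 2800 * (n ^ 2 * (R + 1)) * B = 2800 * ((n : ℝ) ^ 2 * (R + 1) * B) := by ring
        have h2 : W ≤ W * B := le_mul_of_one_le_right (by linarith) hB1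
        rw [hW] at h2 ⊢
        nlinarith
    · have h1 : W * 2 ^ (K + 2) * (1 - (1 / 2) ^ (k + 1)) - W * 2 ^ (K + 2) * (1 - (1 / 2) ^ k) =
          2 * (W * B) := by
        rw [hB, pow_succ 2 (K + 1), pow_succ (1 / 2 : ℝ) k]; ring
      have h2 : W ≤ W * B := le_mul_of_one_le_right (by linarith) hB1
      push_cast
      linarith
  · have h1 : W * 2 ^ (K + 2) * (1 - (1 / 2) ^ (K + 1)) ≤ W * 2 ^ (K + 2) * 1 := by
      apply mul_le_mul_of_nonneg_left _ (by positivity)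
      have : (0 : ℝ) ≤ (1 / 2) ^ (K + 1) := by positivity
      linarith
    have h2 : (1 : ℝ) ≤ 2 ^ (K + 2) := one_le_pow₀ (by norm_num)
    have h3 : 3000 * ((n : ℝ) ^ 2 * (R + 1)) * 2 ^ (K + 2) =
      W * 2 ^ (K + 2) + 200 * (n ^ 2 * (R + 1)) * 2 ^ (K + 2) := by rw [hW]; ring
    have h4 : 200 ≤ 200 * ((n : ℝ) ^ 2 * (R + 1)) := by rw [hW] at hW0; linarith
    have h5 : 200 * 1 ≤ 200 * ((n : ℝ) ^ 2 * (R + 1)) * 2 ^ (K + 2) := by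
      apply mul_le_mul h4 h2 zero_le_one (by linarith)
    linarith
  · rintro m' ⟨⟨k, h | ⟨-, h, -⟩⟩, hg⟩ -
    · exact h
    · simp [h] at hg

end RealRAM

namespace RealRAM
open SubsetSumRatio

/-! ### Sorting the items -/

/-- The number of items larger than item `r`. -/
noncomputable def rank (A : ℕ → ℝ) (n r : ℕ) : ℕ :=
  ((Finset.range n).filter fun s => A r < A s).card

theorem rank_lt_rank {A : ℕ → ℝ} {n r s : ℕ} (hs : s < n) (h : A r < A s) :
    rank A n s < rank A n r := by
  refine Finset.card_lt_card (Finset.ssubset_iff_of_subset ?_ |>.mpr ⟨s, ?_, ?_⟩)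
  · intro x hx
    rw [Finset.mem_filter] at hx ⊢
    exact ⟨hx.1, h.trans hx.2⟩
  · simp [hs, h]
  · simp

theorem rank_lt {A : ℕ → ℝ} {n r : ℕ} (hr : r < n) : rank A n r < n := by
  have : rank A n r < (Finset.range n).card :=
    Finset.card_lt_card (Finset.filter_ssubset.mpr ⟨r, by simpa using hr, lt_irrefl _⟩)
  simpa using this

theorem rank_inj {A : ℕ → ℝ} {n r s : ℕ} (hA : ∀ r s, r < n → s < n → A r = A s → r = s)
    (hr : r < n) (hs : s < n) (h : rank A n r = rank A n s) : r = s := by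
  rcases lt_trichotomy (A r) (A s) with h1 | h1 | h1
  · exact absurd h (rank_lt_rank hs h1).ne'
  · exact hA r s hr hs h1
  · exact absurd h (rank_lt_rank hr h1).ne

theorem rank_surj {A : ℕ → ℝ} {n k : ℕ} (hA : ∀ r s, r < n → s < n → A r = A s → r = s)
    (hk : k < n) : ∃ r, r < n ∧ rank A n r = k := by
  have h := Finset.surj_on_of_inj_on_of_card_le (s := Finset.range n) (t := Finset.range n)
    (fun r _ => rank A n r) (fun r hr => by simpa using rank_lt (by simpa using hr))
    (fun r s hr hs h => rank_inj hA (by simpa using hr) (by simpa using hs) h) le_rfl k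
    (by simpa using hk)
  obtain ⟨r, hr, h⟩ := h
  exact ⟨r, by simpa using hr, h.symm⟩

def countBody : Program :=
  .cond (.lt (.read 0 (var 10)) (.read 0 (var 11))) (assign 12 (.add (var 12) one)) .skip ;;
  assign 11 (.add (var 11) one)

def countLoop : Program := .loop (.lt (var 11) (.read 1 zero)) countBody

/-- Label `1` for rank zero and `2` for all other ranks is already the final output when the largest
item dominates; variable 13 accumulates the sum needed for that test. -/
def placeItem : Program :=
  .write 3 (var 12) (.read 0 (var 10)) ;; .write 4 (var 12) (var 10) ;;
  .cond (.le (var 12) zero) (.write 2 (var 10) one) (.write 2 (var 10) (.const 2)) ;;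
  assign 13 (.add (var 13) (.read 0 (var 10))) ;; assign 10 (.add (var 10) one)

def rankBody : Program := assign 11 zero ;; assign 12 zero ;; countLoop ;; placeItem

def rankLoop : Program := .loop (.lt (var 10) (.read 1 zero)) rankBody

theorem countLoop_spec {A : ℕ → ℝ} {n r : ℕ} {m : Memory} (h0 : m 0 = A) (h1 : m 1 0 = n)
    (h10 : m 10 0 = r) (h11 : m 11 0 = 0) (h12 : m 12 0 = 0) :
    Tri countLoop m (60 * n + 10) (fun m' => m' 12 0 = rank A n r) := by
  let Inv : ℕ → Memory → Prop := fun k m => m 0 = A ∧ m 1 0 = n ∧ m 10 0 = r ∧ ∃ s,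
    k + s = n ∧ m 11 0 = (s : ℕ) ∧
    m 12 0 = (((Finset.range s).filter fun s => A r < A s).card : ℕ)
  have hinit : Inv n m := ⟨h0, h1, h10, 0, by simp, by simpa using h11, by simpa using h12⟩
  refine (Tri.loop 50 (by norm_num) Inv 10 (by decide) ?_ n m hinit).mono (by push_cast; linarith) ?_
  · rintro k m₁ ⟨g0, g1, g10, s, hk, g11, g12⟩ hg
    simp only [holds_not, holds_le, eval_read, eval_const, Int.cast_zero, Nat.floor_zero, g1, g11,
      not_le, Nat.cast_lt] at hg
    refine ⟨k - 1, by omega, Tri.straight (by decide) 50 (by decide) (by norm_num) ?_⟩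
    by_cases hc : A r < A s
    · rw [countBody, step_seq, step_cond_true _ _ (by simpa [g0, g10, g11] using hc)]
      refine ⟨by simp [Memory.set_apply, g0], by simp [Memory.set_apply, g1],
        by simp [Memory.set_apply, g10], s + 1, by omega, by simp [Memory.set_apply, g11], ?_⟩
      rw [Finset.range_add_one, Finset.filter_insert, if_pos hc, Finset.card_insert_of_notMem
        (by simp)]
      simp [Memory.set_apply, g12]
    · rw [countBody, step_seq, step_cond_false _ _ (by simpa [g0, g10, g11] using hc)]
      refine ⟨by simp [Memory.set_apply, g0], by simp [Memory.set_apply, g1],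
        by simp [Memory.set_apply, g10], s + 1, by omega, by simp [Memory.set_apply, g11], ?_⟩
      rw [Finset.range_add_one, Finset.filter_insert, if_neg hc]
      simp [Memory.set_apply, g12]
  · rintro m' ⟨⟨k, g0, g1, g10, s, hk, g11, g12⟩, hg⟩ -
    simp only [holds_not, holds_le, eval_read, eval_const, Int.cast_zero, Nat.floor_zero, g1, g11,
      not_le, Nat.cast_lt] at hg
    have : s = n := by omega
    rw [g12, this, rank]

/-- The items have been sorted, `π k` being the original position of the item of rank `k`. -/
structure Ranked (A : ℕ → ℝ) (n : ℕ) (π : ℕ → ℕ) (m : Memory) : Prop where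
  pi_lt : ∀ k, k < n → π k < n
  pi_inj : ∀ k k', k < n → k' < n → π k = π k' → k = k'
  items : ∀ k, k < n → m 3 k = A (π k)
  index : ∀ k, k < n → m 4 k = π k
  anti : ∀ k k', k < k' → k' < n → m 3 k' < m 3 k
  label : ∀ k, k < n → m 2 (π k) = if k = 0 then 1 else 2
  total : m 13 0 = ∑ k ∈ Finset.Ico 0 n, m 3 k

theorem rankLoop_spec {A : ℕ → ℝ} {n : ℕ} {m : Memory}
    (hA : ∀ r s, r < n → s < n → A r = A s → r = s) (h0 : m 0 = A) (h1 : m 1 0 = n)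
    (h10 : m 10 0 = 0) (h13 : m 13 0 = 0) :
    Tri rankLoop m (n * (60 * n + 120) + 10) (fun m' => ∃ π, Ranked A n π m') := by
  let Inv : ℕ → Memory → Prop := fun k m => m 0 = A ∧ m 1 0 = n ∧ ∃ r, k + r = n ∧
    m 10 0 = (r : ℕ) ∧ m 13 0 = ∑ s ∈ Finset.range r, A s ∧ ∀ s, s < r →
      m 3 (rank A n s) = A s ∧ m 4 (rank A n s) = s ∧ m 2 s = if rank A n s = 0 then 1 else 2
  have hinit : Inv n m := ⟨h0, h1, 0, by simp, by simpa using h10, by simpa using h13,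
    fun s h => absurd h (Nat.not_lt_zero s)⟩
  refine (Tri.loop (60 * n + 110) (by positivity) Inv 10 (by decide) ?_ n m hinit).mono
    (by push_cast; linarith) ?_
  · rintro k m₁ ⟨g0, g1, r, hk, g10, g13, hr⟩ hg
    simp only [holds_not, holds_le, eval_read, eval_const, Int.cast_zero, Nat.floor_zero, g1, g10,
      not_le, Nat.cast_lt] at hg
    refine ⟨k - 1, by omega, Tri.seq (T₁ := 10) (T₂ := 60 * n + 100)
      (Q₁ := fun m₂ => m₂ = (assign 11 zero).step m₁)
      (Tri.straight (by decide) 10 (by decide) (by norm_num) rfl) ?_ (by linarith)⟩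
    rintro _ rfl -
    refine Tri.seq (T₁ := 10) (T₂ := 60 * n + 90)
      (Q₁ := fun m₃ => m₃ = (assign 12 zero).step ((assign 11 zero).step m₁))
      (Tri.straight (by decide) 10 (by decide) (by norm_num) rfl) ?_ (by linarith)
    rintro _ rfl -
    have hfr : ∀ X, X ≠ 11 → X ≠ 12 → (assign 12 zero).step ((assign 11 zero).step m₁) X = m₁ X := by
      intro X h11 h12
      simp [Memory.set_apply, h11, h12]
    refine Tri.seq (countLoop_spec (A := A) (n := n) (r := r)
      (by rw [hfr 0 (by decide) (by decide), g0])
      (by rw [hfr 1 (by decide) (by decide), g1]) (by rw [hfr 10 (by decide) (by decide), g10])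
      (by simp [Memory.set_apply]) (by simp [Memory.set_apply])) (T₂ := 80) ?_ (by linarith)
    intro m₄ h12 hf
    have hfr' : ∀ X, X ≠ 11 → X ≠ 12 → m₄ X = m₁ X := by
      intro X h11 h12
      rw [hf X (by
        have : countLoop.writes = [12, 11] := rfl
        simp [this, h11, h12]), hfr X h11 h12]
    have e0 : m₄ 0 = A := by rw [hfr' 0 (by decide) (by decide), g0]
    have e10 : m₄ 10 0 = r := by rw [hfr' 10 (by decide) (by decide), g10]
    refine Tri.straight (by decide) 80 (by decide) (by norm_num) ?_
    have hstep : ∀ x, (placeItem.step m₄) 3 x = Function.update (m₄ 3) (rank A n r) (A r) x ∧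
        (placeItem.step m₄) 4 x = Function.update (m₄ 4) (rank A n r) r x ∧
        (placeItem.step m₄) 2 x =
          Function.update (m₄ 2) r (if rank A n r = 0 then 1 else 2) x ∧
        (placeItem.step m₄) 0 = A ∧ (placeItem.step m₄) 1 = m₄ 1 ∧
        (placeItem.step m₄) 13 0 = m₄ 13 0 + A r ∧
        (placeItem.step m₄) 10 0 = r + 1 := by
      intro x
      by_cases hc : rank A n r = 0
      · simp only [placeItem, step_seq]
        rw [step_cond_true _ _ (by simp [Memory.set_apply, h12, hc])]
        simp [Memory.set_apply, h12, e0, e10, hc]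
      · simp only [placeItem, step_seq]
        rw [step_cond_false _ _ (by simp [Memory.set_apply, h12, hc])]
        simp [Memory.set_apply, h12, e0, e10, hc]
    refine ⟨(hstep 0).2.2.2.1, ?_, r + 1, by omega, ?_, ?_, ?_⟩
    · rw [(hstep 0).2.2.2.2.1, hfr' 1 (by decide) (by decide), g1]
    · rw [(hstep 0).2.2.2.2.2.2]; push_cast; rfl
    · rw [(hstep 0).2.2.2.2.2.1, hfr' 13 (by decide) (by decide), g13, Finset.sum_range_succ]
    · intro s hs
      rw [(hstep _).1, (hstep _).2.1, (hstep _).2.2.1]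
      rcases Nat.lt_succ_iff_lt_or_eq.mp hs with hs | rfl
      · have hne : rank A n s ≠ rank A n r := fun h => by
          have := rank_inj hA (by omega) hg h
          omega
        simp only [Function.update_of_ne hne, Function.update_of_ne hs.ne]
        rw [hfr' 3 (by decide) (by decide), hfr' 4 (by decide) (by decide),
          hfr' 2 (by decide) (by decide)]
        exact hr s hs
      · simp
  · rintro m' ⟨⟨k, g0, g1, r, hk, g10, g13, hr⟩, hg⟩ -
    simp only [holds_not, holds_le, eval_read, eval_const, Int.cast_zero, Nat.floor_zero, g1, g10,
      not_le, Nat.cast_lt] at hg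
    have hrn : r = n := by omega
    subst hrn
    have hsurj : ∀ k, ∃ s, k < r → s < r ∧ rank A r s = k := by
      intro k
      by_cases h : k < r
      · obtain ⟨s, hs⟩ := rank_surj hA h
        exact ⟨s, fun _ => hs⟩
      · exact ⟨0, fun h' => absurd h' h⟩
    choose π hπ using hsurj
    have hitems : ∀ k, k < r → m' 3 k = A (π k) := by
      intro k hk
      obtain ⟨h2, h3⟩ := hπ k hk
      have := (hr _ h2).1
      rwa [h3] at this
    have hinj : ∀ k k', k < r → k' < r → π k = π k' → k = k' := by
      intro k k' hk hk' h
      rw [← (hπ k hk).2, ← (hπ k' hk').2, h]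
    refine ⟨π, fun k hk => (hπ k hk).1, hinj, hitems, ?_, ?_, ?_, ?_⟩
    · intro k hk
      obtain ⟨h2, h3⟩ := hπ k hk
      have := (hr _ h2).2.1
      rwa [h3] at this
    · intro k k' h hk'
      have hk : k < r := h.trans hk'
      rw [hitems k hk, hitems k' hk']
      obtain ⟨h2, h3⟩ := hπ k hk
      obtain ⟨h2', h3'⟩ := hπ k' hk'
      by_contra hcon
      rcases (not_lt.mp hcon).lt_or_eq with h4 | h4
      · have := rank_lt_rank h2' h4
        omega
      · have := hinj _ _ hk hk' (hA _ _ h2 h2' h4)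
        omega
    · intro k hk
      obtain ⟨h2, h3⟩ := hπ k hk
      have := (hr _ h2).2.2
      rwa [h3] at this
    · rw [g13, ← Finset.range_eq_Ico, Finset.sum_congr rfl fun k hk =>
        hitems k (Finset.mem_range.mp hk)]
      refine (Finset.sum_bij (fun k _ => π k) ?_ ?_ ?_ ?_).symm
      · intro k hk; simpa using (hπ k (by simpa using hk)).1
      · intro k hk k' hk' h; exact hinj k k' (by simpa using hk) (by simpa using hk') h
      · intro s hs
        have hs' : s < r := by simpa using hs
        have hlt := rank_lt (A := A) hs'
        obtain ⟨h2, h3⟩ := hπ _ hlt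
        exact ⟨rank A r s, by simpa using hlt, rank_inj hA h2 hs' h3⟩
      · intro k _; rfl

/-! ### Writing the output -/

def popDigit (x : ℕ) : Program :=
  assign 46 (.sub (var x) (.mul (.const 3) (.floor (.div (var x) (.const 3))))) ;;
  assign x (.floor (.div (var x) (.const 3)))

/-- The last item is the least significant digit, so decoding runs downwards. Items from `t` on are
unused, those in `[l, t)` are read from variable 43, those below `l` from variable 42, which is
exhausted and yields zeros below `i`. -/
def decodeBody : Program :=
  assign 44 (.sub (var 44) one) ;;
  .cond (.le (var 19) (var 44)) (assign 46 zero)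
    (.cond (.le (var 33) (var 44)) (popDigit 43) (popDigit 42)) ;;
  .write 2 (.read 4 (var 44)) (var 46)

def decodeLoop : Program := .loop (.lt zero (var 44)) decodeBody

theorem floor_digit (c v : ℕ) (hv : v < 3) : ⌊((3 * c + v : ℕ) : ℝ) / 3⌋ = c := by
  rw [Int.floor_eq_iff]
  have : (v : ℝ) < 3 := by exact_mod_cast hv
  have : (0 : ℝ) ≤ v := by positivity
  push_cast
  constructor <;> linarith

theorem code_digit {w : ℕ → ℕ} (hw : Labels w) (s k e : ℕ) (h : k < e) :
    ∃ c v : ℕ, v < 3 ∧ code w s (k + 1) = 3 * c + v ∧ code w s k = c ∧ v = restrict w s e k := by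
  by_cases hs : s ≤ k
  · exact ⟨code w s k, w k, hw k, code_succ w hs, rfl, by simp [restrict, hs, h]⟩
  · exact ⟨0, 0, by norm_num, code_of_le w (by omega), code_of_le w (by omega),
      by simp [restrict, hs]⟩

theorem popDigit_step {m : Memory} {x c v : ℕ} (hx : x = 42 ∨ x = 43) (hv : v < 3)
    (h : m x 0 = (3 * c + v : ℕ)) :
    ((popDigit x).step m) 46 0 = v ∧ ((popDigit x).step m) x 0 = c ∧
      ∀ A, A ≠ 46 → A ≠ x → ((popDigit x).step m) A = m A := by
  have hne : x ≠ 46 := by omega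
  have h' : (46 : ℕ) ≠ x := by omega
  have hfl : ⌊m x 0 / 3⌋ = c := by rw [h]; exact floor_digit c v hv
  refine ⟨?_, ?_, ?_⟩
  · simp [popDigit, Memory.set_apply, hne, h', hfl]
    rw [h]; push_cast; ring
  · simp [popDigit, Memory.set_apply, hne, hfl]
  · intro A h1 h2
    simp [popDigit, Memory.set_apply, h1, h2]

theorem decodeLoop_spec {w π : ℕ → ℕ} {n i l t : ℕ} {m : Memory} (hw : Labels w)
    (hil : i ≤ l) (hlt : l ≤ t) (htn : t ≤ n)
    (hπ : ∀ k k', k < n → k' < n → π k = π k' → k = k')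
    (h44 : m 44 0 = n) (h33 : m 33 0 = l) (h19 : m 19 0 = t)
    (h42 : m 42 0 = code w i l) (h43 : m 43 0 = code w l t) (h4 : ∀ k, k < n → m 4 k = π k) :
    Tri decodeLoop m (n * 110 + 10) (fun m' => ∀ k, k < n → m' 2 (π k) = restrict w i t k) := by
  let Inv : ℕ → Memory → Prop := fun k m => k ≤ n ∧ m 44 0 = k ∧ m 33 0 = l ∧ m 19 0 = t ∧
    m 42 0 = code w i (min k l) ∧ m 43 0 = code w l (min k t) ∧ (∀ k, k < n → m 4 k = π k) ∧
    ∀ k', k ≤ k' → k' < n → m 2 (π k') = restrict w i t k'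
  have hinit : Inv n m := by
    refine ⟨le_rfl, h44, h33, h19, ?_, ?_, h4, fun k' h1 h2 => by omega⟩
    · rw [min_eq_right (by omega), h42]
    · rw [min_eq_right (by omega), h43]
  refine (Tri.loop 100 (by norm_num) Inv 10 (by decide) ?_ n m hinit).mono (by push_cast; linarith) ?_
  · rintro k m₁ ⟨hk, g44, g33, g19, g42, g43, g4, g2⟩ hg
    simp only [holds_not, holds_le, eval_read, eval_const, Int.cast_zero, Nat.floor_zero, g44,
      not_le, Nat.cast_pos] at hg
    obtain ⟨k, rfl⟩ : ∃ k', k = k' + 1 := ⟨k - 1, by omega⟩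
    refine ⟨k, by omega, Tri.straight (by decide) 100 (by decide) (by norm_num) ?_⟩
    have key : ∃ m₂, decodeBody.step m₁ =
        (Program.write 2 (.read 4 (var 44)) (var 46)).step m₂ ∧
        m₂ 46 0 = restrict w i t k ∧ m₂ 42 0 = code w i (min k l) ∧ m₂ 43 0 = code w l (min k t) ∧
        m₂ 44 0 = k ∧ ∀ A, A ∉ [42, 43, 44, 46] → m₂ A = m₁ A := by
      by_cases c1 : t ≤ k
      · rw [decodeBody, step_seq, step_seq, step_cond_true _ _ (by
          simpa [Memory.set_apply, g44, g19] using c1)]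
        refine ⟨_, rfl, ?_, ?_, ?_, ?_, ?_⟩
        · simp [Memory.set_apply, restrict, c1]
        · rw [min_eq_right (by omega)] at g42 ⊢
          simp [Memory.set_apply, g42]
        · rw [min_eq_right (by omega)] at g43 ⊢
          simp [Memory.set_apply, g43]
        · simp [Memory.set_apply, g44]
        · intro A hA
          simp only [List.mem_cons, List.not_mem_nil, or_false, not_or] at hA
          simp [Memory.set_apply, hA]
      · push Not at c1
        by_cases c2 : l ≤ k
        · rw [decodeBody, step_seq, step_seq, step_cond_false _ _ (by
            simpa [Memory.set_apply, g44, g19] using c1), step_cond_true _ _ (by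
            simpa [Memory.set_apply, g44, g33] using c2)]
          obtain ⟨c, v, hv, e1, e2, e3⟩ := code_digit hw l k t c1
          rw [min_eq_left (by omega), e1] at g43
          obtain ⟨p1, p2, p3⟩ := popDigit_step (x := 43)
            (m := (assign 44 (.sub (var 44) one)).step m₁) (Or.inr rfl) hv
            (by simpa [Memory.set_apply] using g43)
          refine ⟨_, rfl, ?_, ?_, ?_, ?_, ?_⟩
          · rw [p1, e3]
            simp [restrict, c1, c2, hil.trans c2]
          · rw [p3 42 (by decide) (by decide)]
            rw [min_eq_right (by omega)] at g42 ⊢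
            simp [Memory.set_apply, g42]
          · rw [p2, min_eq_left (by omega), e2]
          · rw [p3 44 (by decide) (by decide)]
            simp [Memory.set_apply, g44]
          · intro A hA
            simp only [List.mem_cons, List.not_mem_nil, or_false, not_or] at hA
            rw [p3 A hA.2.2.2 hA.2.1]
            simp [Memory.set_apply, hA]
        · push Not at c2
          rw [decodeBody, step_seq, step_seq, step_cond_false _ _ (by
            simpa [Memory.set_apply, g44, g19] using c1), step_cond_false _ _ (by
            simpa [Memory.set_apply, g44, g33] using c2)]
          obtain ⟨c, v, hv, e1, e2, e3⟩ := code_digit hw i k t c1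
          rw [min_eq_left (by omega), e1] at g42
          obtain ⟨p1, p2, p3⟩ := popDigit_step (x := 42)
            (m := (assign 44 (.sub (var 44) one)).step m₁) (Or.inl rfl) hv
            (by simpa [Memory.set_apply] using g42)
          refine ⟨_, rfl, ?_, ?_, ?_, ?_, ?_⟩
          · rw [p1, e3]
          · rw [p2, min_eq_left (by omega), e2]
          · rw [p3 43 (by decide) (by decide), min_eq_left (by omega), code_of_le w (by omega)]
            rw [min_eq_left (by omega), code_of_le w (by omega)] at g43
            simpa [Memory.set_apply] using g43
          · rw [p3 44 (by decide) (by decide)]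
            simp [Memory.set_apply, g44]
          · intro A hA
            simp only [List.mem_cons, List.not_mem_nil, or_false, not_or] at hA
            rw [p3 A hA.2.2.2 hA.1]
            simp [Memory.set_apply, hA]
    obtain ⟨m₂, e, f46, f42, f43, f44, hf⟩ := key
    rw [e]
    have f4 : ∀ k, k < n → m₂ 4 k = π k := by
      intro k hk; rw [hf 4 (by decide)]; exact g4 k hk
    refine ⟨by omega, ?_, ?_, ?_, ?_, ?_, ?_, ?_⟩
    · simp [Memory.set_apply, f44]
    · simp [Memory.set_apply, hf 33 (by decide), g33]
    · simp [Memory.set_apply, hf 19 (by decide), g19]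
    · simp [Memory.set_apply, f42]
    · simp [Memory.set_apply, f43]
    · intro k' hk'
      simp [Memory.set_apply, f4 k' hk']
    · intro k' h1 h2
      have h3 : m₂ 4 ⌊m₂ 44 0⌋₊ = π k := by rw [f44, Nat.floor_natCast, f4 k (by omega)]
      rcases h1.eq_or_lt with rfl | h1
      · simp [Memory.set_apply, h3, f46]
      · have hne : π k' ≠ π k := fun h => by
          have := hπ k' k h2 (by omega) h
          omega
        simp [Memory.set_apply, h3, hne, hf 2 (by decide), g2 k' h1 h2]
  · rintro m' ⟨⟨k, hk, g44, g33, g19, g42, g43, g4, g2⟩, hg⟩ -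
    simp only [holds_not, holds_le, eval_read, eval_const, Int.cast_zero, Nat.floor_zero, g44,
      not_le, Nat.cast_pos, not_lt, Nat.le_zero] at hg
    intro k' hk'
    exact g2 k' (by omega) hk'

end RealRAM

namespace SubsetSumRatio

/-! ### Near-optimal labellings -/

/-- The ratio of the labelling `w` is at most `1 + ε` times the ratio of any labelling that uses
the largest item. -/
def NearOptimal (b : ℕ → ℝ) (n : ℕ) (ε : ℝ) (w : ℕ → ℕ) : Prop :=
  |dsum b w 0 n| < ssum b w 0 n ∧ ∀ w', Labels w' → w' 0 ≠ 0 →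
    (ssum b w 0 n + |dsum b w 0 n|) * (ssum b w' 0 n - |dsum b w' 0 n|) ≤
      (1 + ε) * ((ssum b w' 0 n + |dsum b w' 0 n|) * (ssum b w 0 n - |dsum b w 0 n|))

/-- The labelling with `X` and `Y` exchanged. -/
def flip (w : ℕ → ℕ) (k : ℕ) : ℕ := if w k = 1 then 2 else if w k = 2 then 1 else 0

theorem labels_flip (w : ℕ → ℕ) : Labels (flip w) := by
  intro k; unfold flip; split_ifs <;> norm_num

theorem sgn_flip (w : ℕ → ℕ) (k : ℕ) : sgn (flip w k) = -sgn (w k) := by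
  unfold flip sgn; split_ifs <;> simp_all

theorem dsum_flip (b : ℕ → ℝ) (w : ℕ → ℕ) (s e : ℕ) : dsum b (flip w) s e = -dsum b w s e := by
  simp [dsum, sgn_flip, Finset.sum_neg_distrib]

theorem ssum_flip (b : ℕ → ℝ) (w : ℕ → ℕ) (s e : ℕ) : ssum b (flip w) s e = ssum b w s e := by
  simp [ssum, sgn_flip]

theorem flip_ne_zero {w : ℕ → ℕ} (hw : Labels w) {k : ℕ} (h : w k ≠ 0) : flip w k ≠ 0 := by
  have := hw k
  unfold flip
  split_ifs <;> omega

theorem abs_dsum_le {b : ℕ → ℝ} {n : ℕ} (hb : ∀ k, k < n → 0 < b k) (w : ℕ → ℕ) {s e : ℕ}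
    (he : e ≤ n) : |dsum b w s e| ≤ ssum b w s e := by
  refine (Finset.abs_sum_le_sum_abs _ _).trans (Finset.sum_le_sum fun k hk => ?_)
  rw [Finset.mem_Ico] at hk
  rw [abs_mul, abs_of_pos (hb k (by omega))]

/-- Exchanging `X` and `Y` reduces negative differences to the nonnegative ones that the search
considers. -/
theorem le_abs_dsum {b : ℕ → ℝ} {lo : ℝ} {i t : ℕ}
    (h : ∀ w, Labels w → w i ≠ 0 → 0 ≤ dsum b w i t → lo * ssum b w i t ≤ dsum b w i t)
    {w : ℕ → ℕ} (hw : Labels w) (hi : w i ≠ 0) : lo * ssum b w i t ≤ |dsum b w i t| := by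
  rcases le_total 0 (dsum b w i t) with h0 | h0
  · rw [abs_of_nonneg h0]; exact h w hw hi h0
  · rw [abs_of_nonpos h0, ← dsum_flip, ← ssum_flip]
    exact h _ (labels_flip w) (flip_ne_zero hw hi) (by rw [dsum_flip]; linarith)

theorem abs_sgn_le (v : ℕ) : |sgn v| ≤ 1 := by
  unfold sgn; split_ifs <;> norm_num

theorem ssum_le {b : ℕ → ℝ} {n : ℕ} (hb : ∀ k, k < n → 0 < b k) (w : ℕ → ℕ) :
    ssum b w 0 n ≤ ∑ k ∈ Finset.Ico 0 n, b k := by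
  refine Finset.sum_le_sum fun k hk => ?_
  rw [Finset.mem_Ico] at hk
  exact mul_le_of_le_one_left (hb k hk.2).le (abs_sgn_le _)

/-- The right-hand side is twice the larger of `Σ(X)` and `Σ(Y)`, and one of the two sets contains
the largest item. -/
theorem two_mul_le {b : ℕ → ℝ} {n : ℕ} (hb : ∀ k, k < n → 0 < b k) (hn : 0 < n) {w : ℕ → ℕ}
    (hw : Labels w) (h0 : w 0 ≠ 0) : 2 * b 0 ≤ ssum b w 0 n + |dsum b w 0 n| := by
  have key : ∀ w, w 0 = 1 → 2 * b 0 ≤ ssum b w 0 n + dsum b w 0 n := by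
    intro w h1
    have h := Finset.single_le_sum (f := fun k => (|sgn (w k)| + sgn (w k)) * b k)
      (s := Finset.Ico 0 n) (fun k hk => mul_nonneg (by linarith [neg_abs_le (sgn (w k))])
        (hb k (by rw [Finset.mem_Ico] at hk; omega)).le) (Finset.mem_Ico.mpr ⟨le_rfl, hn⟩)
    simp only [h1, sgn, if_true, abs_one, add_mul, Finset.sum_add_distrib] at h
    unfold ssum dsum sgn
    linarith
  have h3 := hw 0
  have : w 0 = 1 ∨ w 0 = 2 := by omega
  rcases this with h | h
  · exact (key w h).trans (by linarith [le_abs_self (dsum b w 0 n)])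
  · have := key (flip w) (by simp [flip, h])
    rw [ssum_flip, dsum_flip] at this
    linarith [neg_abs_le (dsum b w 0 n)]

/-- If the largest item is at least the sum of the others, the best solution is to compare these. -/
theorem nearOptimal_of_large {b : ℕ → ℝ} {n : ℕ} {ε : ℝ} (hb : ∀ k, k < n → 0 < b k) (hn : 2 ≤ n)
    (hε : 0 < ε) (h : (∑ k ∈ Finset.Ico 0 n, b k) - b 0 ≤ b 0) :
    NearOptimal b n ε (fun k => if k = 0 then 1 else 2) := by
  set T := ∑ k ∈ Finset.Ico 0 n, b k with hT
  have hsplit : T = b 0 + ∑ k ∈ Finset.Ico 1 n, b k := by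
    rw [hT, Finset.sum_eq_sum_Ico_succ_bot (by omega)]
  have hpos : 0 < ∑ k ∈ Finset.Ico 1 n, b k :=
    Finset.sum_pos (fun k hk => hb k (Finset.mem_Ico.mp hk).2)
      (Finset.nonempty_Ico.mpr (by omega))
  have hd : dsum b (fun k => if k = 0 then 1 else 2) 0 n = b 0 - ∑ k ∈ Finset.Ico 1 n, b k := by
    rw [dsum, Finset.sum_eq_sum_Ico_succ_bot (by omega), Finset.sum_congr rfl
      (g := fun k => -b k) (s₂ := Finset.Ico 1 n)]
    · simp [sgn, Finset.sum_neg_distrib]; ring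
    · intro k hk
      have := (Finset.mem_Ico.mp hk).1
      have h0 : k ≠ 0 := by omega
      simp [h0, sgn]
  have hs : ssum b (fun k => if k = 0 then 1 else 2) 0 n = T := by
    rw [hT, ssum]
    refine Finset.sum_congr rfl fun k _ => ?_
    by_cases h0 : k = 0 <;> simp [h0, sgn]
  have habs : |dsum b (fun k => if k = 0 then 1 else 2) 0 n| =
      b 0 - ∑ k ∈ Finset.Ico 1 n, b k := by
    rw [hd, abs_of_nonneg (by linarith)]
  refine ⟨by rw [habs, hs]; linarith, fun w' hw' h0 => ?_⟩
  rw [habs, hs]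
  have h1 := two_mul_le hb (by omega) hw' h0
  have h2 := ssum_le hb w'
  have h3 := abs_dsum_le hb w' (s := 0) le_rfl
  have hb0 := hb 0 (by omega)
  have e1 : T + (b 0 - ∑ k ∈ Finset.Ico 1 n, b k) = 2 * b 0 := by linarith
  have e2 : T - (b 0 - ∑ k ∈ Finset.Ico 1 n, b k) = 2 * ∑ k ∈ Finset.Ico 1 n, b k := by linarith
  rw [e1, e2]
  -- The larger side of `w'` is at least `b 0`, so its smaller side is at most the sum of the other
  -- items.
  calc 2 * b 0 * (ssum b w' 0 n - |dsum b w' 0 n|)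
      ≤ (ssum b w' 0 n + |dsum b w' 0 n|) * (2 * ∑ k ∈ Finset.Ico 1 n, b k) :=
        mul_le_mul h1 (by linarith) (by linarith) (by linarith)
    _ ≤ (1 + ε) * ((ssum b w' 0 n + |dsum b w' 0 n|) * (2 * ∑ k ∈ Finset.Ico 1 n, b k)) := by
        refine le_mul_of_one_le_left (mul_nonneg (by linarith) (by linarith)) (by linarith)

/-- If the largest item is less than the sum of the others, then there is a solution of ratio
at most `2`. -/
theorem exists_balanced {b : ℕ → ℝ} {n : ℕ} (hb : ∀ k, k < n → 0 < b k)
    (hanti : ∀ k k', k < k' → k' < n → b k' < b k) (hn : 0 < n)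
    (h : b 0 < (∑ k ∈ Finset.Ico 0 n, b k) - b 0) :
    ∃ w, Labels w ∧ w 0 ≠ 0 ∧ |dsum b w 0 n| ≤ ssum b w 0 n / 3 := by
  -- Items are put against `b 0` greedily until they reach it. The last one is smaller than `b 0`,
  -- so their sum stays below `2 * b 0`.
  have hex : ∃ e, e < n ∧ b 0 ≤ ∑ k ∈ Finset.Ico 1 (e + 1), b k := by
    refine ⟨n - 1, by omega, ?_⟩
    rw [Finset.sum_eq_sum_Ico_succ_bot hn] at h
    rw [Nat.sub_add_cancel hn]
    simp only [zero_add] at h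
    linarith
  classical
  obtain ⟨he, hle⟩ := Nat.find_spec hex
  have hmin := fun e => Nat.find_min hex (m := e)
  set e := Nat.find hex with he_def
  have hb0 := hb 0 hn
  have he0 : e ≠ 0 := by
    rintro h0
    rw [h0] at hle
    simp at hle
    linarith
  have hlt : ∑ k ∈ Finset.Ico 1 (e + 1), b k < 2 * b 0 := by
    obtain ⟨e', he'⟩ := Nat.exists_eq_succ_of_ne_zero he0
    have h1 := hmin e' (by omega)
    push Not at h1
    have h2 := h1 (by omega)
    rw [he', Finset.sum_Ico_succ_top (by omega)]
    have h3 := hanti 0 (e' + 1) (by omega) (by omega)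
    linarith
  refine ⟨restrict (fun k => if k = 0 then 1 else 2) 0 (e + 1), ?_, by simp [restrict], ?_⟩
  · refine Labels.restrict (fun k => ?_) _ _
    show (if k = 0 then 1 else 2) < 3
    split_ifs <;> norm_num
  · rw [dsum_restrict b _ le_rfl (by omega), ssum_restrict b _ le_rfl (by omega)]
    have hd : dsum b (fun k => if k = 0 then 1 else 2) 0 (e + 1) =
        b 0 - ∑ k ∈ Finset.Ico 1 (e + 1), b k := by
      rw [dsum, Finset.sum_eq_sum_Ico_succ_bot (by omega), Finset.sum_congr rfl
        (g := fun k => -b k) (s₂ := Finset.Ico 1 (e + 1))]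
      · simp [sgn, Finset.sum_neg_distrib]; ring
      · intro k hk
        have := (Finset.mem_Ico.mp hk).1
        have h0 : k ≠ 0 := by omega
        simp [h0, sgn]
    have hs : ssum b (fun k => if k = 0 then 1 else 2) 0 (e + 1) =
        b 0 + ∑ k ∈ Finset.Ico 1 (e + 1), b k := by
      rw [ssum, Finset.sum_eq_sum_Ico_succ_bot (by omega), Finset.sum_congr rfl
        (g := fun k => b k) (s₂ := Finset.Ico 1 (e + 1))]
      · simp [sgn]
      · intro k hk
        have := (Finset.mem_Ico.mp hk).1
        have h0 : k ≠ 0 := by omega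
        simp [h0, sgn]
    rw [hd, hs, abs_of_nonpos (by linarith)]
    linarith

/-- No ratio is below `1`, so an absolute bound suffices. From `b i ≤ s` the relative difference is
at most `ε/4 + ε/16 = 5ε/16`, and `(1 + x) / (1 - x) ≤ 1 + ε` for such `x`. -/
theorem nearOptimal_of_small_difference {b : ℕ → ℝ} {n i t : ℕ} {ε hi : ℝ} {w : ℕ → ℕ}
    (hb : ∀ k, k < n → 0 < b k) (hε : 0 < ε) (hε1 : ε < 1) (hw : Labels w) (hit : i < t)
    (ht : t ≤ n) (hwi : w i ≠ 0) (hhi : hi ≤ ε / 4)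
    (hd : |dsum b w i t| ≤ hi * ssum b w i t + ε * b i / 16) :
    NearOptimal b n ε (restrict w i t) := by
  have h1 := le_ssum hb hw hit ht hwi
  have h2 := hb i (by omega)
  unfold NearOptimal
  rw [dsum_restrict b w (Nat.zero_le i) ht, ssum_restrict b w (Nat.zero_le i) ht]
  set d := |dsum b w i t|
  set s := ssum b w i t
  have hs : 0 < s := by linarith
  have h3 : d ≤ 5 / 16 * ε * s := by
    have h4 : hi * s ≤ ε / 4 * s := mul_le_mul_of_nonneg_right hhi hs.le
    have h5 : ε * b i ≤ ε * s := mul_le_mul_of_nonneg_left h1 hε.le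
    linarith
  have hεs : ε * s ≤ 1 * s := mul_le_mul_of_nonneg_right hε1.le hs.le
  have hds : d < s := by linarith
  refine ⟨hds, fun w' hw' h0 => ?_⟩
  have h6 := abs_dsum_le hb w' (s := 0) le_rfl
  have h7 : 0 ≤ |dsum b w' 0 n| := abs_nonneg _
  have h8 : 0 ≤ d := abs_nonneg _
  have h9 : s + d ≤ (1 + ε) * (s - d) := by
    have : ε * d ≤ 1 * d := mul_le_mul_of_nonneg_right hε1.le h8
    linarith
  calc (s + d) * (ssum b w' 0 n - |dsum b w' 0 n|)
      ≤ ((1 + ε) * (s - d)) * (ssum b w' 0 n + |dsum b w' 0 n|) :=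
        mul_le_mul h9 (by linarith) (by linarith)
          (mul_nonneg (by linarith) (by linarith))
    _ = _ := by ring

/-- The labelling has relative difference at most `lo + ε/8`, its competitors at least `lo`. Since
`lo + ε/8 < 1/2`, the function `(1 + x) / (1 - x)` changes by a factor of at most `1 + ε` between
the two. -/
theorem nearOptimal_of_enclosure {b : ℕ → ℝ} {n : ℕ} {ε lo hi : ℝ} {w : ℕ → ℕ}
    (hb : ∀ k, k < n → 0 < b k) (hn : 0 < n) (hε : 0 < ε) (hε1 : ε < 1) (hw : Labels w)
    (hw0 : w 0 ≠ 0) (hlo : 0 ≤ lo) (hlo3 : lo ≤ 1 / 3) (hhi : hi ≤ lo + ε / 16)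
    (hlow : ∀ w', Labels w' → w' 0 ≠ 0 → lo * ssum b w' 0 n ≤ |dsum b w' 0 n|)
    (hd : |dsum b w 0 n| ≤ hi * ssum b w 0 n + ε * b 0 / 16) :
    NearOptimal b n ε w := by
  have h1 := le_ssum hb hw hn le_rfl hw0
  have h2 := hb 0 hn
  unfold NearOptimal
  set d := |dsum b w 0 n|
  set s := ssum b w 0 n
  have hs : 0 < s := by linarith
  have h3 : d ≤ (lo + ε / 8) * s := by
    have h4 : hi * s ≤ (lo + ε / 16) * s := mul_le_mul_of_nonneg_right hhi hs.le
    have h5 : ε * b 0 ≤ ε * s := mul_le_mul_of_nonneg_left h1 hε.le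
    linarith
  have h4 : (lo + ε / 8) * s ≤ 1 / 2 * s := mul_le_mul_of_nonneg_right (by linarith) hs.le
  refine ⟨by linarith, fun w' hw' h0 => ?_⟩
  have h6 := abs_dsum_le hb w' (s := 0) le_rfl
  have h7 := hlow w' hw' h0
  have h8 := le_ssum hb hw' hn le_rfl h0
  set d' := |dsum b w' 0 n|
  set s' := ssum b w' 0 n
  have hs' : 0 < s' := by linarith
  have h9 : (1 + (lo + ε / 8)) * (1 - lo) ≤ (1 + ε) * ((1 + lo) * (1 - (lo + ε / 8))) := by
    have e : (1 + ε) * ((1 + lo) * (1 - (lo + ε / 8))) - (1 + (lo + ε / 8)) * (1 - lo) =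
      ε / 8 * (8 * (1 - lo * lo) - (1 + lo) * (1 + ε) - (1 - lo)) := by ring
    have h10 : lo * lo ≤ 1 / 3 * (1 / 3) := mul_le_mul hlo3 hlo3 hlo (by norm_num)
    have h11 : (1 + lo) * (1 + ε) ≤ (1 + 1 / 3) * (1 + 1) :=
      mul_le_mul (by linarith) (by linarith) (by linarith) (by norm_num)
    have : 0 ≤ ε / 8 * (8 * (1 - lo * lo) - (1 + lo) * (1 + ε) - (1 - lo)) :=
      mul_nonneg (by linarith) (by linarith)
    linarith
  have hss : 0 < s * s' := mul_pos hs hs'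
  calc (s + d) * (s' - d') ≤ ((1 + (lo + ε / 8)) * s) * ((1 - lo) * s') :=
        mul_le_mul (by linarith) (by linarith) (by linarith)
          (mul_nonneg (by linarith) hs.le)
    _ = ((1 + (lo + ε / 8)) * (1 - lo)) * (s * s') := by ring
    _ ≤ ((1 + ε) * ((1 + lo) * (1 - (lo + ε / 8)))) * (s * s') :=
        mul_le_mul_of_nonneg_right h9 hss.le
    _ = (1 + ε) * (((1 + lo) * s') * ((1 - (lo + ε / 8)) * s)) := by ring
    _ ≤ (1 + ε) * ((s' + d') * (s - d)) := by
        apply mul_le_mul_of_nonneg_left _ (by linarith)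
        exact mul_le_mul (by linarith) (by linarith)
          (mul_nonneg (by linarith) hs.le) (by linarith [abs_nonneg (dsum b w' 0 n)])

end SubsetSumRatio

/-! ### Correctness of an accepted attempt -/

namespace RealRAM
open SubsetSumRatio

/-- The value `hi = 1`, for which no pair need be stored, is impossible: either `hi ≤ ε/4`, or the
balanced pair forces `lo ≤ 1/3`. -/
theorem AttemptRes.nearOptimal {b : ℕ → ℝ} {n i l t : ℕ} {ε B lo hi : ℝ} {m : Memory}
    (hb : ∀ k, k < n → 0 < b k) (hanti : ∀ k k', k < k' → k' < n → b k' < b k)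
    (hε : 0 < ε) (hε1 : ε < 1) (hbal : b 0 < (∑ k ∈ Finset.Ico 0 n, b k) - b 0)
    (h : AttemptRes b n ε B i l t lo hi m) (hdone : m 15 0 = 1) :
    ∃ w, Labels w ∧ m 42 0 = code w i l ∧ m 43 0 = code w l t ∧
      NearOptimal b n ε (restrict w i t) := by
  have h1 := h.i_lt
  have h2 := h.l_le
  have h3 := h.t_le
  rcases h.done with ⟨-, h4⟩ | ⟨h4, -⟩
  swap
  · rw [hdone] at h4; norm_num at h4
  rcases h4 with h4 | ⟨rfl, rfl⟩
  · rcases h.upper with h5 | ⟨w, hw, hwi, hd, h42, h43⟩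
    · linarith
    · exact ⟨w, hw, h42, h43, nearOptimal_of_small_difference hb hε hε1 hw (by omega) h3 hwi h4 hd⟩
  · have hlow : ∀ w', Labels w' → w' 0 ≠ 0 → lo * ssum b w' 0 t ≤ |dsum b w' 0 t| :=
      fun w' hw' h0 => le_abs_dsum h.lower hw' h0
    obtain ⟨g, hg, hg0, hg3⟩ := exists_balanced hb hanti (by omega) hbal
    have h6 := hlow g hg hg0
    have h7 := le_ssum hb hg (by omega : 0 < t) le_rfl hg0
    have h8 := hb 0 (by omega)
    have hlo : lo ≤ 1 / 3 := by
      by_contra hcon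
      push Not at hcon
      nlinarith
    rcases h.upper with h5 | ⟨w, hw, hwi, hd, h42, h43⟩
    · have := h.hi_le
      linarith
    · refine ⟨w, hw, h42, h43, nearOptimal_of_enclosure hb (by omega) hε hε1 (hw.restrict _ _)
        (by simpa [restrict, (by omega : 0 < t)] using hwi) h.lo_nonneg hlo h.hi_le hlow ?_⟩
      rw [dsum_restrict b w le_rfl le_rfl, ssum_restrict b w le_rfl le_rfl]
      exact hd

end RealRAM

namespace SubsetSumRatio

/-! ### The budget that is needed -/

theorem hasBuckets_of_abs_le {b : ℕ → ℝ} {δ R : ℝ} {s e : ℕ} (hδ : 0 < δ) (hR : 0 ≤ R)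
    (h : ∀ w, Labels w → |dsum b w s e| ≤ R * δ) : HasBuckets b δ s e (2 * R + 2) := by
  refine ⟨Finset.Icc ⌊-R⌋ ⌊R⌋, ?_, fun w hw => ?_⟩
  · have h1 : ⌊-R⌋ ≤ ⌊R⌋ + 1 := (Int.floor_le_floor (by linarith)).trans (by linarith)
    rw [Int.card_Icc]
    have h2 : (((⌊R⌋ + 1 - ⌊-R⌋).toNat : ℤ) : ℝ) = ((⌊R⌋ + 1 - ⌊-R⌋ : ℤ) : ℝ) := by
      rw [Int.toNat_of_nonneg (by linarith)]
    rw [Int.cast_natCast] at h2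
    rw [h2]
    push_cast
    linarith [Int.floor_le R, Int.lt_floor_add_one (-R)]
  · have h3 := abs_le.mp (h w hw)
    rw [Finset.mem_Icc]
    constructor <;> refine Int.floor_le_floor ?_
    · rw [le_div_iff₀ hδ]; linarith [h3.1]
    · rw [div_le_iff₀ hδ]; exact h3.2

/-- The buckets of the subset sums of the items in `[K, j)`. -/
noncomputable def subsetBuckets (b : ℕ → ℝ) (δ : ℝ) (K j : ℕ) : Finset ℤ :=
  (Finset.Ico K j).powerset.image fun A => ⌊(∑ k ∈ A, b k) / δ⌋

theorem subsetBuckets_of_le (b : ℕ → ℝ) (δ : ℝ) {K j : ℕ} (h : j ≤ K) :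
    (subsetBuckets b δ K j).card = 1 := by
  simp [subsetBuckets, Finset.Ico_eq_empty_of_le h]

theorem floor_add_div (x y δ : ℝ) :
    ⌊(x + y) / δ⌋ = ⌊x / δ⌋ + ⌊y / δ⌋ ∨ ⌊(x + y) / δ⌋ = ⌊x / δ⌋ + (⌊y / δ⌋ + 1) := by
  rw [add_div]
  have h1 := Int.le_floor_add (x / δ) (y / δ)
  have h2 := Int.le_floor_add_floor (x / δ) (y / δ)
  omega

/-- Adding `b j` moves a bucket by one of two consecutive integers; omitting it leaves the bucket
alone. Hence the factor three. -/
theorem subsetBuckets_succ_card (b : ℕ → ℝ) (δ : ℝ) (K j : ℕ) :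
    (subsetBuckets b δ K (j + 1)).card ≤ 3 * (subsetBuckets b δ K j).card := by
  have hsub : subsetBuckets b δ K (j + 1) ⊆ subsetBuckets b δ K j ∪
      ((subsetBuckets b δ K j).image (fun u => u + ⌊b j / δ⌋) ∪
        (subsetBuckets b δ K j).image (fun u => u + (⌊b j / δ⌋ + 1))) := by
    intro x hx
    obtain ⟨A, hA, rfl⟩ := Finset.mem_image.mp hx
    rw [Finset.mem_powerset] at hA
    have hmem : ⌊(∑ k ∈ A.erase j, b k) / δ⌋ ∈ subsetBuckets b δ K j := by
      refine Finset.mem_image_of_mem _ (Finset.mem_powerset.mpr fun k hk => ?_)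
      rw [Finset.mem_erase] at hk
      have := hA hk.2
      rw [Finset.mem_Ico] at this ⊢
      omega
    rw [Finset.mem_union, Finset.mem_union]
    by_cases hj : j ∈ A
    · right
      rw [← Finset.sum_erase_add A b hj]
      rcases floor_add_div (∑ k ∈ A.erase j, b k) (b j) δ with h | h <;> rw [h]
      · exact Or.inl (Finset.mem_image_of_mem _ hmem)
      · exact Or.inr (Finset.mem_image_of_mem _ hmem)
    · left
      rwa [Finset.erase_eq_of_notMem hj] at hmem
  have h1 := Finset.card_le_card hsub
  have h2 := Finset.card_union_le (subsetBuckets b δ K j)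
    ((subsetBuckets b δ K j).image (fun u => u + ⌊b j / δ⌋) ∪
        (subsetBuckets b δ K j).image (fun u => u + (⌊b j / δ⌋ + 1)))
  have h3 := Finset.card_union_le ((subsetBuckets b δ K j).image (fun u => u + ⌊b j / δ⌋))
    ((subsetBuckets b δ K j).image (fun u => u + (⌊b j / δ⌋ + 1)))
  have h4 : ((subsetBuckets b δ K j).image (fun u => u + ⌊b j / δ⌋)).card ≤ _ :=
    Finset.card_image_le
  have h5 : ((subsetBuckets b δ K j).image (fun u => u + (⌊b j / δ⌋ + 1))).card ≤ _ :=
    Finset.card_image_le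
  omega

/-- A bound for the number of pairs of a set of items in `[0, min j K)` and a bucket of subset
sums of items in `[K, j)`. -/
noncomputable def pairCount (b : ℕ → ℝ) (δ : ℝ) (K j : ℕ) : ℕ :=
  2 ^ min j K * (subsetBuckets b δ K j).card

/-- This limits how far the count overshoots a threshold when it first exceeds it. -/
theorem pairCount_succ (b : ℕ → ℝ) (δ : ℝ) (K j : ℕ) :
    pairCount b δ K (j + 1) ≤ 3 * pairCount b δ K j := by
  unfold pairCount
  rcases Nat.lt_or_ge j K with h | h
  · rw [subsetBuckets_of_le b δ h.le, subsetBuckets_of_le b δ (show j + 1 ≤ K from h),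
      min_eq_left h.le, min_eq_left (show j + 1 ≤ K from h), pow_succ]
    omega
  · rw [min_eq_right h, min_eq_right (by omega : K ≤ j + 1)]
    calc 2 ^ K * (subsetBuckets b δ K (j + 1)).card
        ≤ 2 ^ K * (3 * (subsetBuckets b δ K j).card) :=
          Nat.mul_le_mul_left _ (subsetBuckets_succ_card b δ K j)
      _ = _ := by ring

/-- The labelling that puts the items of `P \ P'` into `X` and those of `P' \ P` into `Y`. -/
noncomputable def diffLabels (P P' : Finset ℕ) (k : ℕ) : ℕ := by
  classical exact if k ∈ P then (if k ∈ P' then 0 else 1) else (if k ∈ P' then 2 else 0)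

theorem labels_diffLabels (P P' : Finset ℕ) : Labels (diffLabels P P') := by
  intro k; unfold diffLabels; split_ifs <;> norm_num

theorem dsum_diffLabels (b : ℕ → ℝ) {P P' : Finset ℕ} {j : ℕ} (hP : P ⊆ Finset.Ico 0 j)
    (hP' : P' ⊆ Finset.Ico 0 j) :
    dsum b (diffLabels P P') 0 j = ∑ k ∈ P, b k - ∑ k ∈ P', b k := by
  classical
  have h : ∀ P : Finset ℕ, P ⊆ Finset.Ico 0 j →
      ∑ k ∈ P, b k = ∑ k ∈ Finset.Ico 0 j, if k ∈ P then b k else 0 := by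
    intro P hP
    rw [Finset.sum_ite_mem, Finset.inter_eq_right.mpr hP]
  rw [h P hP, h P' hP', ← Finset.sum_sub_distrib, dsum]
  refine Finset.sum_congr rfl fun k _ => ?_
  unfold diffLabels sgn
  split_ifs <;> simp_all

theorem diffLabels_ne_zero {P P' : Finset ℕ} {k : ℕ} (h : ¬ (k ∈ P ↔ k ∈ P')) :
    diffLabels P P' k ≠ 0 := by
  unfold diffLabels
  split_ifs <;> simp_all

/-- The pigeonhole principle: if there are many pairs, there is a labelling with a small
difference. -/
theorem exists_small_difference {b : ℕ → ℝ} {δ : ℝ} {n K j : ℕ} (hb : ∀ k, k < n → 0 < b k)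
    (hmax : ∀ k, k < n → b k ≤ b 0) (hδ : 0 < δ) (hj : j ≤ n)
    (hcount : n * b 0 / δ + 1 < (pairCount b δ K j : ℝ)) :
    ∃ i, i < min j K ∧ ∃ w, Labels w ∧ w i ≠ 0 ∧ 0 ≤ dsum b w i j ∧ dsum b w i j ≤ 2 * δ := by
  classical
  set T := n * b 0 with hT
  have hb0 : 0 ≤ T := by
    rcases Nat.eq_zero_or_pos n with h | h
    · simp [hT, h]
    · exact mul_nonneg (by positivity) (hb 0 h).le
  have hsum : ∀ P : Finset ℕ, P ⊆ Finset.Ico 0 j → ∑ k ∈ P, b k ≤ T := by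
    intro P hP
    calc ∑ k ∈ P, b k ≤ ∑ k ∈ Finset.Ico 0 n, b k :=
          Finset.sum_le_sum_of_subset_of_nonneg (hP.trans (Finset.Ico_subset_Ico_right hj))
            fun k hk _ => (hb k (Finset.mem_Ico.mp hk).2).le
      _ ≤ ∑ k ∈ Finset.Ico 0 n, b 0 :=
          Finset.sum_le_sum fun k hk => hmax k (Finset.mem_Ico.mp hk).2
      _ = T := by simp [hT]
  have hnn : ∀ P : Finset ℕ, P ⊆ Finset.Ico 0 j → 0 ≤ ∑ k ∈ P, b k := fun P hP =>
    Finset.sum_nonneg fun k hk => (hb k (by have := Finset.mem_Ico.mp (hP hk); omega)).le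
  -- One set `Z u` of small items is fixed for every bucket `u`.
  have hchoose : ∀ u, ∃ Z, u ∈ subsetBuckets b δ K j →
      Z ⊆ Finset.Ico K j ∧ ⌊(∑ k ∈ Z, b k) / δ⌋ = u := by
    intro u
    by_cases hu : u ∈ subsetBuckets b δ K j
    · obtain ⟨Z, hZ, h⟩ := Finset.mem_image.mp hu
      exact ⟨Z, fun _ => ⟨Finset.mem_powerset.mp hZ, h⟩⟩
    · exact ⟨∅, fun h => absurd h hu⟩
  choose Z hZ using hchoose
  have hdisj : ∀ A Y : Finset ℕ, A ⊆ Finset.range (min j K) → Y ⊆ Finset.Ico K j →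
      Disjoint A Y := by
    intro A Y hA hY
    rw [Finset.disjoint_left]
    intro k h1 h2
    have h3 := Finset.mem_range.mp (hA h1)
    have h4 := Finset.mem_Ico.mp (hY h2)
    omega
  have hunion : ∀ A Y : Finset ℕ, A ⊆ Finset.range (min j K) → Y ⊆ Finset.Ico K j →
      A ∪ Y ⊆ Finset.Ico 0 j := by
    intro A Y hA hY k hk
    rw [Finset.mem_Ico]
    rcases Finset.mem_union.mp hk with h | h
    · have h3 := Finset.mem_range.mp (hA h)
      omega
    · have h4 := Finset.mem_Ico.mp (hY h)
      omega
  -- Since the floor function is superadditive, the bucket of `A` plus `u` is at most the bucket of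
  -- the whole sum, which leaves too few values for all pairs.
  obtain ⟨⟨A, u⟩, hx, ⟨A', u'⟩, hy, hne, heq⟩ := Finset.exists_ne_map_eq_of_card_lt_of_maps_to
    (s := (Finset.range (min j K)).powerset ×ˢ subsetBuckets b δ K j)
    (t := Finset.Icc (0 : ℤ) ⌊T / δ⌋) (f := fun x => ⌊(∑ k ∈ x.1, b k) / δ⌋ + x.2)
    (by
      rw [Finset.card_product, Finset.card_powerset, Finset.card_range, Int.card_Icc]
      have h1 : 0 ≤ ⌊T / δ⌋ := Int.floor_nonneg.mpr (by positivity)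
      have h2 : (((⌊T / δ⌋ + 1 - 0).toNat : ℤ) : ℝ) = ((⌊T / δ⌋ + 1 - 0 : ℤ) : ℝ) := by
        rw [Int.toNat_of_nonneg (by linarith)]
      rw [Int.cast_natCast] at h2
      have h3 : ((⌊T / δ⌋ + 1 - 0).toNat : ℝ) < (pairCount b δ K j : ℝ) := by
        rw [h2]
        push_cast
        linarith [Int.floor_le (T / δ)]
      exact_mod_cast h3)
    (by
      rintro ⟨A, u⟩ hx
      rw [Finset.mem_coe, Finset.mem_product, Finset.mem_powerset] at hx
      obtain ⟨hA, hu⟩ := hx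
      obtain ⟨hZ1, hZ2⟩ := hZ u hu
      dsimp only at hA hu ⊢
      have hAj : A ⊆ Finset.Ico 0 j := by
        have := hunion A ∅ hA (Finset.empty_subset _)
        simpa using this
      have hZj : Z u ⊆ Finset.Ico 0 j := by
        have := hunion ∅ (Z u) (Finset.empty_subset _) hZ1
        simpa using this
      rw [Finset.coe_Icc, Set.mem_Icc]
      constructor
      · have h1 : 0 ≤ ⌊(∑ k ∈ A, b k) / δ⌋ := Int.floor_nonneg.mpr (div_nonneg (hnn A hAj) hδ.le)
        have h2 : 0 ≤ u := by
          rw [← hZ2]; exact Int.floor_nonneg.mpr (div_nonneg (hnn _ hZj) hδ.le)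
        omega
      · rw [← hZ2]
        refine (Int.le_floor_add _ _).trans (Int.floor_le_floor ?_)
        rw [← add_div, ← Finset.sum_union (hdisj A _ hA hZ1)]
        exact div_le_div_of_nonneg_right (hsum _ (hunion A _ hA hZ1)) hδ.le)
  rw [Finset.mem_product, Finset.mem_powerset] at hx hy
  obtain ⟨hA, hu⟩ := hx
  obtain ⟨hA', hu'⟩ := hy
  dsimp only at hA hu hA' hu' heq
  obtain ⟨hZ1, hZ2⟩ := hZ u hu
  obtain ⟨hZ1', hZ2'⟩ := hZ u' hu'
  -- With equal large parts, equal images would give `u = u'`.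
  have hAA : A ≠ A' := by
    rintro rfl
    exact hne (by rw [add_left_cancel heq])
  obtain ⟨i₀, hi₀, hi₀K⟩ : ∃ i, ¬ (i ∈ A ↔ i ∈ A') ∧ i < min j K := by
    obtain ⟨i, hi⟩ : ∃ i, ¬ (i ∈ A ↔ i ∈ A') := by
      by_contra hcon
      push Not at hcon
      exact hAA (Finset.ext hcon)
    refine ⟨i, hi, ?_⟩
    by_contra hcon
    exact hi ⟨fun h => absurd (Finset.mem_range.mp (hA h)) hcon,
      fun h => absurd (Finset.mem_range.mp (hA' h)) hcon⟩
  have hex : ∃ i, diffLabels (A ∪ Z u) (A' ∪ Z u') i ≠ 0 := by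
    refine ⟨i₀, diffLabels_ne_zero ?_⟩
    have h1 : i₀ ∉ Z u := fun h => by have := Finset.mem_Ico.mp (hZ1 h); omega
    have h2 : i₀ ∉ Z u' := fun h => by have := Finset.mem_Ico.mp (hZ1' h); omega
    simpa [h1, h2] using hi₀
  set w := diffLabels (A ∪ Z u) (A' ∪ Z u') with hw_def
  have hw : Labels w := labels_diffLabels _ _
  -- The first nonzero label occurs at or before `i₀`, hence at a large item.
  obtain ⟨i, hwi, hmin⟩ : ∃ i, w i ≠ 0 ∧ ∀ k, k < i → w k = 0 :=
    ⟨Nat.find hex, Nat.find_spec hex, fun k hk => not_not.mp (Nat.find_min hex hk)⟩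
  have hiK : i < min j K := by
    by_contra hcon
    have h1 : i₀ ∉ Z u := fun h => by have := Finset.mem_Ico.mp (hZ1 h); omega
    have h2 : i₀ ∉ Z u' := fun h => by have := Finset.mem_Ico.mp (hZ1' h); omega
    exact diffLabels_ne_zero (P := A ∪ Z u) (P' := A' ∪ Z u') (k := i₀)
      (by simpa [h1, h2] using hi₀) (hmin i₀ (by omega))
  have hd : dsum b w i j = (∑ k ∈ A, b k + ∑ k ∈ Z u, b k) -
      (∑ k ∈ A', b k + ∑ k ∈ Z u', b k) := by
    rw [← Finset.sum_union (hdisj A _ hA hZ1), ← Finset.sum_union (hdisj A' _ hA' hZ1'),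
      ← dsum_diffLabels b (hunion A _ hA hZ1) (hunion A' _ hA' hZ1'),
      ← dsum_add b _ (Nat.zero_le i) (by omega : i ≤ j)]
    have : dsum b w 0 i = 0 := Finset.sum_eq_zero fun k hk => by
      rw [hmin k (Finset.mem_Ico.mp hk).2]; simp [sgn]
    rw [← hw_def, this, zero_add]
  -- Each of the four sums exceeds its bucket's lower end by at most `δ`, and these lower ends
  -- cancel.
  have habs : |dsum b w i j| ≤ 2 * δ := by
    have hfl : ∀ x : ℝ, (⌊x / δ⌋ : ℝ) * δ ≤ x ∧ x ≤ (⌊x / δ⌋ : ℝ) * δ + δ := by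
      intro x
      have h1 := (le_div_iff₀ hδ).mp (Int.floor_le (x / δ))
      have h2 := (div_lt_iff₀ hδ).mp (Int.lt_floor_add_one (x / δ))
      constructor <;> linarith
    have heq' : (⌊(∑ k ∈ A, b k) / δ⌋ : ℝ) * δ + (⌊(∑ k ∈ Z u, b k) / δ⌋ : ℝ) * δ =
        (⌊(∑ k ∈ A', b k) / δ⌋ : ℝ) * δ + (⌊(∑ k ∈ Z u', b k) / δ⌋ : ℝ) * δ := by
      rw [← add_mul, ← add_mul, hZ2, hZ2']
      congr 1
      exact_mod_cast heq
    have h1 := hfl (∑ k ∈ A, b k)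
    have h2 := hfl (∑ k ∈ Z u, b k)
    have h3 := hfl (∑ k ∈ A', b k)
    have h4 := hfl (∑ k ∈ Z u', b k)
    rw [hd, abs_le]
    constructor <;> linarith [h1.1, h1.2, h2.1, h2.2, h3.1, h3.2, h4.1, h4.2]
  rcases le_total 0 (dsum b w i j) with h0 | h0
  · exact ⟨i, hiK, w, hw, hwi, h0, (le_abs_self _).trans habs⟩
  · refine ⟨i, hiK, flip w, labels_flip w, flip_ne_zero hw hwi, ?_, ?_⟩
    · rw [dsum_flip]; linarith
    · rw [dsum_flip]; exact (neg_le_abs _).trans habs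

/-- The number of buckets that is sufficient for the labellings of the items in `[l, j)`. -/
theorem hasBuckets_of_subsetBuckets {b : ℕ → ℝ} {δ₀ δ : ℝ} {l K j : ℕ} (hδ₀ : 0 < δ₀)
    (hδ : δ₀ ≤ δ) (hl : l ≤ min j K) :
    HasBuckets b δ l j (3 * 3 ^ (min j K - l) * ((subsetBuckets b δ₀ K j).card : ℝ) ^ 2) := by
  classical
  have hδp : 0 < δ := hδ₀.trans_le hδ
  obtain ⟨F, hF, hFw⟩ := exists_dsums b hl
  set U := subsetBuckets b δ₀ K j with hU
  refine ⟨((F ×ˢ (U ×ˢ U)) ×ˢ Finset.Icc (-1 : ℤ) 1).image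
    fun x => ⌊(x.1.1 + ((x.1.2.1 : ℝ) - x.1.2.2) * δ₀) / δ⌋ + x.2, ?_, ?_⟩
  · have h1 : (((F ×ˢ (U ×ˢ U)) ×ˢ Finset.Icc (-1 : ℤ) 1).image
        fun x => ⌊(x.1.1 + ((x.1.2.1 : ℝ) - x.1.2.2) * δ₀) / δ⌋ + x.2).card ≤
        3 * 3 ^ (min j K - l) * U.card ^ 2 := by
      refine Finset.card_image_le.trans ?_
      rw [Finset.card_product, Finset.card_product, Finset.card_product, Int.card_Icc]
      calc F.card * (U.card * U.card) * (1 + 1 - -1 : ℤ).toNat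
          ≤ 3 ^ (min j K - l) * (U.card * U.card) * 3 := by
            apply Nat.mul_le_mul
            · exact Nat.mul_le_mul_right _ hF
            · decide
        _ = _ := by ring
    exact_mod_cast h1
  · intro w hw
    have hmem : ∀ v : ℕ, ∃ u, u ∈ U ∧ (u : ℝ) * δ₀ ≤ ∑ k ∈ (Finset.Ico K j).filter (w · = v), b k ∧
        ∑ k ∈ (Finset.Ico K j).filter (w · = v), b k < (u : ℝ) * δ₀ + δ₀ := by
      intro v
      refine ⟨_, Finset.mem_image_of_mem _ (Finset.mem_powerset.mpr (Finset.filter_subset (w · = v) _)),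
        ?_, ?_⟩
      · exact (le_div_iff₀ hδ₀).mp (Int.floor_le _)
      · have := (div_lt_iff₀ hδ₀).mp (Int.lt_floor_add_one
          ((∑ k ∈ (Finset.Ico K j).filter (w · = v), b k) / δ₀))
        linarith
    obtain ⟨u₁, hu₁, a₁, b₁⟩ := hmem 1
    obtain ⟨u₂, hu₂, a₂, b₂⟩ := hmem 2
    have hsplit : dsum b w l j = dsum b w l (min j K) +
        (∑ k ∈ (Finset.Ico K j).filter (w · = 1), b k -
          ∑ k ∈ (Finset.Ico K j).filter (w · = 2), b k) := by
      have h1 : dsum b w (min j K) j = ∑ k ∈ Finset.Ico K j, sgn (w k) * b k := by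
        rcases le_total j K with h | h
        · simp [dsum, min_eq_left h, Finset.Ico_eq_empty_of_le h]
        · rw [min_eq_right h]; rfl
      rw [← dsum_add b w hl (min_le_left j K), h1, Finset.sum_filter, Finset.sum_filter,
        ← Finset.sum_sub_distrib]
      congr 1
      refine Finset.sum_congr rfl fun k _ => ?_
      unfold sgn
      split_ifs <;> simp_all
    -- Rounding the small parts of `X` and `Y` to multiples of `δ₀` changes the difference by at
    -- most `δ₀ ≤ δ`, so the bucket moves by at most one; this explains the factor `3`.
    set y := dsum b w l (min j K) + ((u₁ : ℝ) - u₂) * δ₀ with hy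
    have hclose : |dsum b w l j - y| ≤ δ := by
      rw [abs_le]
      constructor <;> linarith
    have hfl : ⌊dsum b w l j / δ⌋ - ⌊y / δ⌋ ∈ Finset.Icc (-1 : ℤ) 1 := by
      have h1 := abs_le.mp hclose
      have h2 : dsum b w l j / δ ≤ y / δ + 1 := by
        rw [div_add_one hδp.ne']
        exact div_le_div_of_nonneg_right (by linarith [h1.2]) hδp.le
      have h3 : y / δ ≤ dsum b w l j / δ + 1 := by
        rw [div_add_one hδp.ne']
        exact div_le_div_of_nonneg_right (by linarith [h1.1]) hδp.le
      have h4 := Int.floor_le_floor h2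
      have h5 := Int.floor_le_floor h3
      rw [Int.floor_add_one] at h4 h5
      rw [Finset.mem_Icc]
      omega
    refine Finset.mem_image.mpr ⟨((dsum b w l (min j K), (u₁, u₂)),
      ⌊dsum b w l j / δ⌋ - ⌊y / δ⌋), ?_, ?_⟩
    · simp only [Finset.mem_product]
      exact ⟨⟨hFw w hw, hu₁, hu₂⟩, hfl⟩
    · simp only [← hy]
      omega

set_option exponentiation.threshold 3000 in
/-- The numerical inequality behind the exponent of the running time. -/
theorem budget_inequality {M ε : ℝ} {l : ℕ} (hM : 1 ≤ M) (hε : 0 < ε)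
    (hMε : M ^ 2067 * ε ^ 1940 = 1) (hl : M < 3 ^ (l + 1)) :
    1 ≤ 4 ^ (l + 1) * M ^ 3 * ε ^ 4 := by
  have h0 : 0 ≤ 4 ^ (l + 1) * M ^ 3 * ε ^ 4 := by positivity
  -- This is `612/485 ≤ log₃ 4`. The exponents of `hMε` arise from `M^(3 + 612/485) ε^4 = 1` by
  -- taking 485th powers: `3 · 485 + 612 = 2067` and `4 · 485 = 1940`.
  have h1 : (3 : ℝ) ^ 612 ≤ 4 ^ 485 := by norm_num
  have h2 : M ^ 612 ≤ (4 ^ (l + 1)) ^ 485 := by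
    calc M ^ 612 ≤ ((3 : ℝ) ^ (l + 1)) ^ 612 := pow_le_pow_left₀ (by linarith) hl.le _
      _ = (3 ^ 612) ^ (l + 1) := by rw [← pow_mul, ← pow_mul, mul_comm]
      _ ≤ (4 ^ 485) ^ (l + 1) := pow_le_pow_left₀ (by positivity) h1 _
      _ = _ := by rw [← pow_mul, ← pow_mul, mul_comm]
  have h3 : (1 : ℝ) ^ 485 ≤ (4 ^ (l + 1) * M ^ 3 * ε ^ 4) ^ 485 := by
    calc (1 : ℝ) ^ 485 = M ^ 2067 * ε ^ 1940 := by rw [hMε, one_pow]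
      _ = M ^ 612 * (M ^ 3) ^ 485 * (ε ^ 4) ^ 485 := by
          rw [← pow_mul, ← pow_mul, ← pow_add]
      _ ≤ (4 ^ (l + 1)) ^ 485 * (M ^ 3) ^ 485 * (ε ^ 4) ^ 485 := by
          have : 0 ≤ (M ^ 3) ^ 485 := by positivity
          have : 0 ≤ (ε ^ 4) ^ 485 := by positivity
          gcongr
      _ = _ := by rw [mul_pow, mul_pow]
  exact (pow_le_pow_iff_left₀ zero_le_one h0 (by norm_num)).mp h3

end SubsetSumRatio

/-! ### Existence of an item for which a moderate budget suffices -/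

namespace SubsetSumRatio

theorem exists_threshold (b : ℕ → ℝ) (n : ℕ) (L : ℝ)
    (hanti : ∀ k k', k < k' → k' < n → b k' < b k) :
    ∃ K, K ≤ n ∧ (∀ k, k < K → L ≤ b k) ∧ ∀ k, K ≤ k → k < n → b k < L := by
  classical
  have hex : ∃ K, n ≤ K ∨ b K < L := ⟨n, Or.inl le_rfl⟩
  refine ⟨Nat.find hex, Nat.find_le (Or.inl le_rfl), fun k hk => ?_, fun k hk hkn => ?_⟩
  · have := Nat.find_min hex hk
    push Not at this
    exact this.2
  · rcases Nat.find_spec hex with h | h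
    · omega
    · rcases hk.eq_or_lt with h1 | h1
      · rwa [← h1]
      · exact (hanti _ _ h1 hkn).trans h

/-- The case of few large items. -/
theorem suffices_of_few_large {b : ℕ → ℝ} {n K l : ℕ} {ε M : ℝ} (hb : ∀ k, k < n → 0 < b k)
    (hn : 2 ≤ n) (hε : 0 < ε) (hM : 1 ≤ M) (hl : (3 : ℝ) ^ l ≤ M) (hKl : K ≤ l + 1)
    (hsmall : ∀ k, K ≤ k → k < n → b k < ε * M * b 0) :
    Suffices b n ε (8000 * n ^ 4 * M) 0 := by
  have hn0 : (1 : ℝ) ≤ n := by exact_mod_cast (by omega : 1 ≤ n)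
  have hb0 := hb 0 (by omega)
  have hn24 : (n : ℝ) ^ 2 ≤ n ^ 4 := pow_le_pow_right₀ hn0 (by norm_num)
  have hn4 : (1 : ℝ) ≤ n ^ 4 := one_le_pow₀ hn0
  have hMn : M ≤ n ^ 4 * M := le_mul_of_one_le_left (by linarith) hn4
  have hMn2 : (n : ℝ) ^ 2 * M ≤ n ^ 4 * M := mul_le_mul_of_nonneg_right hn24 (by linarith)
  refine ⟨by omega, min (l + 1) n, n, by omega, min_le_right _ _, le_rfl, ?_, ?_, Or.inl ⟨rfl, rfl⟩⟩
  · calc (3 : ℝ) ^ min (l + 1) n ≤ 3 ^ (l + 1) :=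
          pow_le_pow_right₀ (by norm_num) (min_le_left _ _)
      _ = 3 * 3 ^ l := by rw [pow_succ]; ring
      _ ≤ 8000 * n ^ 4 * M := by linarith
  · have hδ : 0 < ε * b 0 / 16 / n := by positivity
    -- At most `n` items of size below `ε * M * b 0`, measured in buckets of width `ε * b 0 / 16 /
    -- n`.
    refine (hasBuckets_of_abs_le (R := 16 * n ^ 2 * M) hδ (by positivity) ?_).mono le_rfl le_rfl ?_
    · intro w _
      calc |dsum b w (min (l + 1) n) n|
          ≤ ∑ k ∈ Finset.Ico (min (l + 1) n) n, |sgn (w k) * b k| := Finset.abs_sum_le_sum_abs _ _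
        _ ≤ ∑ k ∈ Finset.Ico (min (l + 1) n) n, ε * M * b 0 := by
            refine Finset.sum_le_sum fun k hk => ?_
            rw [Finset.mem_Ico] at hk
            have h1 := hsmall k (by omega) hk.2
            have h2 := hb k hk.2
            rw [abs_mul, abs_of_pos h2]
            exact (mul_le_of_le_one_left h2.le (abs_sgn_le _)).trans h1.le
        _ ≤ n * (ε * M * b 0) := by
            rw [Finset.sum_const, Nat.card_Ico, nsmul_eq_mul]
            refine mul_le_mul_of_nonneg_right ?_ (by positivity)
            exact_mod_cast Nat.sub_le _ _
        _ = 16 * n ^ 2 * M * (ε * b 0 / 16 / n) := by field_simp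
    · linarith

/-- Of `s + r` large items, `s` go into the first list; leaving them out of the second gains a
factor `4 ^ s`, which `hs` converts into the missing `M ^ 3 * ε ^ 4`. -/
theorem pow_mul_sq_le {x q M ε : ℝ} {r s : ℕ} (hM : 0 < M) (hε : 0 < ε)
    (hs : 1 ≤ 4 ^ s * M ^ 3 * ε ^ 4)
    (hq : 4 ^ (s + r) * q ^ 2 ≤ 2601 * x ^ 4 / (ε ^ 4 * M ^ 2)) :
    3 ^ r * q ^ 2 ≤ 2601 * x ^ 4 * M := by
  have h0 : 0 ≤ M ^ 3 * ε ^ 4 := (mul_pos (pow_pos hM 3) (pow_pos hε 4)).le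
  have h34 : (4 : ℝ) ^ s * 3 ^ r ≤ 4 ^ (s + r) := by
    rw [pow_add]
    exact mul_le_mul_of_nonneg_left (pow_le_pow_left₀ (by norm_num) (by norm_num) r)
      (pow_pos (by norm_num) s).le
  calc (3 : ℝ) ^ r * q ^ 2 = 3 ^ r * q ^ 2 * 1 := (mul_one _).symm
    _ ≤ 3 ^ r * q ^ 2 * (4 ^ s * M ^ 3 * ε ^ 4) :=
        mul_le_mul_of_nonneg_left hs (mul_nonneg (pow_pos (by norm_num) r).le (sq_nonneg q))
    _ = (4 ^ s * 3 ^ r) * (q ^ 2 * (M ^ 3 * ε ^ 4)) := by ring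
    _ ≤ 4 ^ (s + r) * (q ^ 2 * (M ^ 3 * ε ^ 4)) :=
        mul_le_mul_of_nonneg_right h34 (mul_nonneg (sq_nonneg q) h0)
    _ = (4 ^ (s + r) * q ^ 2) * (M ^ 3 * ε ^ 4) := by ring
    _ ≤ (2601 * x ^ 4 / (ε ^ 4 * M ^ 2)) * (M ^ 3 * ε ^ 4) :=
        mul_le_mul_of_nonneg_right hq h0
    _ = 2601 * x ^ 4 * M := by field_simp

/-- The case of many large items. -/
theorem exists_suffices_of_many_large {b : ℕ → ℝ} {n K l : ℕ} {ε M : ℝ}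
    (hb : ∀ k, k < n → 0 < b k) (hanti : ∀ k k', k < k' → k' < n → b k' < b k)
    (hn : 2 ≤ n) (hε : 0 < ε) (hM : 1 ≤ M) (hMε : ε * M ≤ 1) (hl : (3 : ℝ) ^ l ≤ M)
    (hl' : 1 ≤ 4 ^ (l + 1) * M ^ 3 * ε ^ 4) (hKn : K ≤ n) (hKl : l + 1 < K)
    (hlarge : ∀ k, k < K → ε * M * b 0 ≤ b k) :
    ∃ i, Suffices b n ε (8000 * n ^ 4 * M) i := by
  have hn0 : (2 : ℝ) ≤ n := by exact_mod_cast hn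
  have hb0 := hb 0 (by omega)
  have hmax : ∀ k, k < n → b k ≤ b 0 := fun k hk => by
    rcases Nat.eq_zero_or_pos k with rfl | h
    · exact le_rfl
    · exact (hanti 0 k h hk).le
  have hn4 : (1 : ℝ) ≤ n ^ 4 := one_le_pow₀ (by linarith)
  have hMn : M ≤ n ^ 4 * M := le_mul_of_one_le_left (by linarith) hn4
  -- No attempt at a large item uses a smaller width, so this choice serves whichever `i` the
  -- pigeonhole principle produces.
  set δ := ε * (ε * M * b 0) / 16 / n with hδ
  have hδ0 : 0 < δ := by positivity
  set N := n * b 0 / δ + 1 with hN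
  have hN1 : N = 16 * n ^ 2 / (ε ^ 2 * M) + 1 := by
    rw [hN, hδ]; field_simp
  have hε1 : ε ≤ 1 := by
    have : ε * 1 ≤ ε * M := mul_le_mul_of_nonneg_left hM hε.le
    linarith
  have hN2 : N ≤ 17 * n ^ 2 / (ε ^ 2 * M) := by
    have h1 : ε ^ 2 * M ≤ 1 := by
      have : ε * (ε * M) ≤ 1 * 1 := mul_le_mul hε1 hMε (by positivity) zero_le_one
      calc ε ^ 2 * M = ε * (ε * M) := by ring
        _ ≤ 1 := by linarith
    have h2 : 1 ≤ (n : ℝ) ^ 2 / (ε ^ 2 * M) := by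
      rw [one_le_div (by positivity)]
      exact h1.trans (one_le_pow₀ (by linarith))
    rw [hN1]
    have h3 : 17 * (n : ℝ) ^ 2 / (ε ^ 2 * M) =
        16 * n ^ 2 / (ε ^ 2 * M) + n ^ 2 / (ε ^ 2 * M) := by ring
    rw [h3]
    linarith
  have hN0 : 1 ≤ N := by
    rw [hN]
    have : 0 ≤ n * b 0 / δ := by positivity
    linarith
  -- Either the count for all items is within `N`, and the attempt `i = 0` is exhaustive, or `J` is
  -- the first index at which the count exceeds `N`.
  have hmain : ∃ J i, J ≤ n ∧ i < min J K ∧ (pairCount b δ K J : ℝ) ≤ 3 * N ∧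
      ((i = 0 ∧ J = n) ∨ ∃ w, Labels w ∧ w i ≠ 0 ∧ 0 ≤ dsum b w i J ∧ dsum b w i J ≤ 2 * δ) := by
    classical
    by_cases hF : (pairCount b δ K n : ℝ) ≤ N
    · exact ⟨n, 0, le_rfl, by omega, by linarith, Or.inl ⟨rfl, rfl⟩⟩
    · have hex : ∃ j, N < (pairCount b δ K j : ℝ) := ⟨n, not_le.mp hF⟩
      obtain ⟨J, hJ, hJn, hmin⟩ : ∃ J, N < (pairCount b δ K J : ℝ) ∧ J ≤ n ∧
          ∀ j, j < J → (pairCount b δ K j : ℝ) ≤ N :=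
        ⟨Nat.find hex, Nat.find_spec hex, Nat.find_le (not_le.mp hF),
          fun j hj => not_lt.mp (Nat.find_min hex hj)⟩
      obtain ⟨i, hi, hw⟩ := exists_small_difference hb hmax hδ0 hJn hJ
      refine ⟨J, i, hJn, hi, ?_, Or.inr hw⟩
      obtain ⟨j, rfl⟩ : ∃ j, J = j + 1 := ⟨J - 1, by omega⟩
      have h1 := hmin j (by omega)
      have h2 : (pairCount b δ K (j + 1) : ℝ) ≤ 3 * pairCount b δ K j := by
        exact_mod_cast pairCount_succ b δ K j
      linarith
  obtain ⟨J, i, hJn, hi, hcount, hor⟩ := hmain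
  have hiK : i < K := lt_of_lt_of_le hi (min_le_right _ _)
  have hiJ : i < J := lt_of_lt_of_le hi (min_le_left _ _)
  have hbi := hlarge i hiK
  have hδi : δ ≤ ε * b i / 16 / n := by
    rw [hδ]
    gcongr
  refine ⟨i, by omega, min (l + 1) J, J, hiJ, min_le_right _ _, hJn, ?_, ?_, ?_⟩
  · calc (3 : ℝ) ^ min (l + 1) J ≤ 3 ^ (l + 1) :=
          pow_le_pow_right₀ (by norm_num) (min_le_left _ _)
      _ = 3 * 3 ^ l := by rw [pow_succ]; ring
      _ ≤ 8000 * n ^ 4 * M := by linarith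
  · rcases Nat.lt_or_ge (l + 1) J with hlJ | hlJ
    swap
    · rw [min_eq_right hlJ]
      refine (hasBuckets_pow b _ le_rfl).mono le_rfl le_rfl ?_
      simp only [Nat.sub_self, pow_zero]
      linarith
    rw [min_eq_left hlJ.le]
    refine (hasBuckets_of_subsetBuckets hδ0 hδi (le_min hlJ.le hKl.le)).mono le_rfl le_rfl ?_
    set k := min J K with hk
    have hlk : l + 1 ≤ k := le_min hlJ.le hKl.le
    set q : ℝ := ((subsetBuckets b δ K J).card : ℝ) with hq
    have hq0 : 0 ≤ q := by positivity
    -- Here `51 = 3 · 17`. Squaring gives `2601`, and the factor from `hasBuckets_of_subsetBuckets`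
    -- gives `7803 ≤ 8000`.
    have hcq : 2 ^ k * q ≤ 51 * n ^ 2 / (ε ^ 2 * M) := by
      have h1 : (pairCount b δ K J : ℝ) = 2 ^ k * q := by
        rw [pairCount]; push_cast; rfl
      rw [← h1]
      have h2 : 51 * (n : ℝ) ^ 2 / (ε ^ 2 * M) = 3 * (17 * n ^ 2 / (ε ^ 2 * M)) := by ring
      rw [h2]
      linarith
    have hsq : 4 ^ k * q ^ 2 ≤ 2601 * n ^ 4 / (ε ^ 4 * M ^ 2) := by
      calc (4 : ℝ) ^ k * q ^ 2 = (2 ^ k * q) ^ 2 := by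
            rw [mul_pow, ← pow_mul, mul_comm k 2, pow_mul]; norm_num
        _ ≤ (51 * n ^ 2 / (ε ^ 2 * M)) ^ 2 := pow_le_pow_left₀ (by positivity) hcq 2
        _ = _ := by rw [div_pow]; ring
    obtain ⟨r, hr⟩ : ∃ r, k = l + 1 + r := ⟨k - (l + 1), by omega⟩
    have hkr : k - (l + 1) = r := by omega
    rw [hkr]
    have hkey := pow_mul_sq_le (by linarith) hε hl' (hr ▸ hsq)
    nlinarith
  · refine hor.imp_right ?_
    rintro ⟨w, hw, hwi, h0, hd⟩
    refine ⟨w, hw, hwi, h0, hd.trans ?_⟩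
    have hbi0 := hb i (by omega)
    calc 2 * δ ≤ 2 * (ε * b i / 16 / n) := by linarith
      _ = ε / 16 * b i * (2 / n) := by ring
      -- As `n ≥ 2`, the division of the bucket width by `n` absorbs the factor in `2 * δ`.
      _ ≤ ε / 16 * b i * 1 := by
          refine mul_le_mul_of_nonneg_left ?_ (by positivity)
          rw [div_le_one (by positivity)]
          exact hn0
      _ = _ := by ring

theorem exists_suffices {b : ℕ → ℝ} {n : ℕ} {ε M : ℝ}
    (hb : ∀ k, k < n → 0 < b k) (hanti : ∀ k k', k < k' → k' < n → b k' < b k)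
    (hn : 2 ≤ n) (hε : 0 < ε) (hM : 1 ≤ M) (hMε : ε * M ≤ 1)
    (hexp : M ^ 2067 * ε ^ 1940 = 1) :
    ∃ i, Suffices b n ε (8000 * n ^ 4 * M) i := by
  obtain ⟨l, hl, hl'⟩ := exists_nat_pow_near hM (by norm_num : (1 : ℝ) < 3)
  obtain ⟨K, hKn, hlarge, hsmall⟩ := exists_threshold b n (ε * M * b 0) hanti
  rcases Nat.lt_or_ge (l + 1) K with h | h
  · exact exists_suffices_of_many_large hb hanti hn hε hM hMε hl
      (budget_inequality hM hε hexp hl') hKn h hlarge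
  · exact ⟨0, suffices_of_few_large hb hn hε hM hl h hsmall⟩

end SubsetSumRatio

namespace RealRAM
open SubsetSumRatio

/-! ### The program -/

def searchAndDecode : Program := budgetLoop ;; assign 44 (.read 1 zero) ;; decodeLoop

def program : Program :=
  rankLoop ;; assign 14 one ;;
  .cond (.le (.sub (var 13) (.read 3 zero)) (.read 3 zero)) .skip searchAndDecode

/-- The output of the program, in terms of the sorted items `b`. -/
def Solved (A : ℕ → ℝ) (n : ℕ) (ε : ℝ) (m : Memory) : Prop :=
  ∃ (π w : ℕ → ℕ) (b : ℕ → ℝ), (∀ k, k < n → π k < n) ∧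
    (∀ k k', k < n → k' < n → π k = π k' → k = k') ∧ (∀ k, k < n → b k = A (π k)) ∧
    (∀ k k', k < k' → k' < n → b k' < b k) ∧ (∀ k, k < n → m 2 (π k) = w k) ∧
    NearOptimal b n ε w

theorem searchAndDecode_spec {b : ℕ → ℝ} {A : ℕ → ℝ} {π : ℕ → ℕ} {n R K : ℕ} {ε M : ℝ} {m : Memory}
    (hb : ∀ k, k < n → 0 < b k) (hn : 2 ≤ n) (hε : 0 < ε) (hε1 : ε < 1)
    (hR : (1 / 2 : ℝ) ^ R ≤ ε / 16) (hM : 1 ≤ M) (hMε : ε * M ≤ 1)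
    (hexp : M ^ 2067 * ε ^ 1940 = 1) (hK : 8000 * n ^ 4 * M ≤ 2 ^ K)
    (hrk : Ranked A n π m) (hm : Base b n ε m) (h14 : m 14 0 = 1) (h15 : m 15 0 = 0)
    (hbal : b 0 < (∑ k ∈ Finset.Ico 0 n, b k) - b 0) :
    Tri searchAndDecode m (3000 * (n ^ 2 * (R + 1)) * 2 ^ (K + 2) + n * 110 + 30)
      (Solved A n ε) := by
  have hm3 := hm.items
  have hanti : ∀ k k', k < k' → k' < n → b k' < b k := by
    rw [← hm3]; exact hrk.anti
  obtain ⟨i, hsuf⟩ := exists_suffices hb hanti hn hε hM hMε hexp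
  refine Tri.seq (budgetLoop_spec hb (by omega) hε hε1 hR ⟨i, hsuf.mono hK⟩ hm h14 h15)
    (T₂ := n * 110 + 30) ?_ (by linarith)
  rintro m₁ ⟨d1, B, i, l, t, lo, hi, -, hres⟩ hf₁
  obtain ⟨w, hw, h42, h43, hopt⟩ := hres.nearOptimal hb hanti hε hε1 hbal d1
  refine Tri.seq (T₁ := 20) (T₂ := n * 110 + 10)
    (Q₁ := fun m₂ => m₂ = (assign 44 (.read 1 zero)).step m₁)
    (Tri.straight (by decide) 20 (by decide) (by norm_num) rfl) ?_ (by linarith)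
  rintro _ rfl -
  refine (decodeLoop_spec hw hres.i_lt.le hres.l_le hres.t_le hrk.pi_inj ?_ ?_ ?_ ?_ ?_ ?_).mono
    le_rfl ?_
  · simp [Memory.set_apply, hf₁ 1 (by decide), hm.n]
  · simp [Memory.set_apply, hres.m33]
  · simp [Memory.set_apply, hres.m19]
  · simp [Memory.set_apply, h42]
  · simp [Memory.set_apply, h43]
  · intro k hk
    simp [Memory.set_apply, hf₁ 4 (by decide), hrk.index k hk]
  · intro m' hm' _
    exact ⟨π, restrict w i t, b, hrk.pi_lt, hrk.pi_inj, fun k hk => by rw [← hm3, hrk.items k hk],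
      hanti, hm', hopt⟩

theorem program_spec {A : ℕ → ℝ} {n R K : ℕ} {ε M : ℝ} {m : Memory}
    (hA : ∀ k, k < n → 0 < A k) (hinj : ∀ r s, r < n → s < n → A r = A s → r = s)
    (hn : 2 ≤ n) (hε : 0 < ε) (hε1 : ε < 1)
    (hR : (1 / 2 : ℝ) ^ R ≤ ε / 16) (hM : 1 ≤ M) (hMε : ε * M ≤ 1)
    (hexp : M ^ 2067 * ε ^ 1940 = 1) (hK : 8000 * n ^ 4 * M ≤ 2 ^ K)
    (h0 : m 0 = A) (h1 : m 1 0 = n) (h11 : m 1 1 = ε) (hrest : ∀ x, 2 ≤ x → m x 0 = 0) :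
    Tri program m (n * (60 * n + 120) +
      (3000 * (n ^ 2 * (R + 1)) * 2 ^ (K + 2) + n * 110) + 100) (Solved A n ε) := by
  refine Tri.seq (rankLoop_spec hinj h0 h1 (hrest 10 (by norm_num)) (hrest 13 (by norm_num)))
    (T₂ := 3000 * (n ^ 2 * (R + 1)) * 2 ^ (K + 2) + n * 110 + 90) ?_ (by linarith)
  rintro m₁ ⟨π, hrk⟩ hf₁
  refine Tri.seq (T₁ := 10) (T₂ := 3000 * (n ^ 2 * (R + 1)) * 2 ^ (K + 2) + n * 110 + 80)
    (Q₁ := fun m₂ => m₂ = (assign 14 one).step m₁)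
    (Tri.straight (by decide) 10 (by decide) (by norm_num) rfl) ?_ (by linarith)
  rintro _ rfl hf₂
  set m₂ := (assign 14 one).step m₁ with hm₂
  have hrk₂ : Ranked A n π m₂ := by
    refine ⟨hrk.pi_lt, hrk.pi_inj, ?_, ?_, ?_, ?_, ?_⟩
    · rw [hf₂ 3 (by decide)]; exact hrk.items
    · rw [hf₂ 4 (by decide)]; exact hrk.index
    · rw [hf₂ 3 (by decide)]; exact hrk.anti
    · rw [hf₂ 2 (by decide)]; exact hrk.label
    · rw [hf₂ 13 (by decide), hf₂ 3 (by decide)]; exact hrk.total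
  have hb : ∀ k, k < n → 0 < m₂ 3 k := fun k hk => by
    rw [hrk₂.items k hk]; exact hA _ (hrk.pi_lt k hk)
  have hbase : Base (m₂ 3) n ε m₂ := by
    refine ⟨?_, ?_, rfl⟩
    · rw [hf₂ 1 (by decide), hf₁ 1 (by decide), h1]
    · rw [hf₂ 1 (by decide), hf₁ 1 (by decide), h11]
  have htest : (Test.le (.sub (var 13) (.read 3 zero)) (.read 3 zero)).Holds m₂ ↔
      (∑ k ∈ Finset.Ico 0 n, m₂ 3 k) - m₂ 3 0 ≤ m₂ 3 0 := by
    simp only [holds_le, eval_sub, eval_read, eval_const, Int.cast_zero, Nat.floor_zero,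
      hrk₂.total]
  have hT : 0 ≤ 3000 * ((n : ℝ) ^ 2 * (R + 1)) * 2 ^ (K + 2) + n * 110 := by positivity
  refine Tri.cond (T := 3000 * (n ^ 2 * (R + 1)) * 2 ^ (K + 2) + n * 110 + 30) 50 (by decide)
    (fun hc => ?_) (fun hc => ?_) (by push_cast; linarith)
  · refine Tri.straight (by decide) 1 (by decide) (by push_cast; linarith) ?_
    rw [step_skip]
    refine ⟨π, fun k => if k = 0 then 1 else 2, m₂ 3, hrk₂.pi_lt, hrk₂.pi_inj, hrk₂.items,
      hrk₂.anti, fun k hk => ?_, nearOptimal_of_large hb hn hε (htest.mp hc)⟩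
    rw [hrk₂.label k hk]
    push_cast
    rfl
  · refine searchAndDecode_spec hb hn hε hε1 hR hM hMε hexp hK hrk₂ hbase ?_ ?_
      (not_le.mp fun h => hc (htest.mpr h)) |>.mono le_rfl fun _ h _ => h
    · simp [hm₂, Memory.set_apply]
    · rw [hf₂ 15 (by decide), hf₁ 15 (by decide), hrest 15 (by norm_num)]

end RealRAM

namespace SubsetSumRatio

/-! ### From labellings to pairs of sets -/

theorem total_eq {b : ℕ → ℝ} {n : ℕ} {I X : Finset ℝ}
    (hanti : ∀ k k', k < k' → k' < n → b k' < b k)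
    (hI : ∀ x, x ∈ I → ∃ k, k < n ∧ b k = x) (hX : X ⊆ I) :
    total X = ∑ k ∈ Finset.Ico 0 n, if b k ∈ X then b k else 0 := by
  classical
  rw [← Finset.sum_filter]
  have himg : X = ((Finset.Ico 0 n).filter fun k => b k ∈ X).image b := by
    ext x
    rw [Finset.mem_image]
    constructor
    · intro hx
      obtain ⟨k, hk, rfl⟩ := hI x (hX hx)
      exact ⟨k, by simp [hk, hx], rfl⟩
    · rintro ⟨k, hk, rfl⟩
      exact (Finset.mem_filter.mp hk).2
  rw [total]
  conv_lhs => rw [himg]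
  refine Finset.sum_image fun k hk k' hk' h => ?_
  have h1 := (Finset.mem_Ico.mp (Finset.mem_filter.mp hk).1).2
  have h2 := (Finset.mem_Ico.mp (Finset.mem_filter.mp hk').1).2
  rcases lt_trichotomy k k' with h3 | h3 | h3
  · exact absurd h (hanti k k' h3 h2).ne'
  · exact h3
  · exact absurd h (hanti k' k h3 h1).ne

theorem dsum_eq_total_sub {b : ℕ → ℝ} {n : ℕ} {I X Y : Finset ℝ} {w : ℕ → ℕ}
    (hanti : ∀ k k', k < k' → k' < n → b k' < b k)
    (hI : ∀ x, x ∈ I → ∃ k, k < n ∧ b k = x) (hX : X ⊆ I) (hY : Y ⊆ I)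
    (h1 : ∀ k, k < n → (b k ∈ X ↔ w k = 1)) (h2 : ∀ k, k < n → (b k ∈ Y ↔ w k = 2)) :
    dsum b w 0 n = total X - total Y ∧ ssum b w 0 n = total X + total Y := by
  rw [total_eq hanti hI hX, total_eq hanti hI hY, ← Finset.sum_sub_distrib,
    ← Finset.sum_add_distrib]
  constructor <;>
  · refine Finset.sum_congr rfl fun k hk => ?_
    rw [Finset.mem_Ico] at hk
    simp only [h1 k hk.2, h2 k hk.2, sgn]
    split_ifs <;> simp_all

/-- Sum plus and minus absolute difference are twice the larger and twice the smaller total. -/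
theorem ratio_eq {X Y : Finset ℝ} (hX : 0 < total X) (hY : 0 < total Y) :
    ratio X Y = ENNReal.ofReal ((total X + total Y + |total X - total Y|) /
      (total X + total Y - |total X - total Y|)) := by
  rw [ratio, quot, quot, if_neg hX.ne', if_neg hY.ne', ← ENNReal.ofReal_max]
  congr 1
  have key : ∀ x y : ℝ, 0 < x → 0 < y → x ≤ y → max (x / y) (y / x) = y / x := by
    intro x y hx hy h
    exact max_eq_right (((div_le_one hy).mpr h).trans ((one_le_div hx).mpr h))
  rcases le_total (total X) (total Y) with h | h
  · rw [key _ _ hX hY h, abs_of_nonpos (by linarith)]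
    rw [div_eq_div_iff hX.ne' (by linarith)]
    ring
  · rw [max_comm, key _ _ hY hX h, abs_of_nonneg (by linarith)]
    rw [div_eq_div_iff hY.ne' (by linarith)]
    ring

/-- Competitors with a side of total zero have ratio `∞`; for all others, `NearOptimal` is the
required inequality with denominators cleared. -/
theorem isSolutionL_of_nearOptimal {b : ℕ → ℝ} {n : ℕ} {ε : ℝ} {I X Y : Finset ℝ} {w : ℕ → ℕ}
    (hpos : ∀ x ∈ I, 0 < x) (hn : 0 < n) (hε : 0 < ε)
    (hanti : ∀ k k', k < k' → k' < n → b k' < b k)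
    (hI : ∀ x, x ∈ I ↔ ∃ k, k < n ∧ b k = x) (hX : X ⊆ I) (hY : Y ⊆ I)
    (h1 : ∀ k, k < n → (b k ∈ X ↔ w k = 1)) (h2 : ∀ k, k < n → (b k ∈ Y ↔ w k = 2))
    (hw : NearOptimal b n ε w) : IsSolutionL I ε X Y := by
  classical
  have hI' : ∀ x, x ∈ I → ∃ k, k < n ∧ b k = x := fun x => (hI x).mp
  refine ⟨hX, hY, ?_, ?_⟩
  · rw [Finset.disjoint_left]
    intro x hx hy
    obtain ⟨k, hk, rfl⟩ := hI' x (hX hx)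
    have e1 := (h1 k hk).mp hx
    have e2 := (h2 k hk).mp hy
    omega
  obtain ⟨hd, hs⟩ := dsum_eq_total_sub hanti hI' hX hY h1 h2
  obtain ⟨hlt, hopt⟩ := hw
  rw [hd, hs] at hlt hopt
  have hX0 : 0 < total X := by
    have := (abs_lt.mp hlt).1
    linarith
  have hY0 : 0 < total Y := by
    have := (abs_lt.mp hlt).2
    linarith
  have hε' : ENNReal.ofReal (1 + ε) ≠ 0 := by
    rw [Ne, ENNReal.ofReal_eq_zero]; linarith
  rw [← ENNReal.div_le_iff' hε' ENNReal.ofReal_ne_top]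
  refine le_sInf ?_
  rintro _ ⟨X', Y', ⟨hX', hY', hdis, z, hz, hgr⟩, rfl⟩
  rw [ENNReal.div_le_iff' hε' ENNReal.ofReal_ne_top]
  by_cases h0 : total X' = 0 ∨ total Y' = 0
  · have htop : ratio X' Y' = ⊤ := by
      unfold ratio quot
      rcases h0 with h | h <;> simp [h]
    rw [htop, ENNReal.mul_top hε']
    exact le_top
  push Not at h0
  have hX'0 : 0 < total X' := lt_of_le_of_ne
    (Finset.sum_nonneg fun x hx => (hpos x (hX' hx)).le) (Ne.symm h0.1)
  have hY'0 : 0 < total Y' := lt_of_le_of_ne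
    (Finset.sum_nonneg fun x hx => (hpos x (hY' hx)).le) (Ne.symm h0.2)
  let w' : ℕ → ℕ := fun k => if b k ∈ X' then 1 else if b k ∈ Y' then 2 else 0
  have hw' : Labels w' := fun k => by
    simp only [w']; split_ifs <;> norm_num
  have hz0 : z = b 0 := by
    obtain ⟨k, hk, rfl⟩ := hI' z hgr.1
    rcases Nat.eq_zero_or_pos k with rfl | h
    · rfl
    · exact absurd (hgr.2 (Finset.mem_coe.mpr ((hI (b 0)).mpr ⟨0, hn, rfl⟩)))
        (not_le.mpr (hanti 0 k h hk))
  have hw'0 : w' 0 ≠ 0 := by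
    rw [hz0, Finset.mem_union] at hz
    simp only [w']
    split_ifs with g1 g2
    · norm_num
    · norm_num
    · exact absurd hz (by tauto)
  obtain ⟨hd', hs'⟩ := dsum_eq_total_sub (w := w') hanti hI' hX' hY'
    (fun k _ => by simp only [w']; split_ifs <;> simp_all)
    (fun k _ => by
      have hnd : b k ∈ X' → b k ∉ Y' := fun h => Finset.disjoint_left.mp hdis h
      simp only [w']; split_ifs <;> simp_all)
  have h := hopt w' hw' hw'0
  rw [hd', hs'] at h
  rw [ratio_eq hX0 hY0, ratio_eq hX'0 hY'0, ← ENNReal.ofReal_mul (by linarith)]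
  refine ENNReal.ofReal_le_ofReal ?_
  have hlt' : |total X' - total Y'| < total X' + total Y' := by
    rw [abs_lt]; constructor <;> linarith
  rw [mul_div_assoc', div_le_div_iff₀ (by linarith) (by linarith)]
  linarith

end SubsetSumRatio

/-! ### Choice of parameters and the running time -/

namespace SubsetSumRatio

/-- For `x ≥ 1` the number `M = x ^ (1940 / 2067)`. -/
theorem exists_subtable_size {ε : ℝ} (hε : 0 < ε) (hε1 : ε < 1) :
    ∃ M : ℝ, M = (1 / ε) ^ (1940 / 2067 : ℝ) ∧ 1 ≤ M ∧ ε * M ≤ 1 ∧ M ^ 2067 * ε ^ 1940 = 1 := by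
  have hx : 1 ≤ 1 / ε := (one_le_div hε).mpr hε1.le
  have hx0 : 0 ≤ 1 / ε := by linarith
  refine ⟨_, rfl, Real.one_le_rpow hx (by norm_num), ?_, ?_⟩
  · have h : (1 / ε) ^ (1940 / 2067 : ℝ) ≤ (1 / ε) ^ (1 : ℝ) :=
      Real.rpow_le_rpow_of_exponent_le hx (by norm_num)
    rw [Real.rpow_one] at h
    calc ε * (1 / ε) ^ (1940 / 2067 : ℝ) ≤ ε * (1 / ε) := by gcongr
      _ = 1 := mul_one_div_cancel hε.ne'
  · have h : ((1 / ε) ^ (1940 / 2067 : ℝ)) ^ 2067 = (1 / ε) ^ 1940 := by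
      rw [← Real.rpow_natCast, ← Real.rpow_mul hx0, ← Real.rpow_natCast (1 / ε) 1940]
      norm_num
    rw [h, ← mul_pow, one_div_mul_cancel hε.ne', one_pow]

theorem exists_budget_exponent {y : ℝ} (hy : 1 ≤ y) : ∃ K : ℕ, y ≤ 2 ^ K ∧ (2 : ℝ) ^ K ≤ 2 * y := by
  obtain ⟨K, h1, h2⟩ := exists_nat_pow_near hy (one_lt_two : (1 : ℝ) < 2)
  refine ⟨K + 1, h2.le, ?_⟩
  rw [pow_succ]
  linarith

/-- Here `16/ε ≤ 2^R ≤ 32/ε`, and `log x ≤ x^τ / τ` turns the logarithm into an arbitrarily small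
power of `1/ε`. -/
theorem exists_search_depth {ε τ : ℝ} (hε : 0 < ε) (hε1 : ε < 1) (hτ : 0 < τ) :
    ∃ R : ℕ, (1 / 2 : ℝ) ^ R ≤ ε / 16 ∧
      (R : ℝ) + 1 ≤ (2 + (Real.log 32 + 1 / τ) / Real.log 2) * (1 / ε) ^ τ := by
  have hx : 1 ≤ 1 / ε := (one_le_div hε).mpr hε1.le
  have hx0 : 0 < 1 / ε := by linarith
  obtain ⟨R, h1, h2⟩ := exists_budget_exponent (y := 16 * (1 / ε)) (by linarith)
  refine ⟨R, ?_, ?_⟩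
  · rw [one_div, inv_pow, inv_le_comm₀ (by positivity) (by positivity)]
    refine le_trans (le_of_eq ?_) h1
    field_simp
  · have hlog2 : 0 < Real.log 2 := Real.log_pos one_lt_two
    have hlog : R * Real.log 2 ≤ Real.log 32 + (1 / ε) ^ τ / τ := by
      rw [← Real.log_pow]
      calc Real.log (2 ^ R) ≤ Real.log (32 * (1 / ε)) :=
            Real.log_le_log (by positivity) (by linarith)
        _ = Real.log 32 + Real.log (1 / ε) := Real.log_mul (by norm_num) hx0.ne'
        _ ≤ _ := by
          gcongr
          exact Real.log_le_rpow_div hx0.le hτ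
    have hp : 1 ≤ (1 / ε) ^ τ := Real.one_le_rpow hx hτ.le
    have hl32 : 0 ≤ Real.log 32 := Real.log_nonneg (by norm_num)
    have hR : (R : ℝ) ≤ (Real.log 32 + 1 / τ) / Real.log 2 * (1 / ε) ^ τ := by
      rw [div_mul_eq_mul_div, le_div_iff₀ hlog2]
      refine hlog.trans ?_
      rw [add_mul, one_div_mul_eq_div]
      gcongr
      exact le_mul_of_one_le_right hl32 hp
    linarith

/-- The powers combine as `(1/ε)^τ * M = (1/ε)^0.93856`, and `192000000 = 3000 · 4 · 2 · 8000`. -/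
theorem running_time_bound {n R K : ℕ} {ε τ c M : ℝ} (hn : 2 ≤ n) (hε : 0 < ε) (hε1 : ε < 1)
    (hτ : τ = 0.93856 - 1940 / 2067) (hM : M = (1 / ε) ^ (1940 / 2067 : ℝ))
    (hR : (R : ℝ) + 1 ≤ c * (1 / ε) ^ τ) (hK : (2 : ℝ) ^ K ≤ 2 * (8000 * n ^ 4 * M)) :
    (n : ℝ) * (60 * n + 120) + (3000 * (n ^ 2 * (R + 1)) * 2 ^ (K + 2) + n * 110) + 100 ≤
      (192000000 * c + 1000) * (n : ℝ) ^ 6 * (1 / ε) ^ (0.93856 : ℝ) := by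
  have hx : 1 ≤ 1 / ε := (one_le_div hε).mpr hε1.le
  have hx0 : 0 < 1 / ε := by linarith
  have hn1 : (1 : ℝ) ≤ n := by exact_mod_cast (by omega : 1 ≤ n)
  set z := (1 / ε) ^ (0.93856 : ℝ) with hz
  have hz1 : 1 ≤ z := Real.one_le_rpow hx (by norm_num)
  have hmul : (1 / ε) ^ τ * M = z := by
    rw [hM, hz, ← Real.rpow_add hx0, hτ]
    norm_num
  have hn6 : (1 : ℝ) ≤ n ^ 6 := one_le_pow₀ hn1
  have hmain : 3000 * ((n : ℝ) ^ 2 * (R + 1)) * 2 ^ (K + 2) ≤ 192000000 * c * n ^ 6 * z := by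
    have h : ((R : ℝ) + 1) * 2 ^ K ≤ c * (1 / ε) ^ τ * (2 * (8000 * n ^ 4 * M)) :=
      mul_le_mul hR hK (by positivity) (le_trans (by positivity) hR)
    calc 3000 * ((n : ℝ) ^ 2 * (R + 1)) * 2 ^ (K + 2)
        = 12000 * n ^ 2 * ((R + 1) * 2 ^ K) := by ring
      _ ≤ 12000 * n ^ 2 * (c * (1 / ε) ^ τ * (2 * (8000 * n ^ 4 * M))) := by gcongr
      _ = 192000000 * c * n ^ 6 * ((1 / ε) ^ τ * M) := by ring
      _ = _ := by rw [hmul]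
  have h1 : (n : ℝ) ≤ n ^ 6 := le_self_pow₀ hn1 (by norm_num)
  have h2 : (n : ℝ) ^ 2 ≤ n ^ 6 := pow_le_pow_right₀ hn1 (by norm_num)
  have h6 : (n : ℝ) ^ 6 ≤ n ^ 6 * z := le_mul_of_one_le_right (by positivity) hz1
  linarith

end SubsetSumRatio

/-! ### The output as a pair of sets, and the theorem -/

namespace RealRAM
open SubsetSumRatio

theorem mem_output_iff {n : ℕ} {a : Fin n → ℝ} (ha : Function.Injective a) {m : Memory} {v : ℝ}
    (r : Fin n) : a r ∈ output a m v ↔ m 2 r = v := by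
  classical
  simp [output, ha.eq_iff]

theorem output_subset {n : ℕ} {a : Fin n → ℝ} {I : Finset ℝ} (hI : Set.range a = (I : Set ℝ))
    {m : Memory} {v : ℝ} : output a m v ⊆ I := by
  classical
  intro x hx
  rw [output, Finset.mem_image] at hx
  obtain ⟨r, -, rfl⟩ := hx
  exact Finset.mem_coe.mp (hI ▸ Set.mem_range_self r)

theorem Solved.isSolutionL {n : ℕ} {a : Fin n → ℝ} {I : Finset ℝ} {ε : ℝ} {m : Memory}
    (ha : Function.Injective a) (hI : Set.range a = (I : Set ℝ)) (hpos : ∀ x ∈ I, 0 < x)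
    (hn : 0 < n) (hε : 0 < ε) (h : Solved (input a ε 0) n ε m) :
    IsSolutionL I ε (output a m 1) (output a m 2) := by
  obtain ⟨π, w, b, hπ, hinj, hb, hanti, hm, hopt⟩ := h
  have hb' : ∀ k (hk : k < n), b k = a ⟨π k, hπ k hk⟩ := fun k hk => by
    rw [hb k hk]; simp [input, hπ k hk]
  have hmem : ∀ k, k < n → ∀ v : ℕ, b k ∈ output a m v ↔ w k = v := fun k hk v => by
    rw [hb' k hk, mem_output_iff ha, hm k hk, Nat.cast_inj]
  have hmaps : Set.MapsTo π (Finset.range n) (Finset.range n) := fun k hk => by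
    simpa using hπ k (by simpa using hk)
  have hsurj := Finset.surjOn_of_injOn_of_card_le (s := Finset.range n) π hmaps
    (fun k hk k' hk' => hinj k k' (by simpa using hk) (by simpa using hk')) le_rfl
  refine isSolutionL_of_nearOptimal hpos hn hε hanti (fun x => ?_) (output_subset hI)
    (output_subset hI) (fun k hk => by exact_mod_cast hmem k hk 1)
    (fun k hk => by exact_mod_cast hmem k hk 2) hopt
  rw [← Finset.mem_coe, ← hI]
  constructor
  · rintro ⟨r, rfl⟩
    obtain ⟨k, hk, hkr⟩ := hsurj (by simp : (r : ℕ) ∈ (Finset.range n : Set ℕ))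
    have hk' : k < n := by simpa using hk
    exact ⟨k, hk', by rw [hb' k hk']; congr 1; exact Fin.ext hkr⟩
  · rintro ⟨k, hk, rfl⟩
    exact ⟨_, (hb' k hk).symm⟩

end RealRAM

theorem mainTheorem3 :
    ∃ (p : RealRAM.Program) (C : ℝ) (k : ℕ),
      ∀ (I : Finset ℝ) (n : ℕ) (a : Fin n → ℝ) (ε : ℝ),
        2 ≤ n → (∀ x ∈ I, 0 < x) → Function.Injective a → Set.range a = (I : Set ℝ) →
        0 < ε → ε < 1 →
        ∃ (t : ℕ) (m : RealRAM.Memory),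
          RealRAM.Runs p (RealRAM.input a ε) t m ∧
          (t : ℝ) ≤ C * (n : ℝ) ^ k * (1 / ε) ^ (0.93856 : ℝ) ∧
          SubsetSumRatio.IsSolutionL I ε (RealRAM.output a m 1) (RealRAM.output a m 2) := by
  -- The positive gap `τ` between the two exponents is reserved for the number of bisection steps.
  obtain ⟨τ, hτ⟩ : ∃ τ : ℝ, τ = 0.93856 - 1940 / 2067 := ⟨_, rfl⟩
  refine ⟨RealRAM.program,
    192000000 * (2 + (Real.log 32 + 1 / τ) / Real.log 2) + 1000, 6, ?_⟩
  intro I n a ε hn hpos ha hI hε hε1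
  obtain ⟨M, hM, hM1, hMε, hexp⟩ := SubsetSumRatio.exists_subtable_size hε hε1
  obtain ⟨R, hR, hR'⟩ := SubsetSumRatio.exists_search_depth hε hε1
    (show 0 < τ by rw [hτ]; norm_num)
  have hn1 : (1 : ℝ) ≤ n ^ 4 := one_le_pow₀ (by exact_mod_cast (by omega : 1 ≤ n))
  obtain ⟨K, hK, hK'⟩ := SubsetSumRatio.exists_budget_exponent
    (y := 8000 * (n : ℝ) ^ 4 * M) (by nlinarith)
  have hA : ∀ r (hr : r < n), RealRAM.input a ε 0 r = a ⟨r, hr⟩ := fun r hr => by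
    simp [RealRAM.input, hr]
  obtain ⟨t, m, hrun, ht, hsol, -⟩ := RealRAM.program_spec (m := RealRAM.input a ε)
    (A := RealRAM.input a ε 0)
    (fun r hr => by
      rw [hA r hr]; exact hpos _ (Finset.mem_coe.mp (hI ▸ Set.mem_range_self _)))
    (fun r s hr hs h => by
      rw [hA r hr, hA s hs] at h; exact congrArg Fin.val (ha h))
    hn hε hε1 hR hM1 hMε hexp hK rfl (by simp [RealRAM.input]) (by simp [RealRAM.input])
    (fun x hx => by
      simp [RealRAM.input, show x ≠ 0 by omega, show x ≠ 1 by omega])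
  exact ⟨t, m, hrun, ht.trans (SubsetSumRatio.running_time_bound hn hε hε1 hτ hM hR' hK'),
    hsol.isSolutionL ha hI hpos (by omega) hε⟩
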